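/- Let $V,H$ be real Hilbert spaces forming a Gelfand triple $V\hookrightarrow H\cong H^*\hookrightarrow V^*$, where $V\hookrightarrow H$ is dense, continuous and compact, and write $\|\cdot\|=\|\cdot\|_H$. Let $a\colon V\times V\to\mathbb R$ be a continuous bilinear form such that, for some $\alpha_0>0$ and $\omega_0\ge 0$, $a(v,v)+\omega_0\|v\|^2\ge\alpha_0\|v\|_V^2$ for all $v\in V$; let $A\colon V\to V^*$, $\langle Ay,v\rangle=a(y,v)$, and let $A^*\colon V\to V^*$, $\langle A^*p,v\rangle=a(v,p)$. Let $(\omega,\varrho)$ be a measure space, $B\colon L^2(\omega)\to V^*$ linear and continuous, $y_0,y_d\in H$, $\delta_0>0$, and $u_a,u_b\in L^\infty(\omega)$ with $u_a<u_b$ a.e. Assume that $U_{ad}=\{u\in L^2(\omega): u_a\le u\le u_b \text{ a.e.}\}$ is nonempty and bounded in $L^2(\omega)$ (boundedness is automatic if $\varrho(\omega)<\infty$). For $T>0$ let $U_{ad}(0,T)=\{u\in L^2((0,T);L^2(\omega)): u(t)\in U_{ad}\text{ for a.e. }t\in(0,T)\}$ and $W(0,T)=L^2((0,T);V)\cap H^1((0,T);V^*)\subset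 C([0,T];H)$. For $T>0$ define the minimal distance value function $$\delta(T)=\inf\{\|y[u](T)-y_d\|-\delta_0 : u\in U_{ad}(0,T)\},$$ where $y[u]\in W(0,T)$ solves $\partial_t y+Ay=Bu$ on $(0,T)$, $y(0)=y_0$. For $\nu>0$ and $u\in U_{ad}(0,1)$ let $S(\nu,u)\in W(0,1)$ be the solution $y$ of $\partial_t y+\nu Ay=\nu Bu$ on $(0,1)$, $y(0)=y_0$, and let $\bar u(\nu)\subset U_{ad}(0,1)$ be the set of minimizers of $u\mapsto\|S(\nu,u)(1)-y_d\|$ over $U_{ad}(0,1)$. Let $\nu>0$ with $\delta(\nu)>-\delta_0$. Then $\delta(\cdot)$ is directionally differentiable at $\nu$, and its directional derivatives in the directions $\pm1$, $$\mathrm d^{\pm}\delta(\nu)=\lim_{\tau\downarrow0}\frac{\delta(\nu\pm\tau)-\delta(\nu)}{\tau},$$ satisfy $$\mathrm d^{\pm}\delta(\nu)=\min_{u\in\bar u(\nu)}\ \pm\int_0^1\langle Bu-Ay,\,p\rangle\,dt$$ (in particular the minima are attained), where $y=S(\nu,u)$ and $p\in W(0,1)$ solves $-\partial_t p+\nu A^*p=0$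 on $(0,1)$, $p(1)=(y(1)-y_d)/\|y(1)-y_d\|$. If additionally the value of the integral $\int_0^1\langle Bu-Ay,p\rangle\,dt$ is the same for all $u\in\bar u(\nu)$, then $\delta(\cdot)$ is continuously differentiable at $\nu$, i.e. $\delta$ is $C^1$ in a neighbourhood of $\nu$. -/

import Mathlib

open MeasureTheory Set Filter Topology

noncomputable section

/-- `L²(0,T;X)`, as a Bochner space. -/
abbrev L2Time (T : ℝ) (X : Type*) [NormedAddCommGroup X] : Type _ :=
  Lp X 2 (volume.restrict (Ioo (0 : ℝ) T))

/-- The data of the control problem. `V` and `H` are the spaces of the Gelfand triple,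
`V* = StrongDual ℝ V`, and `ρ` is the measure on the control domain `Ω`; the assumptions on the
data are stated separately. -/
structure ControlSystem (V H : Type*) [NormedAddCommGroup V] [InnerProductSpace ℝ V]
    [NormedAddCommGroup H] [InnerProductSpace ℝ H]
    {Ω : Type*} [MeasurableSpace Ω] (ρ : Measure Ω) where
  /-- the embedding `V ↪ H` -/
  emb : V →L[ℝ] H
  /-- the continuous bilinear form; as a map `V → V*` it is the operator `A` -/
  a : V →L[ℝ] StrongDual ℝ V
  /-- the control operator `B : L²(Ω, ρ) → V*` -/
  B : Lp ℝ 2 ρ →L[ℝ] StrongDual ℝ V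
  /-- the initial state -/
  y₀ : H
  /-- the desired state -/
  yd : H
  /-- the radius of the target ball -/
  δ₀ : ℝ
  /-- the lower control bound in `L^∞(Ω, ρ)` -/
  ua : Lp ℝ ⊤ ρ
  /-- the upper control bound in `L^∞(Ω, ρ)` -/
  ub : Lp ℝ ⊤ ρ

namespace ControlSystem

variable {V H : Type*} [NormedAddCommGroup V] [InnerProductSpace ℝ V]
  [NormedAddCommGroup H] [InnerProductSpace ℝ H]
  {Ω : Type*} [MeasurableSpace Ω] {ρ : Measure Ω}

/-- The embedding `V ↪ H ≅ H* ↪ V*`, i.e. `⟨toDual v, w⟩ = (v, w)_H`. -/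
def toDual (P : ControlSystem V H ρ) : V →L[ℝ] StrongDual ℝ V :=
  ((ContinuousLinearMap.compL ℝ V H ℝ).flip P.emb).comp ((innerSL ℝ).comp P.emb)

theorem toDual_apply (P : ControlSystem V H ρ) (v w : V) :
    P.toDual v w = inner ℝ (P.emb v) (P.emb w) := rfl

/-- `V ↪ H` is injective with dense range and compact, so that `V ↪ H ≅ H* ↪ V*` is a Gelfand
triple with compact first embedding. -/
structure IsGelfandTriple (P : ControlSystem V H ρ) : Prop where
  injective : Function.Injective P.emb
  dense : DenseRange P.emb
  compact : IsCompactOperator P.emb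

/-- The Gårding inequality. -/
def Garding (P : ControlSystem V H ρ) : Prop :=
  ∃ α₀ ω₀ : ℝ, 0 < α₀ ∧ 0 ≤ ω₀ ∧ ∀ v : V, α₀ * ‖v‖ ^ 2 ≤ P.a v v + ω₀ * ‖P.emb v‖ ^ 2

/-- The set `U_ad` of admissible control values. -/
def Uad (P : ControlSystem V H ρ) : Set (Lp ℝ 2 ρ) :=
  {u | ∀ᵐ x ∂ρ, P.ua x ≤ u x ∧ u x ≤ P.ub x}

/-- The set `U_ad(0,T)` of admissible controls. -/
def UadTime (P : ControlSystem V H ρ) (T : ℝ) : Set (L2Time T (Lp ℝ 2 ρ)) :=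
  {u | ∀ᵐ t ∂(volume.restrict (Ioo (0 : ℝ) T)), u t ∈ P.Uad}

/-- `y ∈ L²(0,T;V)` has the distributional time derivative `g ∈ L²(0,T;V*)`. -/
def HasWeakDeriv (P : ControlSystem V H ρ) (T : ℝ) (y : L2Time T V)
    (g : L2Time T (StrongDual ℝ V)) : Prop :=
  ∀ φ : ℝ → ℝ, ContDiff ℝ (⊤ : ℕ∞) φ → HasCompactSupport φ → tsupport φ ⊆ Ioo 0 T →
    ∫ t in Ioo 0 T, deriv φ t • P.toDual (y t) = -∫ t in Ioo 0 T, φ t • g t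

/-- `y ∈ W(0,T) = L²(0,T;V) ∩ H¹(0,T;V*)`, `g = ∂ₜ y`, and `c` is, on `[0,T]`, the representative
of `y` in `C([0,T];H)`; thus the trace `y(t)` is `c t`. -/
structure IsW (P : ControlSystem V H ρ) (T : ℝ) (y : L2Time T V)
    (g : L2Time T (StrongDual ℝ V)) (c : ℝ → H) : Prop where
  weakDeriv : P.HasWeakDeriv T y g
  continuousOn : ContinuousOn c (Icc 0 T)
  ae_eq : ∀ᵐ t ∂(volume.restrict (Ioo (0 : ℝ) T)), c t = P.emb (y t)

/-- `y` (with continuous representative `c`) solves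
`∂ₜ y + ν A y = ν B u` on `(0,T)`, `y(0) = y₀`. -/
def IsState (P : ControlSystem V H ρ) (T ν : ℝ) (u : L2Time T (Lp ℝ 2 ρ))
    (y : L2Time T V) (c : ℝ → H) : Prop :=
  ∃ g : L2Time T (StrongDual ℝ V), P.IsW T y g c ∧
    (∀ᵐ t ∂(volume.restrict (Ioo (0 : ℝ) T)), g t + ν • P.a (y t) = ν • P.B (u t)) ∧
    c 0 = P.y₀

/-- `p` solves `-∂ₜ p + ν A* p = 0` on `(0,1)`, `p(1) = p₁`. -/
def IsAdjoint (P : ControlSystem V H ρ) (ν : ℝ) (p₁ : H) (p : L2Time 1 V) : Prop :=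
  ∃ (g : L2Time 1 (StrongDual ℝ V)) (c : ℝ → H), P.IsW 1 p g c ∧
    (∀ᵐ t ∂(volume.restrict (Ioo (0 : ℝ) 1)), -g t + ν • P.a.flip (p t) = 0) ∧
    c 1 = p₁

/-- The minimal distance value function
`δ(T) = inf {‖y[u](T) - y_d‖ - δ₀ : u ∈ U_ad(0,T)}`, where `y[u]` solves
`∂ₜ y + A y = B u` on `(0,T)`, `y(0) = y₀`. -/
def delta (P : ControlSystem V H ρ) (T : ℝ) : ℝ :=
  sInf {r : ℝ | ∃ u ∈ P.UadTime T, ∃ (y : L2Time T V) (c : ℝ → H),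
    P.IsState T 1 u y c ∧ r = ‖c T - P.yd‖ - P.δ₀}

/-- The set `ū(ν)` of minimizers of `‖S(ν,u)(1) - y_d‖` over `u ∈ U_ad(0,1)`, where
`y = S(ν,u)` solves the state equation transformed to `(0,1)`. -/
def ubar (P : ControlSystem V H ρ) (ν : ℝ) : Set (L2Time 1 (Lp ℝ 2 ρ)) :=
  {u | u ∈ P.UadTime 1 ∧ ∃ (y : L2Time 1 V) (c : ℝ → H), P.IsState 1 ν u y c ∧
    ∀ u' ∈ P.UadTime 1, ∀ (y' : L2Time 1 V) (c' : ℝ → H), P.IsState 1 ν u' y' c' →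
      ‖c 1 - P.yd‖ ≤ ‖c' 1 - P.yd‖}

/-- The values `∫₀¹ ⟨B u - A y, p⟩ dt`, where `u ∈ ū(ν)`, `y = S(ν,u)` and `p` is the adjoint state
with terminal value `(y(1) - y_d) / ‖y(1) - y_d‖`. -/
def derivValues (P : ControlSystem V H ρ) (ν : ℝ) : Set ℝ :=
  {r | ∃ u ∈ P.ubar ν, ∃ (y : L2Time 1 V) (c : ℝ → H) (p : L2Time 1 V),
    P.IsState 1 ν u y c ∧
    P.IsAdjoint ν (‖c 1 - P.yd‖⁻¹ • (c 1 - P.yd)) p ∧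
    r = ∫ t in Ioo (0 : ℝ) 1, (P.B (u t) - P.a (y t)) (p t)}

end ControlSystem

/-- `d` is the directional derivative of `f` at `x` in direction `e`. -/
def HasDirDerivAt (f : ℝ → ℝ) (x e d : ℝ) : Prop :=
  Tendsto (fun τ : ℝ => (f (x + τ * e) - f x) / τ) (𝓝[>] 0) (𝓝 d)

end

/-! After rescaling time to `(0,1)`, the claim concerns the optimal distance `minDist`, which is `δ
+ δ₀`, near a parameter where it is positive. The proof traps it at `ν` between functions that touch
it there from above and from below and are differentiable at `ν`. It is then differentiable itself,
and all these functions share its slope.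

From above, an optimal control is frozen and the parameter varies. The first-order change of the
final state, tested with the adjoint state, is the integral of the theorem, so every element of
`derivValues ν` is the slope of a quadratic upper bound (`exists_semiconcave`, by way of
`exists_expansion`).

From below, the adjoint solution is frozen instead. The problem is autonomous, so one solution `(z,
e)` of `∂ₜ z + A* z = 0`, started from the unit normal at an optimal final state, serves all
horizons at once. Green's formula turns it into `dualFun`, that is `(y₀, e(μ)) - (y_d, e(0)) + ∫₀^μ
h(z(s)) ds` with `h(q) = inf {⟨B v, q⟩ : v ∈ U_ad}`. This is a lower bound for every `μ`
(`dualFun_le`) and is exact at `ν` by the minimum principle (`dualFun_eq`). It is differentiable at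
`ν` because the homogeneous equation smooths: `z` has a limit in `V` at `ν` off a null set
(`exists_tendsto_ae`) and `h` is Lipschitz, while `(y₀, e(μ))` is covered by the expansion for the
zero control.

Hence `derivValues ν` is a single number, the derivative, and both minima are taken over one point.
The quadratic upper bound holds with locally uniform constants, and a differentiable function with
such bounds has a continuous derivative (`contDiffAt_one_of_semiconcave`).

The parabolic theory rests on `C¹` approximation. By the energy estimate and the density of the
pairs `(∂ₜ y + A y, y(0))` in `L²(0,T;V*) × H`, existence, estimates and Green's formula pass from
`C¹` functions to weak solutions. Uniqueness comes from integrating the equation in time until the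
solution is `C¹`. -/

noncomputable section

/-- Lebesgue measure on the time interval `(0,T)`. -/
abbrev timeMeasure (T : ℝ) : Measure ℝ := volume.restrict (Ioo (0 : ℝ) T)

/-! ### Square-integrable functions on a time interval. -/

section Calculus

variable {E : Type*} [NormedAddCommGroup E]

theorem norm_toLp_sq {α : Type*} [MeasurableSpace α] {μ : Measure α} {f : α → E}
    (hf : MemLp f 2 μ) : ‖hf.toLp f‖ ^ 2 = ∫ s, ‖f s‖ ^ 2 ∂μ := by
  rw [Lp.norm_toLp, hf.eLpNorm_eq_integral_rpow_norm two_ne_zero ENNReal.ofNat_ne_top]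
  have h0 : 0 ≤ ∫ s, ‖f s‖ ^ 2 ∂μ := integral_nonneg fun _ => by positivity
  rw [ENNReal.toReal_ofReal (by positivity)]
  simp only [ENNReal.toReal_ofNat, Real.rpow_ofNat]
  rw [← Real.rpow_natCast, ← Real.rpow_mul h0]
  norm_num

theorem integral_timeMeasure [NormedSpace ℝ E] {T : ℝ} (hT : 0 ≤ T) (f : ℝ → E) :
    ∫ s, f s ∂(timeMeasure T) = ∫ s in (0 : ℝ)..T, f s := by
  rw [intervalIntegral.integral_of_le hT, integral_Ioc_eq_integral_Ioo]

theorem intervalIntegrable_of_integrable {T : ℝ} {f : ℝ → E} (hf : Integrable f (timeMeasure T))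
    {a b : ℝ} (ha : a ∈ Icc 0 T) (hb : b ∈ Icc 0 T) : IntervalIntegrable f volume a b := by
  have h : IntervalIntegrable f volume 0 T := by
    rw [intervalIntegrable_iff_integrableOn_Ioo_of_le (ha.1.trans ha.2)]
    exact hf
  refine h.mono_set ?_
  rw [uIcc_of_le (ha.1.trans ha.2)]
  exact uIcc_subset_Icc ha hb

theorem _root_.Continuous.memLp_timeMeasure {f : ℝ → E} (hf : Continuous f) (T : ℝ) :
    MemLp f 2 (timeMeasure T) := by
  obtain ⟨C, hC⟩ := (isCompact_Icc (a := 0) (b := T)).exists_bound_of_continuousOn hf.continuousOn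
  refine MemLp.of_bound hf.aestronglyMeasurable C ?_
  filter_upwards [ae_restrict_mem measurableSet_Ioo] with t ht
  exact hC t (Ioo_subset_Icc_self ht)

end Calculus

/-! ### Gårding's inequality and the energy estimate for `C¹` functions. -/

variable {V H : Type*} [NormedAddCommGroup V] [InnerProductSpace ℝ V]
  [NormedAddCommGroup H] [InnerProductSpace ℝ H]

/-- The map `V → V*`, `⟨gelfandMap j v, w⟩ = (j v, j w)_H`. -/
def gelfandMap (j : V →L[ℝ] H) : V →L[ℝ] StrongDual ℝ V :=
  ((ContinuousLinearMap.compL ℝ V H ℝ).flip j).comp ((innerSL ℝ).comp j)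

theorem gelfandMap_apply (j : V →L[ℝ] H) (v w : V) :
    gelfandMap j v w = inner ℝ (j v) (j w) := rfl

/-- The Gårding inequality for `A` with constants `α`, `ω`. -/
structure GardingWith (j : V →L[ℝ] H) (A : V →L[ℝ] StrongDual ℝ V) (α ω : ℝ) : Prop where
  pos : 0 < α
  nonneg : 0 ≤ ω
  le : ∀ v, α * ‖v‖ ^ 2 ≤ A v v + ω * ‖j v‖ ^ 2

theorem GardingWith.flip {j : V →L[ℝ] H} {A : V →L[ℝ] StrongDual ℝ V} {α ω : ℝ}
    (h : GardingWith j A α ω) : GardingWith j A.flip α ω := ⟨h.pos, h.nonneg, h.le⟩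

theorem GardingWith.smul {j : V →L[ℝ] H} {A : V →L[ℝ] StrongDual ℝ V} {α ω : ℝ}
    (h : GardingWith j A α ω) {l : ℝ} (hl : 0 < l) :
    GardingWith j (l • A) (l * α) (l * ω) := by
  refine ⟨mul_pos hl h.pos, mul_nonneg hl.le h.nonneg, fun v => ?_⟩
  have := mul_le_mul_of_nonneg_left (h.le v) hl.le
  simp only [_root_.smul_apply, smul_eq_mul]
  linarith

theorem GardingWith.mono {j : V →L[ℝ] H} {A : V →L[ℝ] StrongDual ℝ V} {α ω α' ω' : ℝ}
    (h : GardingWith j A α ω) (hα : 0 < α') (h1 : α' ≤ α) (h2 : ω ≤ ω') :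
    GardingWith j A α' ω' :=
  ⟨hα, h.nonneg.trans h2, fun v => by
    have := h.le v
    have := mul_le_mul_of_nonneg_right h1 (sq_nonneg ‖v‖)
    have := mul_le_mul_of_nonneg_right h2 (sq_nonneg ‖j v‖)
    linarith⟩

/-- Test the equation with `y` and absorb the right-hand side by Young's inequality with weight `α`.
The factor `exp(-2ωt)` compensates the lower-order term of Gårding's inequality, which makes the
function `W` below nonincreasing. -/
theorem energy_estimate_of_contDiff {j : V →L[ℝ] H} {A : V →L[ℝ] StrongDual ℝ V} {α ω : ℝ}
    (hA : GardingWith j A α ω) {y : ℝ → V} (hy : ContDiff ℝ 1 y) {T : ℝ} (hT : 0 ≤ T) :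
    ‖j (y T)‖ ^ 2 + α * ∫ s in (0 : ℝ)..T, ‖y s‖ ^ 2 ≤
      Real.exp (2 * ω * T) * (‖j (y 0)‖ ^ 2 +
        α⁻¹ * ∫ s in (0 : ℝ)..T, ‖gelfandMap j (deriv y s) + A (y s)‖ ^ 2) := by
  have hα := hA.pos
  have hω := hA.nonneg
  have hyc : Continuous y := hy.continuous
  have hy'c : Continuous (deriv y) := hy.continuous_deriv le_rfl
  have hd : ∀ t, HasDerivAt y (deriv y t) t := fun t => (hy.differentiable one_ne_zero t).hasDerivAt
  set f : ℝ → StrongDual ℝ V := fun s => gelfandMap j (deriv y s) + A (y s) with hf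
  have hfc : Continuous f := by fun_prop
  set k : ℝ → ℝ := fun s => Real.exp (-(2 * ω * s)) * (α * ‖y s‖ ^ 2 - α⁻¹ * ‖f s‖ ^ 2) with hk
  have hkc : Continuous k := by fun_prop
  set W : ℝ → ℝ := fun t => Real.exp (-(2 * ω * t)) * ‖j (y t)‖ ^ 2 + ∫ s in (0 : ℝ)..t, k s with hW
  have hWd : ∀ t, HasDerivAt W (Real.exp (-(2 * ω * t)) * (-(2 * ω)) * ‖j (y t)‖ ^ 2 +
      Real.exp (-(2 * ω * t)) * (2 * inner ℝ (j (y t)) (j (deriv y t))) + k t) t := by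
    intro t
    have h1 : HasDerivAt (fun t : ℝ => Real.exp (-(2 * ω * t)))
        (Real.exp (-(2 * ω * t)) * (-(2 * ω))) t := by
      have : HasDerivAt (fun t : ℝ => -(2 * ω * t)) (-(2 * ω)) t := by
        simpa using ((hasDerivAt_id t).const_mul (2 * ω)).fun_neg
      exact this.exp
    have h2 : HasDerivAt (fun t => ‖j (y t)‖ ^ 2) (2 * inner ℝ (j (y t)) (j (deriv y t))) t :=
      (j.hasFDerivAt.comp_hasDerivAt t (hd t)).norm_sq
    have h3 : HasDerivAt (fun t => ∫ s in (0 : ℝ)..t, k s) (k t) t :=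
      intervalIntegral.integral_hasDerivAt_right (hkc.intervalIntegrable _ _)
        hkc.aestronglyMeasurable.stronglyMeasurableAtFilter hkc.continuousAt
    exact (h1.mul h2).add h3
  have hWa : Antitone W := by
    refine antitone_of_hasDerivAt_nonpos hWd fun t => ?_
    have hg := hA.le (y t)
    have h1 : inner ℝ (j (y t)) (j (deriv y t)) = f t (y t) - A (y t) (y t) := by
      rw [hf]; simp [gelfandMap_apply, real_inner_comm]
    have h2 : f t (y t) ≤ ‖f t‖ * ‖y t‖ := (le_abs_self _).trans ((f t).le_opNorm _)
    have h3 : 2 * (‖f t‖ * ‖y t‖) ≤ α * ‖y t‖ ^ 2 + α⁻¹ * ‖f t‖ ^ 2 := by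
      have : 0 ≤ α⁻¹ * (α * ‖y t‖ - ‖f t‖) ^ 2 := by positivity
      have h : α⁻¹ * (α * ‖y t‖ - ‖f t‖) ^ 2
          = α * ‖y t‖ ^ 2 + α⁻¹ * ‖f t‖ ^ 2 - 2 * (‖f t‖ * ‖y t‖) := by
        field_simp; ring
      linarith
    have h4 : Real.exp (-(2 * ω * t)) * (-(2 * ω)) * ‖j (y t)‖ ^ 2 +
      Real.exp (-(2 * ω * t)) * (2 * inner ℝ (j (y t)) (j (deriv y t))) + k t
      = Real.exp (-(2 * ω * t)) * (-(2 * ω) * ‖j (y t)‖ ^ 2 + 2 * (f t (y t) - A (y t) (y t))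
        + (α * ‖y t‖ ^ 2 - α⁻¹ * ‖f t‖ ^ 2)) := by
      rw [hk, h1]; ring
    rw [h4]
    exact mul_nonpos_of_nonneg_of_nonpos (Real.exp_pos _).le (by linarith)
  have hle := hWa hT
  have hexp : ∀ s ∈ Icc 0 T, Real.exp (-(2 * ω * T)) ≤ Real.exp (-(2 * ω * s)) ∧
      Real.exp (-(2 * ω * s)) ≤ 1 := fun s hs => by
    refine ⟨Real.exp_le_exp.2 ?_, Real.exp_le_one_iff.2 ?_⟩
    · nlinarith [hs.2]
    · have := mul_nonneg hω hs.1; linarith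
  have hint : Real.exp (-(2 * ω * T)) * (α * ∫ s in (0 : ℝ)..T, ‖y s‖ ^ 2) -
      α⁻¹ * ∫ s in (0 : ℝ)..T, ‖f s‖ ^ 2 ≤ ∫ s in (0 : ℝ)..T, k s := by
    rw [← intervalIntegral.integral_const_mul, ← intervalIntegral.integral_const_mul,
      ← intervalIntegral.integral_const_mul, ← intervalIntegral.integral_sub]
    · refine intervalIntegral.integral_mono_on hT ?_ (hkc.intervalIntegrable _ _) fun s hs => ?_
      · exact Continuous.intervalIntegrable (by fun_prop) _ _
      · have h1 := mul_le_mul_of_nonneg_right (hexp s hs).1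
          (by positivity : 0 ≤ α * ‖y s‖ ^ 2)
        have h2 := mul_le_mul_of_nonneg_right (hexp s hs).2
          (by positivity : 0 ≤ α⁻¹ * ‖f s‖ ^ 2)
        simp only [hk]
        linarith
    · exact Continuous.intervalIntegrable (by fun_prop) _ _
    · exact Continuous.intervalIntegrable (by fun_prop) _ _
  have h0 : W 0 = ‖j (y 0)‖ ^ 2 := by simp [hW]
  have hT' : W T = Real.exp (-(2 * ω * T)) * ‖j (y T)‖ ^ 2 + ∫ s in (0 : ℝ)..T, k s := rfl
  have key : Real.exp (-(2 * ω * T)) * (‖j (y T)‖ ^ 2 + α * ∫ s in (0 : ℝ)..T, ‖y s‖ ^ 2) ≤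
      ‖j (y 0)‖ ^ 2 + α⁻¹ * ∫ s in (0 : ℝ)..T, ‖f s‖ ^ 2 := by
    rw [mul_add]; linarith
  have := mul_le_mul_of_nonneg_left key (Real.exp_pos (2 * ω * T)).le
  rwa [← mul_assoc, ← Real.exp_add, add_neg_cancel, Real.exp_zero, one_mul] at this

theorem eq_zero_of_homogeneous {j : V →L[ℝ] H} {A : V →L[ℝ] StrongDual ℝ V} {α ω : ℝ}
    (hA : GardingWith j A α ω) (hj : Function.Injective j) {y : ℝ → V} (hy : ContDiff ℝ 1 y)
    (h0 : y 0 = 0) {T : ℝ}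
    (heq : ∀ s ∈ Icc 0 T, gelfandMap j (deriv y s) + A (y s) = 0) {t : ℝ} (ht : t ∈ Icc 0 T) :
    y t = 0 := by
  have h := energy_estimate_of_contDiff hA hy ht.1
  have h1 : ∫ s in (0 : ℝ)..t, ‖gelfandMap j (deriv y s) + A (y s)‖ ^ 2 = 0 := by
    rw [intervalIntegral.integral_congr (g := fun _ => (0 : ℝ)), intervalIntegral.integral_zero]
    intro s hs
    rw [uIcc_of_le ht.1] at hs
    simp [heq s ⟨hs.1, hs.2.trans ht.2⟩]
  have h2 : 0 ≤ α * ∫ s in (0 : ℝ)..t, ‖y s‖ ^ 2 :=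
    mul_nonneg hA.pos.le (intervalIntegral.integral_nonneg ht.1 fun _ _ => by positivity)
  rw [h1, h0] at h
  simp only [map_zero, norm_zero, mul_zero, add_zero, ne_eq, OfNat.ofNat_ne_zero,
    not_false_eq_true, zero_pow] at h
  have h3 : ‖j (y t)‖ ^ 2 = 0 := le_antisymm (by linarith) (by positivity)
  have h4 : j (y t) = 0 := by simpa using h3
  exact hj (by rw [h4, map_zero])

/-! ### Primitives of vector-valued integrable functions. -/

section Primitive

theorem _root_.ContinuousOn.integrable_timeMeasure {E : Type*} [NormedAddCommGroup E]
    {k : ℝ → E} {T : ℝ}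
    (hk : ContinuousOn k (Icc 0 T)) : Integrable k (timeMeasure T) :=
  (hk.integrableOn_Icc).mono_set Ioo_subset_Icc_self

variable {E : Type*} [NormedAddCommGroup E] [NormedSpace ℝ E] [CompleteSpace E]

/-- Integration by parts against a `k` that is only integrable. Continuous functionals separate
points, so it suffices to treat scalar functions, whose primitives are absolutely continuous. -/
theorem integral_deriv_smul_primitive {φ : ℝ → ℝ} (hφ : ContDiff ℝ 1 φ) {k : ℝ → E} {T : ℝ}
    (hk : IntervalIntegrable k volume 0 T) :
    ∫ s in (0 : ℝ)..T, deriv φ s • ∫ r in (0 : ℝ)..s, k r =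
      φ T • (∫ s in (0 : ℝ)..T, k s) - ∫ s in (0 : ℝ)..T, φ s • k s := by
  have hc : ContinuousOn (fun s => ∫ r in (0 : ℝ)..s, k r) (uIcc 0 T) :=
    intervalIntegral.continuousOn_primitive_interval'  hk left_mem_uIcc
  have h1 : IntervalIntegrable (fun s => deriv φ s • ∫ r in (0 : ℝ)..s, k r) volume 0 T :=
    ((hφ.continuous_deriv le_rfl).continuousOn.smul hc).intervalIntegrable
  have h2 : IntervalIntegrable (fun s => φ s • k s) volume 0 T :=
    hk.continuousOn_smul hφ.continuous.continuousOn
  rw [SeparatingDual.eq_iff_forall_dual_eq (R := ℝ)]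
  intro g
  have hgk : IntervalIntegrable (fun s => g (k s)) volume 0 T :=
    ⟨g.integrable_comp hk.1, g.integrable_comp hk.2⟩
  have hac : AbsolutelyContinuousOnInterval (fun s => ∫ r in (0 : ℝ)..s, g (k r)) 0 T :=
    hgk.absolutelyContinuousOnInterval_intervalIntegral left_mem_uIcc
  have hφac : AbsolutelyContinuousOnInterval φ 0 T :=
    hφ.contDiffOn.absolutelyContinuousOnInterval
  have h := AbsolutelyContinuousOnInterval.integral_mul_deriv_eq_deriv_mul hφac hac
  have h3 : ∫ x in (0 : ℝ)..T, φ x * deriv (fun s => ∫ r in (0 : ℝ)..s, g (k r)) x =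
      ∫ x in (0 : ℝ)..T, φ x * g (k x) := by
    refine intervalIntegral.integral_congr_ae ?_
    filter_upwards [hgk.ae_hasDerivAt_integral] with x hx hxm
    rw [(hx (uIoc_subset_uIcc hxm) 0 left_mem_uIcc).deriv]
  have h4 : ∫ x in (0 : ℝ)..T, deriv φ x * ∫ r in (0 : ℝ)..x, g (k r) =
      ∫ x in (0 : ℝ)..T, g (deriv φ x • ∫ r in (0 : ℝ)..x, k r) := by
    refine intervalIntegral.integral_congr fun x hx => ?_
    simp only [map_smul, smul_eq_mul]
    rw [g.intervalIntegral_comp_comm (hk.mono_set (uIcc_subset_uIcc_left hx))]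
  rw [map_sub, map_smul, ← g.intervalIntegral_comp_comm h1, ← g.intervalIntegral_comp_comm hk,
    ← g.intervalIntegral_comp_comm h2, ← h4]
  simp only [map_smul, smul_eq_mul]
  rw [h3] at h
  simp only [intervalIntegral.integral_same, mul_zero, sub_zero] at h
  linarith

/-- By Lebesgue's differentiation theorem the primitive has derivative `k t` at almost every `t`. -/
theorem ae_eq_zero_of_primitive_eq_zero {k : ℝ → E} {T : ℝ} (hk : Integrable k (timeMeasure T))
    (h : ∀ t ∈ Icc 0 T, ∫ s in (0 : ℝ)..t, k s = 0) : ∀ᵐ t ∂(timeMeasure T), k t = 0 := by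
  rw [ae_restrict_iff' measurableSet_Ioo]
  rcases le_or_gt T 0 with hT | hT
  · simp [Ioo_eq_empty (not_lt.2 hT)]
  have hki := intervalIntegrable_of_integrable hk (left_mem_Icc.2 hT.le) (right_mem_Icc.2 hT.le)
  filter_upwards [hki.ae_hasDerivAt_integral] with t ht htm
  have htm' : t ∈ uIcc 0 T := by rw [uIcc_of_le hT.le]; exact Ioo_subset_Icc_self htm
  have h1 := ht htm' 0 left_mem_uIcc
  have h2 : (fun x => ∫ s in (0 : ℝ)..x, k s) =ᶠ[𝓝 t] fun _ => 0 := by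
    filter_upwards [Ioo_mem_nhds htm.1 htm.2] with x hx using h x (Ioo_subset_Icc_self hx)
  exact h1.unique ((hasDerivAt_const t (0 : E)).congr_of_eventuallyEq h2)

theorem eqOn_zero_of_primitive_eq_zero {k : ℝ → E} {T : ℝ} (hT : 0 < T)
    (hk : ContinuousOn k (Icc 0 T))
    (h : ∀ t ∈ Icc 0 T, ∫ s in (0 : ℝ)..t, k s = 0) : ∀ t ∈ Icc 0 T, k t = 0 := by
  have h1 := ae_eq_zero_of_primitive_eq_zero hk.integrable_timeMeasure h
  have h2 : k =ᵐ[volume.restrict (Icc 0 T)] fun _ => (0 : E) := by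
    rw [← restrict_Ioo_eq_restrict_Icc]
    exact h1
  exact Measure.eqOn_Icc_of_ae_eq volume hT.ne h2 hk continuousOn_const

theorem contDiff_primitive {k : ℝ → E} (hk : Continuous k) :
    ContDiff ℝ 1 (fun t => ∫ s in (0 : ℝ)..t, k s) ∧
      ∀ t, deriv (fun t => ∫ s in (0 : ℝ)..t, k s) t = k t := by
  have hd : ∀ t, HasDerivAt (fun t => ∫ s in (0 : ℝ)..t, k s) (k t) t := fun t =>
    intervalIntegral.integral_hasDerivAt_right (hk.intervalIntegrable _ _)
        hk.aestronglyMeasurable.stronglyMeasurableAtFilter hk.continuousAt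
  refine ⟨contDiff_one_iff_deriv.2 ⟨fun t => (hd t).differentiableAt, ?_⟩, fun t => (hd t).deriv⟩
  rw [show deriv (fun t => ∫ s in (0 : ℝ)..t, k s) = k from funext fun t => (hd t).deriv]
  exact hk

/-- Cauchy's formula for repeated integration. With its companion below it converts the weights of
the test functions in the density argument into iterated primitives. -/
theorem integral_sub_smul_eq_primitive {k : ℝ → E} {t : ℝ}
    (hk : IntervalIntegrable k volume 0 t) :
    ∫ s in (0 : ℝ)..t, (t - s) • k s = ∫ s in (0 : ℝ)..t, ∫ r in (0 : ℝ)..s, k r := by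
  have h := integral_deriv_smul_primitive (φ := fun s => s - t) (by fun_prop) hk
  simp only [deriv_sub_const_fun, deriv_id'', one_smul, sub_self, zero_smul, zero_sub] at h
  rw [h, ← intervalIntegral.integral_neg]
  simp only [← neg_smul, neg_sub]

theorem integral_sub_sq_smul_eq_primitive {k : ℝ → E} {t : ℝ}
    (hk : IntervalIntegrable k volume 0 t) :
    ∫ s in (0 : ℝ)..t, ((t - s) ^ 2 / 2) • k s =
      ∫ s in (0 : ℝ)..t, ∫ r in (0 : ℝ)..s, ∫ q in (0 : ℝ)..r, k q := by
  have hc : ContinuousOn (fun s => ∫ r in (0 : ℝ)..s, k r) (uIcc 0 t) :=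
    intervalIntegral.continuousOn_primitive_interval' hk left_mem_uIcc
  rw [← integral_sub_smul_eq_primitive hc.intervalIntegrable]
  have hd : ∀ s, HasDerivAt (fun s : ℝ => -((t - s) ^ 2 / 2)) (t - s) s := fun s => by
    have := ((((hasDerivAt_id s).const_sub t).fun_pow 2).div_const 2).fun_neg
    refine this.congr_deriv ?_
    simp only [id, Nat.cast_ofNat, Nat.add_one_sub_one, pow_one]
    ring
  have h := integral_deriv_smul_primitive (φ := fun s => -((t - s) ^ 2 / 2)) (by fun_prop) hk
  rw [show deriv (fun s => -((t - s) ^ 2 / 2)) = fun s => t - s from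
    funext fun s => (hd s).deriv] at h
  rw [h]
  simp

/-- The `C¹` function `x ↦ x₊²/2`. -/
theorem hasDerivAt_max_sq_div_two (x : ℝ) :
    HasDerivAt (fun x : ℝ => max x 0 ^ 2 / 2) (max x 0) x := by
  rcases lt_trichotomy x 0 with hx | rfl | hx
  · rw [max_eq_right hx.le]
    refine (hasDerivAt_const x (0 : ℝ)).congr_of_eventuallyEq ?_
    filter_upwards [Iio_mem_nhds hx] with y hy
    rw [max_eq_right (le_of_lt hy)]; simp
  · rw [max_self, hasDerivAt_iff_isLittleO_nhds_zero]
    simp only [zero_add, max_self, smul_zero, sub_zero]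
    refine Asymptotics.IsBigO.trans_isLittleO (g := fun h : ℝ => h ^ 2) ?_
      (Asymptotics.isLittleO_pow_id one_lt_two)
    refine Asymptotics.IsBigO.of_bound 1 (Eventually.of_forall fun h => ?_)
    have h1 : max h 0 ^ 2 ≤ h ^ 2 := by
      rcases le_total h 0 with hh | hh
      · rw [max_eq_right hh, zero_pow two_ne_zero]; exact sq_nonneg h
      · rw [max_eq_left hh]
    norm_num
    linarith [sq_nonneg h]
  · rw [max_eq_left hx.le]
    have := ((hasDerivAt_id x).fun_pow 2).div_const 2
    simp only [id, Nat.cast_ofNat, Nat.add_one_sub_one, pow_one, mul_one] at this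
    rw [mul_div_cancel_left₀ _ two_ne_zero] at this
    refine this.congr_of_eventuallyEq ?_
    filter_upwards [Ioi_mem_nhds hx] with y hy
    rw [max_eq_left (le_of_lt hy)]

end Primitive

/-! ### Density of the range of `∂ₜ + A` on `C¹` functions. -/

theorem measurePreserving_reflect (T : ℝ) :
    MeasurePreserving (fun s : ℝ => T - s) (timeMeasure T) (timeMeasure T) := by
  have h := (Measure.measurePreserving_sub_left (volume : Measure ℝ) T).restrict_preimage
    (s := Ioo 0 T) measurableSet_Ioo
  rwa [show (fun s : ℝ => T - s) ⁻¹' Ioo 0 T = Ioo 0 T by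
    ext s; simp only [mem_preimage, mem_Ioo]; constructor <;> rintro ⟨h1, h2⟩ <;> constructor <;> linarith] at h

theorem integral_smul_eq_of_eq_zero {E : Type*} [NormedAddCommGroup E] [NormedSpace ℝ E]
    {k : ℝ → E} {T t : ℝ} (hk : Integrable k (timeMeasure T)) (ht : t ∈ Icc 0 T)
    {g g' : ℝ → ℝ} (hg : Continuous g) (h1 : ∀ s ∈ Icc 0 t, g s = g' s)
    (h2 : ∀ s ∈ Icc t T, g s = 0) :
    ∫ s in (0 : ℝ)..T, g s • k s = ∫ s in (0 : ℝ)..t, g' s • k s := by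
  have hT : (0 : ℝ) ≤ T := ht.1.trans ht.2
  have hi : ∀ {a b : ℝ}, a ∈ Icc 0 T → b ∈ Icc 0 T →
      IntervalIntegrable (fun s => g s • k s) volume a b := fun ha hb =>
    (intervalIntegrable_of_integrable hk ha hb).continuousOn_smul hg.continuousOn
  rw [← intervalIntegral.integral_add_adjacent_intervals (hi (left_mem_Icc.2 hT) ht)
    (hi ht (right_mem_Icc.2 hT))]
  have h3 : ∫ s in t..T, g s • k s = 0 := by
    rw [intervalIntegral.integral_congr (g := fun _ => (0 : E)), intervalIntegral.integral_zero]
    intro s hs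
    rw [uIcc_of_le ht.2] at hs
    simp [h2 s hs]
  rw [h3, add_zero]
  refine intervalIntegral.integral_congr fun s hs => ?_
  rw [uIcc_of_le ht.1] at hs
  simp only [h1 s hs]

variable {V H : Type*} [NormedAddCommGroup V] [InnerProductSpace ℝ V]
  [NormedAddCommGroup H] [InnerProductSpace ℝ H]

/-- The function `∂ₜ y + A y` of a `C¹` function. -/
def parabolicOp (j : V →L[ℝ] H) (A : V →L[ℝ] StrongDual ℝ V) (y : ℝ → V) (s : ℝ) : StrongDual ℝ V :=
  gelfandMap j (deriv y s) + A (y s)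

theorem continuous_parabolicOp (j : V →L[ℝ] H) (A : V →L[ℝ] StrongDual ℝ V) {y : ℝ → V}
    (hy : ContDiff ℝ 1 y) : Continuous (parabolicOp j A y) := by
  have := hy.continuous
  have := hy.continuous_deriv le_rfl
  unfold parabolicOp
  fun_prop

theorem parabolicOp_sub (j : V →L[ℝ] H) (A : V →L[ℝ] StrongDual ℝ V) {y z : ℝ → V}
    (hy : ContDiff ℝ 1 y) (hz : ContDiff ℝ 1 z) (s : ℝ) :
    parabolicOp j A (y - z) s = parabolicOp j A y s - parabolicOp j A z s := by
  unfold parabolicOp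
  rw [deriv_sub (hy.differentiable one_ne_zero s) (hz.differentiable one_ne_zero s)]
  simp only [Pi.sub_apply, map_sub]
  abel

variable [CompleteSpace V]

/-- Orthogonality says that `q` solves the backward adjoint equation in a very weak sense. Reversed
in time and integrated three times it becomes a `C¹` solution of the homogeneous forward equation
with zero initial value. That solution vanishes by the energy estimate, and differentiating back
gives `q = 0`. -/
theorem ae_eq_zero_of_orthogonal_parabolicOp {j : V →L[ℝ] H} {A : V →L[ℝ] StrongDual ℝ V} {α ω : ℝ}
    (hA : GardingWith j A α ω) (hj : Function.Injective j) {T : ℝ} (hT : 0 < T) {q : ℝ → V}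
    (hq : MemLp q 2 (timeMeasure T))
    (h : ∀ y : ℝ → V, ContDiff ℝ 1 y → y 0 = 0 →
      ∫ s in (0 : ℝ)..T, parabolicOp j A y s (q s) = 0) :
    ∀ᵐ s ∂(timeMeasure T), q s = 0 := by
  set k : ℝ → V := fun s => q (T - s) with hk
  have hkL : MemLp k 2 (timeMeasure T) := hq.comp_measurePreserving (measurePreserving_reflect T)
  have hki : Integrable k (timeMeasure T) := hkL.integrable one_le_two
  have hqi : IntervalIntegrable q volume 0 T := intervalIntegrable_of_integrable
    (hq.integrable one_le_two) (left_mem_Icc.2 hT.le) (right_mem_Icc.2 hT.le)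
  -- Extension by zero makes the primitives continuous, and the later ones `C¹`, on all of `ℝ`.
  set k' : ℝ → V := (Ioo 0 T).indicator k with hk'
  have hk'i : Integrable k' :=
    (show IntegrableOn k (Ioo 0 T) volume from hki).integrable_indicator measurableSet_Ioo
  set k1 : ℝ → V := fun t => ∫ s in (0 : ℝ)..t, k' s with hk1
  set k2 : ℝ → V := fun t => ∫ s in (0 : ℝ)..t, k1 s with hk2
  set k3 : ℝ → V := fun t => ∫ s in (0 : ℝ)..t, k2 s with hk3
  have hk1c : Continuous k1 := intervalIntegral.continuous_primitive
    (fun a b => hk'i.intervalIntegrable) 0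
  obtain ⟨hk2C, hk2d⟩ := contDiff_primitive hk1c
  obtain ⟨hk3C, hk3d⟩ := contDiff_primitive hk2C.continuous
  have hkk' : ∀ t ∈ Icc 0 T, ∀ g : ℝ → ℝ, ∫ s in (0 : ℝ)..t, g s • k s =
      ∫ s in (0 : ℝ)..t, g s • k' s := by
    intro t ht g
    rw [← integral_timeMeasure ht.1, ← integral_timeMeasure ht.1]
    refine setIntegral_congr_fun measurableSet_Ioo fun s hs => ?_
    simp only [hk', indicator_of_mem (Ioo_subset_Ioo_right ht.2 hs)]
  have key : ∀ t ∈ Icc 0 T, gelfandMap j (k2 t) + A.flip (k3 t) = 0 := by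
    intro t ht
    ext v
    -- The test function `ψ • v` is `C¹` and vanishes at `0` since `t ≤ T`. After reflection `ψ'`
    -- and `ψ` become `t - s` and `(t - s)²/2`, cut off at `t`, and produce `k2 t` and `k3 t`.
    set ψ : ℝ → ℝ := fun s => max (s + (t - T)) 0 ^ 2 / 2 with hψ
    have hψd : ∀ s, HasDerivAt ψ (max (s + (t - T)) 0) s := fun s =>
      HasDerivAt.comp_add_const (f := fun x : ℝ => max x 0 ^ 2 / 2) s (t - T)
        (hasDerivAt_max_sq_div_two _)
    have hψc : ContDiff ℝ 1 ψ := by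
      refine contDiff_one_iff_deriv.2 ⟨fun s => (hψd s).differentiableAt, ?_⟩
      rw [show deriv ψ = fun s => max (s + (t - T)) 0 from funext fun s => (hψd s).deriv]
      fun_prop
    have hyc : ContDiff ℝ 1 (fun s => ψ s • v) := hψc.smul contDiff_const
    have h0 := h _ hyc (by
      simp only [hψ]
      rw [max_eq_right (by linarith [ht.2])]; simp)
    have hyd : ∀ s, deriv (fun s => ψ s • v) s = max (s + (t - T)) 0 • v := fun s =>
      ((hψd s).smul_const v).deriv
    have hi1 : IntervalIntegrable (fun s => max (s + (t - T)) 0 • q s) volume 0 T :=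
      hqi.continuousOn_smul (Continuous.continuousOn (by fun_prop))
    have hi2 : IntervalIntegrable (fun s => ψ s • q s) volume 0 T :=
      hqi.continuousOn_smul hψc.continuous.continuousOn
    have h1 : ∫ s in (0 : ℝ)..T, parabolicOp j A (fun s => ψ s • v) s (q s) =
        gelfandMap j v (∫ s in (0 : ℝ)..T, max (s + (t - T)) 0 • q s) +
        A v (∫ s in (0 : ℝ)..T, ψ s • q s) := by
      rw [← ContinuousLinearMap.intervalIntegral_comp_comm _ hi1,
        ← ContinuousLinearMap.intervalIntegral_comp_comm _ hi2,
        ← intervalIntegral.integral_add]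
      · refine intervalIntegral.integral_congr fun s _ => ?_
        simp only [parabolicOp, hyd, map_smul, add_apply, smul_apply]
      · exact ⟨(gelfandMap j v).integrable_comp hi1.1, (gelfandMap j v).integrable_comp hi1.2⟩
      · exact ⟨(A v).integrable_comp hi2.1, (A v).integrable_comp hi2.2⟩
    have h2 : ∀ g : ℝ → ℝ, ∫ s in (0 : ℝ)..T, g s • q s = ∫ s in (0 : ℝ)..T, g (T - s) • k s := by
      intro g
      have := intervalIntegral.integral_comp_sub_left (a := 0) (b := T) (fun s => g s • q s) T
      simp only [sub_zero, sub_self] at this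
      rw [← this]
    have hk'I : IntervalIntegrable k' volume 0 t := hk'i.intervalIntegrable
    have h3 : ∫ s in (0 : ℝ)..T, max (s + (t - T)) 0 • q s = k2 t := by
      rw [h2 (fun s => max (s + (t - T)) 0), integral_smul_eq_of_eq_zero hki ht
        (g' := fun s => t - s) (by fun_prop), hkk' t ht, integral_sub_smul_eq_primitive hk'I]
      · intro s hs
        rw [max_eq_left] <;> linarith [hs.2]
      · intro s hs
        rw [max_eq_right]; linarith [hs.1]
    have h4 : ∫ s in (0 : ℝ)..T, ψ s • q s = k3 t := by
      rw [h2 ψ, integral_smul_eq_of_eq_zero hki ht (g' := fun s => (t - s) ^ 2 / 2)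
        (by fun_prop), hkk' t ht, integral_sub_sq_smul_eq_primitive hk'I]
      · intro s hs
        simp only [hψ]
        rw [max_eq_left (by linarith [hs.2])]
        ring
      · intro s hs
        simp only [hψ]
        rw [max_eq_right (by linarith [hs.1])]; simp
    rw [h1, h3, h4] at h0
    simp only [add_apply, ContinuousLinearMap.flip_apply, zero_apply]
    rw [gelfandMap_apply, real_inner_comm, ← gelfandMap_apply]
    exact h0
  have hk3z : ∀ t ∈ Icc 0 T, k3 t = 0 := fun t ht =>
    eq_zero_of_homogeneous hA.flip hj hk3C (by simp) (T := T)
      (fun s hs => by rw [hk3d]; exact key s hs) ht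
  have hk2z := eqOn_zero_of_primitive_eq_zero hT hk2C.continuous.continuousOn hk3z
  have hk1z := eqOn_zero_of_primitive_eq_zero hT hk1c.continuousOn hk2z
  have hkz : ∀ᵐ s ∂(timeMeasure T), k s = 0 :=
    ae_eq_zero_of_primitive_eq_zero hki fun t ht => by
      have := hkk' t ht (fun _ => 1)
      simp only [one_smul] at this
      rw [this]; exact hk1z t ht
  have h5 := (measurePreserving_reflect T).quasiMeasurePreserving.ae hkz
  filter_upwards [h5] with s hs
  simpa [hk] using hs

variable [CompleteSpace H]

/-- A vector orthogonal to all pairs `(∂ₜ y + A y, y(0))` is zero. Functions with `y(0) = 0`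
annihilate its first component, and then constant functions annihilate the second because `j` has
dense range. -/
theorem exists_seq_contDiff_approx {j : V →L[ℝ] H} {A : V →L[ℝ] StrongDual ℝ V} {α ω : ℝ}
    (hA : GardingWith j A α ω) (hj : Function.Injective j) (hjd : DenseRange j)
    {T : ℝ} (hT : 0 < T) {F : ℝ → StrongDual ℝ V} (hF : MemLp F 2 (timeMeasure T)) (x : H) :
    ∃ y : ℕ → ℝ → V, (∀ n, ContDiff ℝ 1 (y n)) ∧
      Tendsto (fun n => ∫ s in (0 : ℝ)..T, ‖parabolicOp j A (y n) s - F s‖ ^ 2) atTop (𝓝 0) ∧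
      Tendsto (fun n => j (y n 0)) atTop (𝓝 x) := by
  -- The Riesz isometry replaces `V*` by `V`, so that orthogonal complements are available in
  -- `L²(0,T;V) × H`.
  let J := (InnerProductSpace.toDual ℝ V).symm
  have hJ : ∀ f v, inner ℝ (J f) v = f v := fun f v => InnerProductSpace.toDual_symm_apply
  have hJs : ∀ (c : ℝ) f, J (c • f) = c • J f := fun c f => by simp [J]
  let K : Submodule ℝ (WithLp 2 (L2Time T V × H)) :=
    { carrier := {p | ∃ y : ℝ → V, ContDiff ℝ 1 y ∧
        (∀ᵐ s ∂(timeMeasure T), p.fst s = J (parabolicOp j A y s)) ∧ p.snd = j (y 0)}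
      add_mem' := by
        rintro p q ⟨y, hy, hp, hp'⟩ ⟨z, hz, hq, hq'⟩
        refine ⟨y + z, hy.add hz, ?_, by simp [hp', hq']⟩
        filter_upwards [hp, hq, Lp.coeFn_add p.fst q.fst] with s h1 h2 h3
        rw [WithLp.add_fst, h3, Pi.add_apply, h1, h2, ← map_add]
        congr 1
        unfold parabolicOp
        rw [deriv_add (hy.differentiable one_ne_zero s) (hz.differentiable one_ne_zero s)]
        simp only [Pi.add_apply, map_add]
        abel
      zero_mem' := by
        refine ⟨0, contDiff_const, ?_, by simp⟩
        filter_upwards [Lp.coeFn_zero V 2 (timeMeasure T)] with s h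
        rw [WithLp.zero_fst, h]
        simp [parabolicOp]
      smul_mem' := by
        rintro c p ⟨y, hy, hp, hp'⟩
        refine ⟨c • y, hy.const_smul c, ?_, by simp [hp']⟩
        filter_upwards [hp, Lp.coeFn_smul c p.fst] with s h1 h3
        rw [WithLp.smul_fst, h3, Pi.smul_apply, h1, ← hJs]
        congr 1
        unfold parabolicOp
        rw [deriv_const_smul c (hy.differentiable one_ne_zero s)]
        simp }
  have hmemJ : ∀ {f : ℝ → StrongDual ℝ V}, MemLp f 2 (timeMeasure T) →
      MemLp (fun s => J (f s)) 2 (timeMeasure T) := fun hf =>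
    hf.of_le (J.continuous.comp_aestronglyMeasurable hf.1) (by simp)
  have hK : Kᗮ = ⊥ := by
    rw [Submodule.eq_bot_iff]
    intro z hz
    have horth : ∀ y : ℝ → V, ContDiff ℝ 1 y →
        (∫ s in (0 : ℝ)..T, parabolicOp j A y s (z.fst s)) + inner ℝ (j (y 0)) z.snd = 0 := by
      intro y hy
      have hm := hmemJ ((continuous_parabolicOp j A hy).memLp_timeMeasure T)
      have := (Submodule.mem_orthogonal K z).1 hz (WithLp.toLp 2 (hm.toLp, j (y 0)))
        ⟨y, hy, hm.coeFn_toLp, rfl⟩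
      rw [WithLp.prod_inner_apply, L2.inner_def] at this
      refine Eq.trans ?_ this
      rw [← integral_timeMeasure hT.le]
      congr 1
      refine integral_congr_ae ?_
      filter_upwards [hm.coeFn_toLp] with s hs
      change _ = inner ℝ ((hm.toLp) s) (z.fst s)
      rw [hs, hJ]
    have h1 : ∀ᵐ s ∂(timeMeasure T), z.fst s = 0 :=
      ae_eq_zero_of_orthogonal_parabolicOp hA hj hT (Lp.memLp z.fst) fun y hy h0 => by
        simpa [h0] using horth y hy
    have h2 : ∀ v, inner ℝ (j v) z.snd = 0 := fun v => by
      have h := horth (fun _ => v) contDiff_const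
      rw [← integral_timeMeasure hT.le, integral_congr_ae (g := fun _ => (0 : ℝ))] at h
      · simpa using h
      · filter_upwards [h1] with s hs
        simp [hs]
    have h3 : z.snd = 0 := hjd.eq_zero_of_inner_right ℝ h2
    have h4 : z.fst = 0 := (Lp.eq_zero_iff_ae_eq_zero).2 h1
    exact WithLp.ofLp_injective 2 (Prod.ext h4 h3)
  have hdense : K.topologicalClosure = ⊤ := (Submodule.topologicalClosure_eq_top_iff).2 hK
  have hFJ := hmemJ hF
  have hmem : WithLp.toLp 2 (hFJ.toLp, x) ∈ closure (K : Set (WithLp 2 (L2Time T V × H))) := by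
    rw [← Submodule.topologicalClosure_coe, hdense]; trivial
  obtain ⟨p, hpK, hp⟩ := mem_closure_iff_seq_limit.1 hmem
  choose y hy hy1 hy2 using hpK
  refine ⟨y, hy, ?_, ?_⟩
  · have h1 : Tendsto (fun n => (p n).fst) atTop (𝓝 hFJ.toLp) :=
      ((WithLp.prod_continuous_ofLp 2 _ _).tendsto _ |>.comp hp).fst_nhds
    have h2 : Tendsto (fun n => ‖(p n).fst - hFJ.toLp‖ ^ 2) atTop (𝓝 0) := by
      simpa using (tendsto_iff_norm_sub_tendsto_zero.1 h1).pow 2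
    refine h2.congr fun n => ?_
    have hL : (p n).fst - hFJ.toLp = (hmemJ (((continuous_parabolicOp j A (hy n)).memLp_timeMeasure T).sub hF)).toLp := by
      refine Lp.ext ?_
      filter_upwards [hy1 n, MemLp.coeFn_toLp (hmemJ (((continuous_parabolicOp j A (hy n)).memLp_timeMeasure T).sub hF)), Lp.coeFn_sub (p n).fst hFJ.toLp, hFJ.coeFn_toLp] with s h1 h2 h3 h4
      rw [h2, h3, Pi.sub_apply, h1, h4, Pi.sub_apply, map_sub]
    rw [hL, norm_toLp_sq, integral_timeMeasure hT.le]
    simp [-map_sub]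
  · have h1 : Tendsto (fun n => (p n).snd) atTop (𝓝 x) :=
      ((WithLp.prod_continuous_ofLp 2 _ _).tendsto _ |>.comp hp).snd_nhds
    exact h1.congr hy2

/-! ### Convergence in `L²(0,T)` and duality pairings. -/

section L2Convergence

variable {E : Type*} [NormedAddCommGroup E]

/-- Convergence of a sequence of functions in `L²(0,T;E)`. -/
def TendstoL2 (T : ℝ) (f : ℕ → ℝ → E) (F : ℝ → E) : Prop :=
  Tendsto (fun n => ∫ s in (0 : ℝ)..T, ‖f n s - F s‖ ^ 2) atTop (𝓝 0)

theorem norm_toLp_sub_sq {T : ℝ} (hT : 0 ≤ T) {f g : ℝ → E} (hf : MemLp f 2 (timeMeasure T))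
    (hg : MemLp g 2 (timeMeasure T)) :
    ‖hf.toLp - hg.toLp‖ ^ 2 = ∫ s in (0 : ℝ)..T, ‖f s - g s‖ ^ 2 := by
  rw [← MemLp.toLp_sub, norm_toLp_sq, integral_timeMeasure hT]
  rfl

theorem tendstoL2_iff {T : ℝ} (hT : 0 ≤ T) {f : ℕ → ℝ → E} {F : ℝ → E}
    (hf : ∀ n, MemLp (f n) 2 (timeMeasure T)) (hF : MemLp F 2 (timeMeasure T)) :
    TendstoL2 T f F ↔ Tendsto (fun n => (hf n).toLp) atTop (𝓝 hF.toLp) := by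
  rw [tendsto_iff_norm_sub_tendsto_zero, TendstoL2]
  simp only [← norm_toLp_sub_sq hT (hf _) hF]
  constructor
  · intro h
    simpa using h.sqrt
  · intro h
    simpa using h.pow 2

theorem TendstoL2.integral_norm_sq {T : ℝ} (hT : 0 ≤ T) {f : ℕ → ℝ → E} {F : ℝ → E}
    (h : TendstoL2 T f F) (hf : ∀ n, MemLp (f n) 2 (timeMeasure T))
    (hF : MemLp F 2 (timeMeasure T)) :
    Tendsto (fun n => ∫ s in (0 : ℝ)..T, ‖f n s‖ ^ 2) atTop
      (𝓝 (∫ s in (0 : ℝ)..T, ‖F s‖ ^ 2)) := by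
  have h1 := (((tendstoL2_iff hT hf hF).1 h).norm).pow 2
  simpa only [norm_toLp_sq, integral_timeMeasure hT] using h1

theorem TendstoL2.const (T : ℝ) (F : ℝ → E) : TendstoL2 T (fun _ => F) F := by
  simp [TendstoL2]

theorem cauchySeq_of_dist_sq_le {X Y : Type*} [PseudoMetricSpace X] [PseudoMetricSpace Y]
    {u : ℕ → X} {p : ℕ → Y} {C : ℝ} (hp : CauchySeq p)
    (h : ∀ m n, dist (u m) (u n) ^ 2 ≤ C * dist (p m) (p n) ^ 2) : CauchySeq u := by
  rw [Metric.cauchySeq_iff] at hp ⊢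
  intro ε hε
  obtain ⟨N, hN⟩ := hp (ε / (|C| + 1)) (by positivity)
  refine ⟨N, fun m hm n hn => ?_⟩
  have h1 := hN m hm n hn
  rw [lt_div_iff₀ (by positivity)] at h1
  have h2 : dist (u m) (u n) ^ 2 < ε ^ 2 := by
    refine lt_of_le_of_lt ((h m n).trans ?_)
      (pow_lt_pow_left₀ h1 (by positivity) two_ne_zero)
    have : C ≤ (|C| + 1) ^ 2 := by nlinarith [le_abs_self C, abs_nonneg C]
    nlinarith [sq_nonneg (dist (p m) (p n))]
  exact lt_of_pow_lt_pow_left₀ 2 hε.le h2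

end L2Convergence

variable {V H : Type*} [NormedAddCommGroup V] [InnerProductSpace ℝ V]
  [NormedAddCommGroup H] [InnerProductSpace ℝ H]

section Pairing

theorem integrable_pairing {T : ℝ} {f : ℝ → StrongDual ℝ V} {y : ℝ → V}
    (hf : MemLp f 2 (timeMeasure T)) (hy : MemLp y 2 (timeMeasure T)) :
    Integrable (fun s => f s (y s)) (timeMeasure T) := by
  have h := MemLp.integrable_mul hf.norm hy.norm
  refine h.mono ?_ (Eventually.of_forall fun s => ?_)
  · exact (ContinuousLinearMap.id ℝ (StrongDual ℝ V)).aestronglyMeasurable_comp₂ hf.1 hy.1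
  · simp only [Pi.mul_apply, norm_mul, norm_norm]
    exact (f s).le_opNorm _

theorem integral_norm_mul_norm_le {E F : Type*} [NormedAddCommGroup E] [NormedAddCommGroup F]
    {T : ℝ} (hT : 0 ≤ T) {f : ℝ → E} {y : ℝ → F}
    (hf : MemLp f 2 (timeMeasure T)) (hy : MemLp y 2 (timeMeasure T)) :
    ∫ s in (0 : ℝ)..T, ‖f s‖ * ‖y s‖ ≤
      √(∫ s in (0 : ℝ)..T, ‖f s‖ ^ 2) * √(∫ s in (0 : ℝ)..T, ‖y s‖ ^ 2) := by
  have h := real_inner_le_norm hf.norm.toLp hy.norm.toLp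
  rw [L2.inner_def, ← Real.sqrt_sq (norm_nonneg hf.norm.toLp),
    ← Real.sqrt_sq (norm_nonneg hy.norm.toLp), norm_toLp_sq, norm_toLp_sq,
    integral_timeMeasure hT, integral_timeMeasure hT, integral_timeMeasure hT] at h
  simp only [norm_norm] at h
  refine le_trans (le_of_eq ?_) h
  rw [← integral_timeMeasure hT, ← integral_timeMeasure hT]
  refine integral_congr_ae ?_
  filter_upwards [hf.norm.coeFn_toLp, hy.norm.coeFn_toLp] with s h1 h2
  rw [h1, h2]
  simp [mul_comm]

theorem abs_integral_pairing_le {T : ℝ} (hT : 0 ≤ T) {f : ℝ → StrongDual ℝ V} {y : ℝ → V}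
    (hf : MemLp f 2 (timeMeasure T)) (hy : MemLp y 2 (timeMeasure T)) :
    |∫ s in (0 : ℝ)..T, f s (y s)| ≤
      √(∫ s in (0 : ℝ)..T, ‖f s‖ ^ 2) * √(∫ s in (0 : ℝ)..T, ‖y s‖ ^ 2) := by
  refine le_trans ?_ (integral_norm_mul_norm_le hT hf hy)
  rw [← Real.norm_eq_abs]
  refine intervalIntegral.norm_integral_le_of_norm_le hT
    (Eventually.of_forall fun s _ => (f s).le_opNorm _) ?_
  exact intervalIntegrable_of_integrable (MemLp.integrable_mul hf.norm hy.norm)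
    (left_mem_Icc.2 hT) (right_mem_Icc.2 hT)

/-- The Riesz isometry turns the time-integrated pairing into the inner product of `L²(0,T;V)`,
which is jointly continuous. -/
theorem TendstoL2.pairing [CompleteSpace V] {T : ℝ} (hT : 0 ≤ T) {f : ℕ → ℝ → StrongDual ℝ V}
    {F : ℝ → StrongDual ℝ V} {y : ℕ → ℝ → V} {Y : ℝ → V} (h : TendstoL2 T f F)
    (h' : TendstoL2 T y Y) (hf : ∀ n, MemLp (f n) 2 (timeMeasure T))
    (hF : MemLp F 2 (timeMeasure T)) (hy : ∀ n, MemLp (y n) 2 (timeMeasure T))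
    (hY : MemLp Y 2 (timeMeasure T)) :
    Tendsto (fun n => ∫ s in (0 : ℝ)..T, f n s (y n s)) atTop
      (𝓝 (∫ s in (0 : ℝ)..T, F s (Y s))) := by
  let J := (InnerProductSpace.toDual ℝ V).symm
  have hmemJ : ∀ {f : ℝ → StrongDual ℝ V}, MemLp f 2 (timeMeasure T) →
      MemLp (fun s => J (f s)) 2 (timeMeasure T) := fun hf =>
    hf.of_le (J.continuous.comp_aestronglyMeasurable hf.1) (by simp)
  have hJ : ∀ {f : ℝ → StrongDual ℝ V} {y : ℝ → V} (hf : MemLp f 2 (timeMeasure T))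
      (hy : MemLp y 2 (timeMeasure T)),
      inner ℝ (hmemJ hf).toLp hy.toLp = ∫ s in (0 : ℝ)..T, f s (y s) := fun hf hy => by
    rw [L2.inner_def, ← integral_timeMeasure hT]
    refine integral_congr_ae ?_
    filter_upwards [(hmemJ hf).coeFn_toLp, hy.coeFn_toLp] with s h1 h2
    rw [h1, h2]
    exact InnerProductSpace.toDual_symm_apply
  have h1 : TendstoL2 T (fun n s => J (f n s)) (fun s => J (F s)) := by
    simpa only [TendstoL2, ← map_sub, LinearIsometryEquiv.norm_map] using h
  have h2 := ((tendstoL2_iff hT (fun n => hmemJ (hf n)) (hmemJ hF)).1 h1).inner (𝕜 := ℝ)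
    ((tendstoL2_iff hT hy hY).1 h')
  rw [hJ hF hY] at h2
  exact h2.congr fun n => hJ (hf n) (hy n)

/-- Pair with the function equal to `v` on `(0,t)` and to zero elsewhere. -/
theorem TendstoL2.integral_apply [CompleteSpace V] {T : ℝ} {f : ℕ → ℝ → StrongDual ℝ V}
    {F : ℝ → StrongDual ℝ V} (h : TendstoL2 T f F) (hf : ∀ n, MemLp (f n) 2 (timeMeasure T))
    (hF : MemLp F 2 (timeMeasure T)) (v : V) {t : ℝ} (ht : t ∈ Icc 0 T) :
    Tendsto (fun n => ∫ s in (0 : ℝ)..t, f n s v) atTop (𝓝 (∫ s in (0 : ℝ)..t, F s v)) := by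
  have hY : MemLp ((Ioo 0 t).indicator fun _ : ℝ => v) 2 (timeMeasure T) :=
    (memLp_const v).indicator measurableSet_Ioo
  have hT : 0 ≤ T := ht.1.trans ht.2
  have h1 := h.pairing hT (TendstoL2.const T _) hf hF (fun _ => hY) hY
  have h2 : ∀ g : ℝ → StrongDual ℝ V,
      ∫ s in (0 : ℝ)..T, g s ((Ioo 0 t).indicator (fun _ : ℝ => v) s) =
        ∫ s in (0 : ℝ)..t, g s v := by
    intro g
    rw [← integral_timeMeasure hT, ← integral_timeMeasure ht.1]
    have : (fun s => g s ((Ioo 0 t).indicator (fun _ : ℝ => v) s)) =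
        (Ioo 0 t).indicator fun s => g s v := by
      ext s
      by_cases hs : s ∈ Ioo 0 t <;> simp [hs]
    rw [this, setIntegral_indicator measurableSet_Ioo, inter_eq_right.2 (Ioo_subset_Ioo_right ht.2)]
  simpa only [h2] using h1

end Pairing

/-! ### Weak solutions in integrated form and their uniqueness. -/

/-- `y` is a weak solution of `∂ₜ y + A y = F` on `(0,T)`, written in integrated form, and `c` is
its continuous `H`-valued representative. -/
structure IsSol (j : V →L[ℝ] H) (A : V →L[ℝ] StrongDual ℝ V) (T : ℝ) (F : ℝ → StrongDual ℝ V)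
    (y : ℝ → V) (c : ℝ → H) : Prop where
  memLp : MemLp y 2 (timeMeasure T)
  memLp_force : MemLp F 2 (timeMeasure T)
  continuousOn : ContinuousOn c (Icc 0 T)
  ae_eq : ∀ᵐ t ∂(timeMeasure T), c t = j (y t)
  eq : ∀ t ∈ Icc 0 T, ∀ v, inner ℝ (c t) (j v) =
    inner ℝ (c 0) (j v) + ∫ s in (0 : ℝ)..t, (F s - A (y s)) v

namespace IsSol

variable {j : V →L[ℝ] H} {A : V →L[ℝ] StrongDual ℝ V} {T : ℝ} {F F₁ F₂ : ℝ → StrongDual ℝ V}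
    {y y₁ y₂ : ℝ → V} {c c₁ c₂ : ℝ → H}

theorem memLp_rhs (h : IsSol j A T F y c) : MemLp (fun s => F s - A (y s)) 2 (timeMeasure T) :=
  h.memLp_force.sub (A.comp_memLp' h.memLp)

theorem intervalIntegrable_rhs (h : IsSol j A T F y c) (v : V) {a b : ℝ} (ha : a ∈ Icc 0 T)
    (hb : b ∈ Icc 0 T) : IntervalIntegrable (fun s => (F s - A (y s)) v) volume a b :=
  intervalIntegrable_of_integrable (integrable_pairing h.memLp_rhs (memLp_const v)) ha hb

theorem lineComb (h₁ : IsSol j A T F₁ y₁ c₁) (h₂ : IsSol j A T F₂ y₂ c₂) (a b : ℝ) :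
    IsSol j A T (fun s => a • F₁ s + b • F₂ s) (fun s => a • y₁ s + b • y₂ s)
      (fun s => a • c₁ s + b • c₂ s) where
  memLp := (h₁.memLp.const_smul a).add (h₂.memLp.const_smul b)
  memLp_force := (h₁.memLp_force.const_smul a).add (h₂.memLp_force.const_smul b)
  continuousOn := (h₁.continuousOn.const_smul a).add (h₂.continuousOn.const_smul b)
  ae_eq := by
    filter_upwards [h₁.ae_eq, h₂.ae_eq] with t h1 h2
    simp [h1, h2]
  eq := fun t ht v => by
    have h0 : (0 : ℝ) ∈ Icc 0 T := left_mem_Icc.2 (ht.1.trans ht.2)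
    simp only [inner_add_left, inner_smul_left, conj_trivial]
    rw [h₁.eq t ht, h₂.eq t ht]
    have : ∀ s, (a • F₁ s + b • F₂ s - A (a • y₁ s + b • y₂ s)) v =
        a * (F₁ s - A (y₁ s)) v + b * (F₂ s - A (y₂ s)) v := fun s => by
      simp only [map_add, map_smul, add_apply, sub_apply, smul_apply, smul_eq_mul]
      ring
    simp only [this]
    rw [intervalIntegral.integral_add ((h₁.intervalIntegrable_rhs v h0 ht).const_mul a)
      ((h₂.intervalIntegrable_rhs v h0 ht).const_mul b), intervalIntegral.integral_const_mul,
      intervalIntegral.integral_const_mul]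
    ring

/-- Force and operator enter only through `F - A y`, so part of the operator may be moved into the
force. Solutions for different parameters are compared in this way. -/
theorem congr_force (h : IsSol j A T F y c) {A' : V →L[ℝ] StrongDual ℝ V}
    {F' : ℝ → StrongDual ℝ V} (hF' : MemLp F' 2 (timeMeasure T))
    (he : ∀ᵐ s ∂(timeMeasure T), F' s - A' (y s) = F s - A (y s)) : IsSol j A' T F' y c where
  memLp := h.memLp
  memLp_force := hF'
  continuousOn := h.continuousOn
  ae_eq := h.ae_eq
  eq := fun t ht v => by
    rw [h.eq t ht, ← integral_timeMeasure ht.1, ← integral_timeMeasure ht.1]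
    congr 1
    refine integral_congr_ae ?_
    filter_upwards [ae_mono (Measure.restrict_mono (Ioo_subset_Ioo_right ht.2) le_rfl) he] with s hs
    rw [hs]

theorem restrict (h : IsSol j A T F y c) {t : ℝ} (ht : t ≤ T) : IsSol j A t F y c where
  memLp := h.memLp.mono_measure (Measure.restrict_mono (Ioo_subset_Ioo_right ht) le_rfl)
  memLp_force := h.memLp_force.mono_measure (Measure.restrict_mono (Ioo_subset_Ioo_right ht) le_rfl)
  continuousOn := h.continuousOn.mono (Icc_subset_Icc_right ht)
  ae_eq := ae_mono (Measure.restrict_mono (Ioo_subset_Ioo_right ht) le_rfl) h.ae_eq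
  eq := fun s hs => h.eq s ⟨hs.1, hs.2.trans ht⟩

variable {α ω : ℝ} [CompleteSpace V] [CompleteSpace H]

/-- A weak solution is too rough for the `C¹` energy estimate, but its second primitive `q2` is
`C¹`. Integrating the integrated equation once more shows that `q2` solves the homogeneous equation
with zero initial value. -/
theorem eq_zero (hA : GardingWith j A α ω) (hj : Function.Injective j) (hjd : DenseRange j)
    (hT : 0 < T) (h : IsSol j A T F y c) (hF : ∀ᵐ s ∂(timeMeasure T), F s = 0) (h0 : c 0 = 0) :
    (∀ t ∈ Icc 0 T, c t = 0) ∧ ∀ᵐ t ∂(timeMeasure T), y t = 0 := by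
  set q : ℝ → V := (Ioo 0 T).indicator y with hq
  have hqi : Integrable q := (show IntegrableOn y (Ioo 0 T) volume from
    h.memLp.integrable one_le_two).integrable_indicator measurableSet_Ioo
  set q1 : ℝ → V := fun t => ∫ s in (0 : ℝ)..t, q s with hq1
  set q2 : ℝ → V := fun t => ∫ s in (0 : ℝ)..t, q1 s with hq2
  have hq1c : Continuous q1 := intervalIntegral.continuous_primitive
    (fun a b => hqi.intervalIntegrable) 0
  obtain ⟨hq2C, hq2d⟩ := contDiff_primitive hq1c
  have hae : ∀ {t}, t ≤ T → timeMeasure t ≤ timeMeasure T := fun ht =>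
    Measure.restrict_mono (Ioo_subset_Ioo_right ht) le_rfl
  have hjq1 : ∀ t ∈ Icc 0 T, j (q1 t) = ∫ s in (0 : ℝ)..t, c s := fun t ht => by
    rw [hq1, ← ContinuousLinearMap.intervalIntegral_comp_comm _ hqi.intervalIntegrable,
      ← integral_timeMeasure ht.1, ← integral_timeMeasure ht.1]
    refine integral_congr_ae ?_
    filter_upwards [ae_mono (hae ht.2) h.ae_eq, ae_restrict_mem measurableSet_Ioo] with s hs hs'
    rw [hs, hq, indicator_of_mem (Ioo_subset_Ioo_right ht.2 hs')]
  have hc : ∀ t ∈ Icc 0 T, ∀ v, inner ℝ (c t) (j v) = - A (q1 t) v := fun t ht v => by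
    rw [h.eq t ht, h0, inner_zero_left, zero_add, hq1,
      ← ContinuousLinearMap.intervalIntegral_comp_comm _ hqi.intervalIntegrable,
      ContinuousLinearMap.intervalIntegral_apply, ← intervalIntegral.integral_neg,
      ← integral_timeMeasure ht.1, ← integral_timeMeasure ht.1]
    · refine integral_congr_ae ?_
      filter_upwards [ae_mono (hae ht.2) hF, ae_restrict_mem measurableSet_Ioo] with s hs hs'
      rw [hs, hq, indicator_of_mem (Ioo_subset_Ioo_right ht.2 hs')]
      simp
    · exact (A.integrable_comp hqi).intervalIntegrable
  have key : ∀ t ∈ Icc 0 T, gelfandMap j (q1 t) + A (q2 t) = 0 := by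
    intro t ht
    ext v
    have hci : IntervalIntegrable c volume 0 t :=
      (h.continuousOn.mono (by rw [uIcc_of_le ht.1]; exact Icc_subset_Icc_right ht.2)).intervalIntegrable
    have h1 : gelfandMap j (q1 t) v = ∫ s in (0 : ℝ)..t, inner ℝ (c s) (j v) := by
      rw [gelfandMap_apply, hjq1 t ht, real_inner_comm]
      simp only [fun s => real_inner_comm (j v) (c s)]
      exact ((innerSL ℝ (j v)).intervalIntegral_comp_comm hci).symm
    have h2 : A (q2 t) v = ∫ s in (0 : ℝ)..t, A (q1 s) v := by
      rw [hq2, ← ContinuousLinearMap.intervalIntegral_comp_comm _ (hq1c.intervalIntegrable _ _),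
        ContinuousLinearMap.intervalIntegral_apply]
      exact (A.continuous.comp hq1c).intervalIntegrable _ _
    rw [add_apply, h1, h2, intervalIntegral.integral_congr (g := fun s => - A (q1 s) v)]
    · simp
    · intro s hs
      rw [uIcc_of_le ht.1] at hs
      exact hc s ⟨hs.1, hs.2.trans ht.2⟩ v
  have hq2z : ∀ t ∈ Icc 0 T, q2 t = 0 := fun t ht =>
    eq_zero_of_homogeneous hA hj hq2C (by simp) (T := T)
      (fun s hs => by rw [hq2d]; exact key s hs) ht
  have hq1z := eqOn_zero_of_primitive_eq_zero hT hq1c.continuousOn hq2z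
  have hcz : ∀ t ∈ Icc 0 T, c t = 0 := fun t ht =>
    hjd.eq_zero_of_inner_left ℝ fun v => by rw [hc t ht, hq1z t ht]; simp
  refine ⟨hcz, ?_⟩
  filter_upwards [h.ae_eq, ae_restrict_mem measurableSet_Ioo] with t h1 h2
  exact hj (by rw [← h1, hcz t (Ioo_subset_Icc_self h2), map_zero])

theorem unique (hA : GardingWith j A α ω) (hj : Function.Injective j) (hjd : DenseRange j)
    (hT : 0 < T) (h₁ : IsSol j A T F₁ y₁ c₁) (h₂ : IsSol j A T F₂ y₂ c₂)
    (hF : ∀ᵐ s ∂(timeMeasure T), F₁ s = F₂ s) (h0 : c₁ 0 = c₂ 0) :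
    (∀ t ∈ Icc 0 T, c₁ t = c₂ t) ∧ ∀ᵐ t ∂(timeMeasure T), y₁ t = y₂ t := by
  have h := (h₁.lineComb h₂ 1 (-1)).eq_zero hA hj hjd hT
    (by filter_upwards [hF] with s hs; rw [hs, ← add_smul, add_neg_cancel, zero_smul]) (by simp [h0])
  simpa only [one_smul, neg_smul, ← sub_eq_add_neg, sub_eq_zero] using h

end IsSol

/-! ### Existence, energy estimate and Green's formula for weak solutions. -/

variable {V H : Type*} [NormedAddCommGroup V] [InnerProductSpace ℝ V]
  [NormedAddCommGroup H] [InnerProductSpace ℝ H] {j : V →L[ℝ] H} {A : V →L[ℝ] StrongDual ℝ V}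

theorem inner_eq_add_integral_of_contDiff {y : ℝ → V} (hy : ContDiff ℝ 1 y) (t : ℝ) (v : V) :
    inner ℝ (j (y t)) (j v) = inner ℝ (j (y 0)) (j v) +
      ∫ s in (0 : ℝ)..t, (parabolicOp j A y s - A (y s)) v := by
  have hd : ∀ s, HasDerivAt (fun s => gelfandMap j (y s) v) (gelfandMap j (deriv y s) v) s :=
    fun s => (((ContinuousLinearMap.apply ℝ ℝ v).comp (gelfandMap j)).hasFDerivAt.comp_hasDerivAt s
      (hy.differentiable one_ne_zero s).hasDerivAt)
  have hc : Continuous fun s => gelfandMap j (deriv y s) v := by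
    have := hy.continuous_deriv le_rfl
    fun_prop
  have h := intervalIntegral.integral_eq_sub_of_hasDerivAt (fun s _ => hd s)
    (hc.intervalIntegrable 0 t)
  simp only [parabolicOp, add_sub_cancel_right]
  rw [h, gelfandMap_apply, gelfandMap_apply]
  ring

/-- `(y, c)` is a limit of the `C¹` functions `z n`, with right-hand sides converging to `F`. -/
structure IsSmoothLimit (j : V →L[ℝ] H) (A : V →L[ℝ] StrongDual ℝ V) (T : ℝ)
    (F : ℝ → StrongDual ℝ V) (y : ℝ → V) (c : ℝ → H) (z : ℕ → ℝ → V) : Prop where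
  contDiff : ∀ n, ContDiff ℝ 1 (z n)
  tendsto : TendstoL2 T z y
  tendsto_force : TendstoL2 T (fun n => parabolicOp j A (z n)) F
  tendsto_apply : ∀ t ∈ Icc 0 T, Tendsto (fun n => j (z n t)) atTop (𝓝 (c t))

variable [CompleteSpace V] [CompleteSpace H] {α ω : ℝ}

/-- Take `C¹` functions whose data converge to `(F, x)`. The energy estimate for their differences
makes them Cauchy in `C([0,T];H)` and in `L²(0,T;V)`, and the integrated equation passes to the
limit. -/
theorem exists_isSol_isSmoothLimit (hA : GardingWith j A α ω) (hj : Function.Injective j)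
    (hjd : DenseRange j) {T : ℝ} (hT : 0 < T) {F : ℝ → StrongDual ℝ V}
    (hF : MemLp F 2 (timeMeasure T)) (x : H) :
    ∃ y c z, IsSol j A T F y c ∧ c 0 = x ∧ IsSmoothLimit j A T F y c z := by
  obtain ⟨z, hz, hzF, hzx⟩ := exists_seq_contDiff_approx hA hj hjd hT hF x
  have hα := hA.pos
  have hfm : ∀ n, MemLp (parabolicOp j A (z n)) 2 (timeMeasure T) := fun n =>
    (continuous_parabolicOp j A (hz n)).memLp_timeMeasure T
  have hzm : ∀ n, MemLp (z n) 2 (timeMeasure T) := fun n =>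
    (hz n).continuous.memLp_timeMeasure T
  have hp := (((tendstoL2_iff hT.le hfm hF).1 hzF).prodMk_nhds hzx).cauchySeq
  set p := fun n => ((hfm n).toLp, j (z n 0)) with hpdef
  set C := Real.exp (2 * ω * T) * (1 + α⁻¹) with hC
  have hest : ∀ m n, ∀ t ∈ Icc 0 T, ‖j (z m t) - j (z n t)‖ ^ 2 +
      α * ∫ s in (0 : ℝ)..t, ‖z m s - z n s‖ ^ 2 ≤ C * dist (p m) (p n) ^ 2 := by
    intro m n t ht
    have h := energy_estimate_of_contDiff (y := z m - z n) hA ((hz m).sub (hz n)) ht.1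
    have h1 : ∫ s in (0 : ℝ)..t, ‖gelfandMap j (deriv (z m - z n) s) + A ((z m - z n) s)‖ ^ 2 ≤
        ∫ s in (0 : ℝ)..T, ‖parabolicOp j A (z m) s - parabolicOp j A (z n) s‖ ^ 2 := by
      have hcont : Continuous fun s => ‖parabolicOp j A (z m) s - parabolicOp j A (z n) s‖ ^ 2 :=
        (((continuous_parabolicOp j A (hz m)).sub (continuous_parabolicOp j A (hz n))).norm.pow 2)
      have := parabolicOp_sub j A (hz m) (hz n)
      simp only [parabolicOp] at this
      simp only [this]
      exact intervalIntegral.integral_mono_interval le_rfl ht.1 ht.2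
        (Eventually.of_forall fun s => by positivity) (hcont.intervalIntegrable _ _)
    rw [← norm_toLp_sub_sq hT.le (hfm m) (hfm n)] at h1
    have h2 : ‖(hfm m).toLp - (hfm n).toLp‖ ≤ dist (p m) (p n) := by
      rw [← dist_eq_norm]; exact le_max_left _ _
    have h3 : ‖j ((z m - z n) 0)‖ ≤ dist (p m) (p n) := by
      rw [Pi.sub_apply, map_sub, ← dist_eq_norm]; exact le_max_right _ _
    have h2' := pow_le_pow_left₀ (norm_nonneg _) h2 2
    have h3' := pow_le_pow_left₀ (norm_nonneg _) h3 2
    have h4 : Real.exp (2 * ω * t) ≤ Real.exp (2 * ω * T) := Real.exp_le_exp.2 (by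
      have := hA.nonneg
      nlinarith [ht.2])
    simp only [Pi.sub_apply, map_sub] at h h3'
    refine h.trans ?_
    rw [hC, mul_assoc (Real.exp (2 * ω * T))]
    refine mul_le_mul h4 ?_ (by
      have := intervalIntegral.integral_nonneg (μ := volume) (f := fun s => ‖gelfandMap j (deriv (z m - z n) s) + (A (z m s) - A (z n s))‖ ^ 2) ht.1 fun _ _ => by positivity
      positivity) (Real.exp_pos _).le
    simp only [Pi.sub_apply, map_sub] at h1
    have := mul_le_mul_of_nonneg_left (h1.trans h2') (inv_pos.2 hα).le
    linarith
  have hyC : CauchySeq fun n => (hzm n).toLp := by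
    refine cauchySeq_of_dist_sq_le (C := α⁻¹ * C) hp fun m n => ?_
    rw [dist_eq_norm, norm_toLp_sub_sq hT.le]
    have := hest m n T (right_mem_Icc.2 hT.le)
    rw [mul_assoc, le_inv_mul_iff₀ hα]
    exact le_trans (le_add_of_nonneg_left (sq_nonneg _)) this
  set g : ℕ → C(Icc 0 T, H) := fun n =>
    ⟨fun t => j (z n t), j.continuous.comp ((hz n).continuous.comp continuous_subtype_val)⟩ with hg
  have hgC : CauchySeq g := by
    refine cauchySeq_of_dist_sq_le (C := C) hp fun m n => ?_
    have hC0 : 0 ≤ C := by positivity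
    have h1 : dist (g m) (g n) ≤ √(C * dist (p m) (p n) ^ 2) := by
      rw [ContinuousMap.dist_le (Real.sqrt_nonneg _)]
      intro t
      refine Real.le_sqrt_of_sq_le ?_
      rw [dist_eq_norm]
      refine le_trans (le_add_of_nonneg_right ?_) (hest m n t t.2)
      exact mul_nonneg hα.le (intervalIntegral.integral_nonneg t.2.1 fun _ _ => by positivity)
    calc dist (g m) (g n) ^ 2 ≤ √(C * dist (p m) (p n) ^ 2) ^ 2 :=
          pow_le_pow_left₀ dist_nonneg h1 2
      _ = C * dist (p m) (p n) ^ 2 := Real.sq_sqrt (by positivity)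
  obtain ⟨y, hy⟩ := cauchySeq_tendsto_of_complete hyC
  obtain ⟨G, hG⟩ := cauchySeq_tendsto_of_complete hgC
  set c : ℝ → H := IccExtend hT.le G with hc
  have hzy : TendstoL2 T z y := by
    rw [tendstoL2_iff hT.le hzm (Lp.memLp y), Lp.toLp_coeFn]
    exact hy
  have hzc : ∀ t ∈ Icc 0 T, Tendsto (fun n => j (z n t)) atTop (𝓝 (c t)) := by
    intro t ht
    rw [hc, IccExtend_of_mem _ _ ht]
    exact ((continuous_eval_const (⟨t, ht⟩ : Icc 0 T)).tendsto G).comp hG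
  have hcx : c 0 = x := tendsto_nhds_unique (hzc 0 (left_mem_Icc.2 hT.le)) hzx
  refine ⟨y, c, z, ⟨Lp.memLp y, hF, ?_, ?_, ?_⟩, hcx, ⟨hz, hzy, hzF, hzc⟩⟩
  · exact (G.continuous.Icc_extend' ).continuousOn
  -- The uniform limit `c` and the `L²` limit `y` are identified along a subsequence converging
  -- almost everywhere.
  · obtain ⟨ns, hns, hae⟩ := (tendstoInMeasure_of_tendsto_Lp hy).exists_seq_tendsto_ae
    have h1 : ∀ᵐ s ∂(timeMeasure T), ∀ n, ((hzm n).toLp (z n) : L2Time T V) s = z n s :=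
      ae_all_iff.2 fun n => (hzm n).coeFn_toLp
    filter_upwards [hae, h1, ae_restrict_mem measurableSet_Ioo] with s h2 h3 h4
    simp only [h3] at h2
    exact tendsto_nhds_unique ((hzc s (Ioo_subset_Icc_self h4)).comp hns.tendsto_atTop)
      ((j.continuous.tendsto _).comp h2)
  · intro t ht v
    have hAz : TendstoL2 T (fun n s => parabolicOp j A (z n) s - A (z n s)) (fun s => F s - A (y s)) := by
      have e1 := (tendstoL2_iff hT.le hfm hF).1 hzF
      have hAm : ∀ n, MemLp (fun s => A (z n s)) 2 (timeMeasure T) := fun n => A.comp_memLp' (hzm n)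
      have hAy : MemLp (fun s => A (y s)) 2 (timeMeasure T) := A.comp_memLp' (Lp.memLp y)
      have e2 : Tendsto (fun n => (hAm n).toLp) atTop (𝓝 hAy.toLp) := by
        have h5 := ((A.compLpL 2 (timeMeasure T)).continuous.tendsto y).comp hy
        have h6 : ∀ w : L2Time T V, ∀ hw : MemLp (fun s => A (w s)) 2 (timeMeasure T),
            A.compLpL 2 (timeMeasure T) w = hw.toLp := fun w hw => by
          refine Lp.ext ?_
          filter_upwards [A.coeFn_compLpL w, hw.coeFn_toLp] with s h7 h8
          rw [h7, h8]
        rw [h6 y hAy] at h5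
        refine h5.congr fun n => ?_
        refine Lp.ext ?_
        filter_upwards [A.coeFn_compLpL (hzm n).toLp, (hAm n).coeFn_toLp, (hzm n).coeFn_toLp]
          with s h7 h8 h9
        rw [Function.comp_apply, h7, h8, h9]
      exact (tendstoL2_iff hT.le (fun n => (hfm n).sub (hAm n)) (hF.sub hAy)).2 (e1.sub e2)
    have h1 := hAz.integral_apply (fun n => (hfm n).sub (A.comp_memLp' (hzm n)))
      (hF.sub (A.comp_memLp' (Lp.memLp y))) v ht
    have h2 : Tendsto (fun n => inner ℝ (j (z n t)) (j v)) atTop (𝓝 (inner ℝ (c t) (j v))) :=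
      (hzc t ht).inner tendsto_const_nhds
    have h3 : Tendsto (fun n => inner ℝ (j (z n 0)) (j v)) atTop (𝓝 (inner ℝ (c 0) (j v))) :=
      (hzc 0 (left_mem_Icc.2 hT.le)).inner tendsto_const_nhds
    refine tendsto_nhds_unique h2 ((h3.add h1).congr fun n => ?_)
    exact (inner_eq_add_integral_of_contDiff (hz n) t v).symm

namespace IsSol

variable {T : ℝ} {F F₁ : ℝ → StrongDual ℝ V} {y : ℝ → V} {c : ℝ → H}

/-- By uniqueness any solution is the one constructed as a limit. Estimates and identities for `C¹`
functions thereby transfer to weak solutions. -/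
theorem exists_isSmoothLimit (h : IsSol j A T F y c) (hA : GardingWith j A α ω)
    (hj : Function.Injective j) (hjd : DenseRange j) (hT : 0 < T) :
    ∃ z, IsSmoothLimit j A T F y c z := by
  obtain ⟨y', c', z, h', h0, hz⟩ := exists_isSol_isSmoothLimit hA hj hjd hT h.memLp_force (c 0)
  obtain ⟨h1, h2⟩ := h'.unique hA hj hjd hT h (Eventually.of_forall fun _ => rfl) h0
  refine ⟨z, hz.contDiff, ?_, hz.tendsto_force, fun t ht => h1 t ht ▸ hz.tendsto_apply t ht⟩
  refine hz.tendsto.congr fun n => ?_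
  rw [← integral_timeMeasure hT.le, ← integral_timeMeasure hT.le]
  refine integral_congr_ae ?_
  filter_upwards [h2] with s hs
  rw [hs]

theorem energy_estimate (h : IsSol j A T F y c) (hA : GardingWith j A α ω)
    (hj : Function.Injective j) (hjd : DenseRange j) (hT : 0 < T) :
    ‖c T‖ ^ 2 + α * ∫ s in (0 : ℝ)..T, ‖y s‖ ^ 2 ≤
      Real.exp (2 * ω * T) * (‖c 0‖ ^ 2 + α⁻¹ * ∫ s in (0 : ℝ)..T, ‖F s‖ ^ 2) := by
  obtain ⟨z, hz⟩ := h.exists_isSmoothLimit hA hj hjd hT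
  have h1 := hz.tendsto.integral_norm_sq hT.le
    (fun n => (hz.contDiff n).continuous.memLp_timeMeasure T) h.memLp
  have h2 := hz.tendsto_force.integral_norm_sq hT.le
    (fun n => (continuous_parabolicOp j A (hz.contDiff n)).memLp_timeMeasure T) h.memLp_force
  have h3 := ((hz.tendsto_apply T (right_mem_Icc.2 hT.le)).norm.pow 2).add (h1.const_mul α)
  have h4 := (((hz.tendsto_apply 0 (left_mem_Icc.2 hT.le)).norm.pow 2).add
    (h2.const_mul α⁻¹)).const_mul (Real.exp (2 * ω * T))
  exact le_of_tendsto_of_tendsto' h3 h4 fun n =>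
    energy_estimate_of_contDiff hA (hz.contDiff n) hT.le

/-- Green's formula for a solution of `∂ₜ y + A y = F` and a solution `z` of `∂ₜ z + A* z = 0`,
the latter run backwards in time. -/
theorem green (h : IsSol j A T F y c) {z : ℝ → V} {e : ℝ → H}
    (h' : IsSol j A.flip T (fun _ => 0) z e) (hA : GardingWith j A α ω)
    (hj : Function.Injective j) (hjd : DenseRange j) (hT : 0 < T) :
    inner ℝ (c T) (e 0) = inner ℝ (c 0) (e T) + ∫ s in (0 : ℝ)..T, F s (z (T - s)) := by
  obtain ⟨Y, hY⟩ := h.exists_isSmoothLimit hA hj hjd hT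
  obtain ⟨Z, hZ⟩ := h'.exists_isSmoothLimit hA.flip hj hjd hT
  have hT0 : (0 : ℝ) ∈ Icc 0 T := left_mem_Icc.2 hT.le
  have hTT : T ∈ Icc 0 T := right_mem_Icc.2 hT.le
  have hYm := fun n => (hY.contDiff n).continuous.memLp_timeMeasure T
  have hYf := fun n => (continuous_parabolicOp j A (hY.contDiff n)).memLp_timeMeasure T
  have hrefl : ∀ {E : Type _} [NormedAddCommGroup E] {f : ℕ → ℝ → E} {g : ℝ → E},
      TendstoL2 T f g → TendstoL2 T (fun n s => f n (T - s)) (fun s => g (T - s)) := by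
    intro E _ f g hfg
    refine hfg.congr fun n => ?_
    have := intervalIntegral.integral_comp_sub_left (a := 0) (b := T)
      (fun s => ‖f n s - g s‖ ^ 2) T
    simp only [sub_zero, sub_self] at this
    exact this.symm
  have hYc := fun n => (hY.contDiff n).continuous
  have hZc := fun n => (hZ.contDiff n).continuous
  have hPY := fun n => continuous_parabolicOp j A (hY.contDiff n)
  have hPZ := fun n => continuous_parabolicOp j A.flip (hZ.contDiff n)
  have hPZ' : ∀ n, Continuous fun s => parabolicOp j A.flip (Z n) (T - s) := fun n =>
    (hPZ n).comp (continuous_const.sub continuous_id)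
  have hZ' : ∀ n, Continuous fun s => Z n (T - s) := fun n =>
    (hZc n).comp (continuous_const.sub continuous_id)
  -- For `C¹` functions the formula is the fundamental theorem of calculus for `s ↦ (j Y(s), j Z(T -
  -- s))`. The terms with `A` cancel between the operator and its transpose.
  have key : ∀ n, inner ℝ (j (Y n T)) (j (Z n 0)) - inner ℝ (j (Y n 0)) (j (Z n T)) =
      (∫ s in (0 : ℝ)..T, parabolicOp j A (Y n) s (Z n (T - s))) -
      ∫ s in (0 : ℝ)..T, parabolicOp j A.flip (Z n) (T - s) (Y n s) := by
    intro n
    have hd : ∀ s, HasDerivAt (fun s => inner ℝ (j (Y n s)) (j (Z n (T - s))))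
        (parabolicOp j A (Y n) s (Z n (T - s)) - parabolicOp j A.flip (Z n) (T - s) (Y n s)) s := by
      intro s
      have h1 := j.hasFDerivAt.comp_hasDerivAt s ((hY.contDiff n).differentiable one_ne_zero s).hasDerivAt
      have h2 := ((hZ.contDiff n).differentiable one_ne_zero (T - s)).hasDerivAt.scomp s
        ((hasDerivAt_id s).const_sub T)
      have h3 := h1.inner ℝ (j.hasFDerivAt.comp_hasDerivAt s h2)
      refine h3.congr_deriv ?_
      simp [parabolicOp, gelfandMap_apply]
      rw [real_inner_comm (j (Y n s))]
      ring
    have hc1 : Continuous fun s => parabolicOp j A (Y n) s (Z n (T - s)) := (hPY n).clm_apply (hZ' n)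
    have hc2 : Continuous fun s => parabolicOp j A.flip (Z n) (T - s) (Y n s) :=
      (hPZ' n).clm_apply (hYc n)
    have h4 := intervalIntegral.integral_eq_sub_of_hasDerivAt (fun s _ => hd s)
      ((hc1.sub hc2).intervalIntegrable 0 T)
    rw [intervalIntegral.integral_sub (hc1.intervalIntegrable _ _) (hc2.intervalIntegrable _ _)] at h4
    simpa using h4.symm
  have h1 := hY.tendsto_force.pairing hT.le (hrefl hZ.tendsto) hYf h.memLp_force
    (fun n => (hZ' n).memLp_timeMeasure T)
    (h'.memLp.comp_measurePreserving (measurePreserving_reflect T))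
  have h2 := (hrefl hZ.tendsto_force).pairing hT.le hY.tendsto
    (fun n => (hPZ' n).memLp_timeMeasure T)
    (h'.memLp_force.comp_measurePreserving (measurePreserving_reflect T)) hYm h.memLp
  have h3 := ((hY.tendsto_apply T hTT).inner (𝕜 := ℝ) (hZ.tendsto_apply 0 hT0)).sub
    ((hY.tendsto_apply 0 hT0).inner (𝕜 := ℝ) (hZ.tendsto_apply T hTT))
  have h4 := tendsto_nhds_unique h3 ((h1.sub h2).congr fun n => (key n).symm)
  simp only [zero_apply, intervalIntegral.integral_zero, sub_zero] at h4
  linarith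

end IsSol

/-! ### Weak time derivatives and the integrated equation. -/

/-- The du Bois-Reymond lemma: a function with vanishing weak derivative is constant. -/
theorem exists_ae_eq_const_of_integral_deriv_smul_eq_zero {E : Type*} [NormedAddCommGroup E]
    [NormedSpace ℝ E] [CompleteSpace E] {T : ℝ} (hT : 0 < T) {k : ℝ → E}
    (hk : Integrable k (timeMeasure T))
    (h : ∀ φ : ℝ → ℝ, ContDiff ℝ (⊤ : ℕ∞) φ → HasCompactSupport φ → tsupport φ ⊆ Ioo 0 T →
      ∫ t in Ioo 0 T, deriv φ t • k t = 0) :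
    ∃ ξ : E, ∀ᵐ t ∂(timeMeasure T), k t = ξ := by
  -- Any outer radius below `T / 2` keeps the support inside `(0,T)`.
  let b : ContDiffBump (T / 2) := ⟨T / 8, T / 4, by positivity, by linarith⟩
  set ρ : ℝ → ℝ := b.normed volume with hρ
  have hρC : ContDiff ℝ (⊤ : ℕ∞) ρ := b.contDiff_normed
  have hρs : HasCompactSupport ρ := b.hasCompactSupport_normed
  have hρT : tsupport ρ ⊆ Ioo 0 T := by
    rw [hρ, b.tsupport_normed_eq, Real.closedBall_eq_Icc]
    intro x hx
    change T / 2 - T / 4 ≤ x ∧ x ≤ T / 2 + T / 4 at hx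
    constructor <;> linarith [hx.1, hx.2]
  have hρ1 : ∫ t, ρ t = 1 := b.integral_normed
  set ξ : E := ∫ t in Ioo 0 T, ρ t • k t with hξ
  refine ⟨ξ, ?_⟩
  have hsmul : ∀ {f : ℝ → ℝ}, Continuous f → Integrable (fun t => f t • k t) (timeMeasure T) := by
    intro f hf
    rw [← integrableOn_univ]
    have h1 : IntervalIntegrable k volume 0 T := intervalIntegrable_of_integrable hk
      (left_mem_Icc.2 hT.le) (right_mem_Icc.2 hT.le)
    have h2 := h1.continuousOn_smul hf.continuousOn
    rw [intervalIntegrable_iff_integrableOn_Ioo_of_le hT.le] at h2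
    rw [integrableOn_univ]
    exact h2
  have h0 : ∀ᵐ t, t ∈ Ioo 0 T → k t - ξ = 0 := by
    refine isOpen_Ioo.ae_eq_zero_of_integral_contDiff_smul_eq_zero
      (f := fun t => k t - ξ) ?_ fun ψ hψ hψs hψT => ?_
    · exact ((show IntegrableOn k (Ioo 0 T) volume from hk).sub
        (integrableOn_const (by simp))).locallyIntegrableOn
    -- Subtracting the multiple of `ρ` makes the mean zero, so the primitive of `χ` is again
    -- compactly supported in `(0,T)` and is an admissible test function.
    set χ : ℝ → ℝ := fun t => ψ t - (∫ s, ψ s) * ρ t with hχ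
    have hχC : ContDiff ℝ (⊤ : ℕ∞) χ := hψ.sub (contDiff_const.mul hρC)
    have hχs : HasCompactSupport χ := hψs.sub hρs.mul_left
    have hχT : tsupport χ ⊆ Ioo 0 T := by
      refine (tsupport_sub _ _).trans (union_subset hψT ?_)
      exact (tsupport_mul_subset_right (f := fun _ : ℝ => ∫ s, ψ s)).trans hρT
    have hψi : Integrable ψ := hψ.continuous.integrable_of_hasCompactSupport hψs
    have hρi : Integrable ρ := hρC.continuous.integrable_of_hasCompactSupport hρs
    have hχ0 : ∫ t, χ t = 0 := by
      rw [hχ, integral_sub hψi (hρi.const_mul _), integral_const_mul, hρ1]; simp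
    set φ : ℝ → ℝ := fun t => ∫ s in (0 : ℝ)..t, χ s with hφ
    obtain ⟨hφ1, hφd⟩ := contDiff_primitive hχC.continuous
    have hφC : ContDiff ℝ (⊤ : ℕ∞) φ := by
      rw [contDiff_infty_iff_deriv]
      refine ⟨hφ1.differentiable one_ne_zero, ?_⟩
      rw [show deriv φ = χ from funext hφd]
      exact hχC
    -- The added point makes `K` nonempty, so that its infimum and supremum belong to it and lie in
    -- `(0,T)`.
    set K := insert (T / 2) (tsupport χ) with hK
    have hKc : IsCompact K := hχs.isCompact.insert _
    have hKT : K ⊆ Ioo 0 T := insert_subset (by constructor <;> linarith) hχT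
    have hKn : K.Nonempty := insert_nonempty _ _
    have ha := hKT (hKc.sInf_mem hKn)
    have hb := hKT (hKc.sSup_mem hKn)
    have hχz : ∀ t, t ∉ Icc (sInf K) (sSup K) → χ t = 0 := fun t ht => by
      by_contra hne
      have : t ∈ K := mem_insert_of_mem _ (subset_tsupport _ hne)
      exact ht ⟨csInf_le hKc.bddBelow this, le_csSup hKc.bddAbove this⟩
    have hφsub : tsupport φ ⊆ Icc (sInf K) (sSup K) := by
      refine closure_minimal (fun t ht => ?_) isClosed_Icc
      by_contra hne
      apply ht
      rcases lt_or_ge t (sInf K) with h1 | h1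
      · rw [hφ]
        refine (intervalIntegral.integral_congr (g := fun _ => (0 : ℝ)) fun s hs => ?_).trans (by simp)
        refine hχz s fun hs' => ?_
        have := (mem_uIcc.1 hs)
        rcases this with h2 | h2 <;> linarith [h2.1, h2.2, hs'.1, ha.1]
      · have h2 : sSup K < t := by
          by_contra h3; exact hne ⟨h1, not_lt.1 h3⟩
        rw [hφ]
        simp only
        rw [intervalIntegral.integral_eq_integral_of_support_subset, hχ0]
        intro s hs
        have hs' : s ∈ Icc (sInf K) (sSup K) := by
          by_contra h3; exact hs (hχz s h3)
        exact ⟨by linarith [hs'.1, ha.1], by linarith [hs'.2]⟩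
    have hφT : tsupport φ ⊆ Ioo 0 T := fun t ht =>
      ⟨lt_of_lt_of_le ha.1 (hφsub ht).1, lt_of_le_of_lt (hφsub ht).2 hb.2⟩
    have h1 := h φ hφC (isCompact_Icc.of_isClosed_subset (isClosed_tsupport _) hφsub) hφT
    simp only [hφ, hφd] at h1
    have h2 : ∫ t, ψ t • (k t - ξ) = ∫ t in Ioo 0 T, ψ t • (k t - ξ) := by
      refine (setIntegral_eq_integral_of_forall_compl_eq_zero fun t ht => ?_).symm
      rw [image_eq_zero_of_notMem_tsupport fun h3 => ht (hψT h3), zero_smul]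
    have h3 : ∫ t, ψ t = ∫ t in Ioo 0 T, ψ t := by
      refine (setIntegral_eq_integral_of_forall_compl_eq_zero fun t ht => ?_).symm
      rw [image_eq_zero_of_notMem_tsupport fun h3 => ht (hψT h3)]
    rw [h2]
    simp only [smul_sub]
    rw [integral_sub (hsmul hψ.continuous) (hψi.integrableOn.smul_const ξ), integral_smul_const, ← h3]
    simp only [hχ, sub_smul, mul_smul] at h1
    rw [integral_sub (hsmul hψ.continuous) (show Integrable (fun t => (∫ s, ψ s) • ρ t • k t) _ from
      (hsmul hρC.continuous).smul _), integral_smul] at h1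
    exact h1
  rw [ae_restrict_iff' measurableSet_Ioo]
  filter_upwards [h0] with t ht htm using sub_eq_zero.1 (ht htm)

namespace ControlSystem

variable {V H : Type*} [NormedAddCommGroup V] [InnerProductSpace ℝ V]
  [NormedAddCommGroup H] [InnerProductSpace ℝ H]
  {Ω : Type*} [MeasurableSpace Ω] {ρ : Measure Ω} (P : ControlSystem V H ρ)

/-- The function `toDual y` minus the primitive of `g` has vanishing weak derivative, hence is
almost everywhere a constant functional. Continuity of `c` extends the identity to every `t`. The
converse is integration by parts. -/
theorem isW_iff {T : ℝ} (hT : 0 < T) (y : L2Time T V) (g : L2Time T (StrongDual ℝ V))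
    (c : ℝ → H) : P.IsW T y g c ↔ ContinuousOn c (Icc 0 T) ∧
      (∀ᵐ t ∂(timeMeasure T), c t = P.emb (y t)) ∧
      ∀ t ∈ Icc 0 T, ∀ v, inner ℝ (c t) (P.emb v) =
        inner ℝ (c 0) (P.emb v) + ∫ s in (0 : ℝ)..t, g s v := by
  have hgi : Integrable g (timeMeasure T) := (Lp.memLp g).integrable one_le_two
  have hyi : Integrable (fun t => P.toDual (y t)) (timeMeasure T) :=
    P.toDual.integrable_comp ((Lp.memLp y).integrable one_le_two)
  have h0 : (0 : ℝ) ∈ Icc 0 T := left_mem_Icc.2 hT.le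
  have hTT : T ∈ Icc 0 T := right_mem_Icc.2 hT.le
  have hgI := intervalIntegrable_of_integrable hgi h0 hTT
  have hGc : ContinuousOn (fun t => ∫ s in (0 : ℝ)..t, g s) (Icc 0 T) := by
    have := intervalIntegral.continuousOn_primitive_interval' hgI left_mem_uIcc
    rwa [uIcc_of_le hT.le] at this
  have hGv : ∀ t ∈ Icc 0 T, ∀ v, (∫ s in (0 : ℝ)..t, g s) v = ∫ s in (0 : ℝ)..t, g s v :=
    fun t ht v => ContinuousLinearMap.intervalIntegral_apply
      (intervalIntegrable_of_integrable hgi h0 ht) v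
  have hend : ∀ φ : ℝ → ℝ, tsupport φ ⊆ Ioo 0 T → φ 0 = 0 ∧ φ T = 0 := fun φ hφ =>
    ⟨image_eq_zero_of_notMem_tsupport fun h => lt_irrefl _ (hφ h).1,
      image_eq_zero_of_notMem_tsupport fun h => lt_irrefl _ (hφ h).2⟩
  have hprim : ∀ φ : ℝ → ℝ, ContDiff ℝ (⊤ : ℕ∞) φ → tsupport φ ⊆ Ioo 0 T →
      ∫ t in Ioo 0 T, deriv φ t • ∫ s in (0 : ℝ)..t, g s = -∫ t in Ioo 0 T, φ t • g t := by
    intro φ hφ hφT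
    have := integral_deriv_smul_primitive (hφ.of_le (by exact_mod_cast le_top)) hgI
    rw [(hend φ hφT).2, zero_smul, zero_sub, ← integral_timeMeasure hT.le,
      ← integral_timeMeasure hT.le] at this
    exact this
  have hsmul : ∀ {φ : ℝ → ℝ}, ContDiff ℝ (⊤ : ℕ∞) φ → ∀ {k : ℝ → StrongDual ℝ V},
      Integrable k (timeMeasure T) → IntegrableOn (fun t => deriv φ t • k t) (Ioo 0 T) volume := by
    intro φ hφ k hk
    have h2 := (intervalIntegrable_of_integrable hk h0 hTT).continuousOn_smul
      (hφ.continuous_deriv (by exact_mod_cast le_top)).continuousOn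
    rwa [intervalIntegrable_iff_integrableOn_Ioo_of_le hT.le] at h2
  constructor
  · rintro ⟨hw, hc, hae⟩
    refine ⟨hc, hae, ?_⟩
    obtain ⟨ξ, hξ⟩ := exists_ae_eq_const_of_integral_deriv_smul_eq_zero hT
      (hyi.sub hGc.integrable_timeMeasure) fun φ hφ hφs hφT => by
        simp only [Pi.sub_apply, smul_sub]
        rw [integral_sub (hsmul hφ hyi) (hsmul hφ hGc.integrable_timeMeasure), hw φ hφ hφs hφT,
          hprim φ hφ hφT, sub_self]
    have hall : ∀ v, ∀ t ∈ Icc 0 T, inner ℝ (c t) (P.emb v) = ξ v + ∫ s in (0 : ℝ)..t, g s v := by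
      intro v
      have hcv : ContinuousOn (fun t => inner ℝ (c t) (P.emb v)) (Icc 0 T) :=
        hc.inner continuousOn_const
      have hcv' : ContinuousOn (fun t => ξ v + (∫ s in (0 : ℝ)..t, g s) v) (Icc 0 T) :=
        continuousOn_const.add (hGc.clm_apply continuousOn_const)
      have hev : (fun t => inner ℝ (c t) (P.emb v)) =ᵐ[volume.restrict (Icc 0 T)]
          fun t => ξ v + (∫ s in (0 : ℝ)..t, g s) v := by
        rw [← restrict_Ioo_eq_restrict_Icc]
        filter_upwards [hξ, hae] with t h1 h2
        rw [h2, ← P.toDual_apply, ← h1]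
        simp
      have := Measure.eqOn_Icc_of_ae_eq volume hT.ne hev hcv hcv'
      intro t ht
      rw [← hGv t ht]
      exact this ht
    intro t ht v
    have h1 := hall v 0 h0
    rw [intervalIntegral.integral_same, add_zero] at h1
    rw [hall v t ht, h1]
  · rintro ⟨hc, hae, heq⟩
    refine ⟨fun φ hφ hφs hφT => ?_, hc, hae⟩
    set ξ : StrongDual ℝ V := (innerSL ℝ (c 0)).comp P.emb with hξ
    have h1 : ∫ t in Ioo 0 T, deriv φ t • P.toDual (y t) =
        ∫ t in Ioo 0 T, (deriv φ t • ξ + deriv φ t • ∫ s in (0 : ℝ)..t, g s) := by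
      refine integral_congr_ae ?_
      filter_upwards [hae, ae_restrict_mem measurableSet_Ioo] with t h2 h3
      rw [← smul_add]
      congr 1
      ext v
      rw [P.toDual_apply, ← h2, heq t (Ioo_subset_Icc_self h3), add_apply,
        hGv t (Ioo_subset_Icc_self h3)]
      rfl
    have h2 : ∫ t in Ioo 0 T, deriv φ t • ξ = 0 := by
      rw [integral_smul_const]
      have h3 : ∫ t in Ioo 0 T, deriv φ t = 0 := by
        have := intervalIntegral.integral_deriv_eq_sub' (a := 0) (b := T) φ rfl
          (fun t _ => hφ.differentiable (by simp) t)
          (hφ.continuous_deriv (by exact_mod_cast le_top)).continuousOn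
        rw [(hend φ hφT).1, (hend φ hφT).2, ← integral_timeMeasure hT.le, sub_zero] at this
        exact this
      rw [h3, zero_smul]
    rw [h1, integral_add (hsmul hφ (integrable_const ξ))
      (hsmul hφ hGc.integrable_timeMeasure), h2, zero_add, hprim φ hφ hφT]

end ControlSystem

/-! ### Time scaling and time reversal. -/

section Scaling

theorem map_mul_timeMeasure {l : ℝ} (hl : 0 < l) (T : ℝ) :
    Measure.map (fun s => l * s) (timeMeasure T) = ENNReal.ofReal l⁻¹ • timeMeasure (l * T) := by
  have h1 : Ioo 0 T = (fun s => l * s) ⁻¹' Ioo 0 (l * T) := by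
    ext s
    simp only [mem_Ioo, mem_preimage, mul_pos_iff_of_pos_left hl, mul_lt_mul_iff_right₀ hl]
  rw [timeMeasure, h1, ← Measure.restrict_map (measurable_const_mul l) measurableSet_Ioo,
    Real.map_volume_mul_left hl.ne', Measure.restrict_smul, abs_of_pos (inv_pos.2 hl)]

theorem quasiMeasurePreserving_mul {l : ℝ} (hl : 0 < l) (T : ℝ) :
    Measure.QuasiMeasurePreserving (fun s => l * s) (timeMeasure T) (timeMeasure (l * T)) := by
  refine ⟨measurable_const_mul l, ?_⟩
  rw [map_mul_timeMeasure hl]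
  exact Measure.smul_absolutelyContinuous

theorem memLp_comp_mul {E : Type*} [NormedAddCommGroup E] {l : ℝ} (hl : 0 < l) {T : ℝ} {f : ℝ → E}
    (hf : MemLp f 2 (timeMeasure (l * T))) : MemLp (fun s => f (l * s)) 2 (timeMeasure T) := by
  have h : MemLp f 2 (Measure.map (fun s => l * s) (timeMeasure T)) := by
    rw [map_mul_timeMeasure hl]
    exact hf.smul_measure ENNReal.ofReal_ne_top
  exact (memLp_map_measure_iff h.1 (measurable_const_mul l).aemeasurable).1 h

variable {V H : Type*} [NormedAddCommGroup V] [InnerProductSpace ℝ V]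
  [NormedAddCommGroup H] [InnerProductSpace ℝ H] {j : V →L[ℝ] H} {A : V →L[ℝ] StrongDual ℝ V}
  {T : ℝ} {F : ℝ → StrongDual ℝ V} {y : ℝ → V} {c : ℝ → H}

/-- Scaling trades the length of the horizon for a coefficient of the equation. It reduces all
horizons to `(0,1)`, and it also allows `z(l ·)` to be compared with `z` in the regularity proof. -/
theorem IsSol.comp_mul {l : ℝ} (hl : 0 < l) (h : IsSol j A (l * T) F y c) :
    IsSol j (l • A) T (fun s => l • F (l * s)) (fun s => y (l * s)) (fun s => c (l * s)) where
  memLp := memLp_comp_mul hl h.memLp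
  memLp_force := (memLp_comp_mul hl h.memLp_force).const_smul l
  continuousOn := h.continuousOn.comp (by fun_prop) fun s hs =>
    ⟨mul_nonneg hl.le hs.1, mul_le_mul_of_nonneg_left hs.2 hl.le⟩
  ae_eq := (quasiMeasurePreserving_mul hl T).ae h.ae_eq
  eq := fun t ht v => by
    simp only [mul_zero]
    rw [h.eq (l * t) ⟨mul_nonneg hl.le ht.1, mul_le_mul_of_nonneg_left ht.2 hl.le⟩]
    have := intervalIntegral.smul_integral_comp_mul_left (a := 0) (b := t)
      (fun s => (F s - A (y s)) v) l
    rw [mul_zero] at this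
    rw [← this, smul_eq_mul, ← intervalIntegral.integral_const_mul]
    congr 1
    refine intervalIntegral.integral_congr fun s _ => ?_
    simp only [sub_apply, smul_apply, smul_eq_mul]
    ring

/-- Time reversal of the integrated form of the equation. -/
theorem integral_form_reflect {H : Type*} [NormedAddCommGroup H] [InnerProductSpace ℝ H] {x : H}
    {T : ℝ} (hT : 0 ≤ T) {c : ℝ → H} {g : ℝ → ℝ} (hg : Integrable g (timeMeasure T))
    (h : ∀ t ∈ Icc 0 T, inner ℝ (c t) x = inner ℝ (c 0) x + ∫ s in (0 : ℝ)..t, g s) :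
    ∀ t ∈ Icc 0 T, inner ℝ (c (T - t)) x = inner ℝ (c (T - 0)) x +
      ∫ s in (0 : ℝ)..t, -g (T - s) := by
  intro t ht
  have h0 : (0 : ℝ) ∈ Icc 0 T := left_mem_Icc.2 hT
  have hTT : T ∈ Icc 0 T := right_mem_Icc.2 hT
  have ht' : T - t ∈ Icc 0 T := ⟨by linarith [ht.2], by linarith [ht.1]⟩
  rw [sub_zero, h _ ht', h T hTT, intervalIntegral.integral_neg,
    intervalIntegral.integral_comp_sub_left (fun s => g s), sub_zero,
    ← intervalIntegral.integral_add_adjacent_intervals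
      (intervalIntegrable_of_integrable hg h0 ht') (intervalIntegrable_of_integrable hg ht' hTT)]
  ring

end Scaling

/-! ### State and adjoint equations as weak solutions. -/

namespace ControlSystem

variable {V H : Type*} [NormedAddCommGroup V] [InnerProductSpace ℝ V]
  [NormedAddCommGroup H] [InnerProductSpace ℝ H]
  {Ω : Type*} [MeasurableSpace Ω] {ρ : Measure Ω} {P : ControlSystem V H ρ}

theorem isState_iff {T ν : ℝ} (hT : 0 < T) {u : L2Time T (Lp ℝ 2 ρ)} {y : L2Time T V} {c : ℝ → H} :
    P.IsState T ν u y c ↔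
      IsSol P.emb (ν • P.a) T (fun s => ν • P.B (u s)) y c ∧ c 0 = P.y₀ := by
  have hF : MemLp (fun s => ν • P.B (u s)) 2 (timeMeasure T) :=
    (P.B.comp_memLp' (Lp.memLp u)).const_smul ν
  have hA : MemLp (fun s => (ν • P.a) (y s)) 2 (timeMeasure T) :=
    (ν • P.a).comp_memLp' (Lp.memLp y)
  constructor
  · rintro ⟨g, hW, hg, hc0⟩
    obtain ⟨h1, h2, h3⟩ := (P.isW_iff hT y g c).1 hW
    refine ⟨⟨Lp.memLp y, hF, h1, h2, fun t ht v => ?_⟩, hc0⟩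
    rw [h3 t ht, ← integral_timeMeasure ht.1, ← integral_timeMeasure ht.1]
    congr 1
    refine integral_congr_ae ?_
    filter_upwards [ae_mono (Measure.restrict_mono (Ioo_subset_Ioo_right ht.2) le_rfl) hg] with s hs
    rw [← hs, smul_apply, add_sub_cancel_right]
  · rintro ⟨h, hc0⟩
    have hg := (hF.sub hA).coeFn_toLp
    refine ⟨(hF.sub hA).toLp, (P.isW_iff hT y _ c).2 ⟨h.continuousOn, h.ae_eq, fun t ht v => ?_⟩,
      ?_, hc0⟩
    · rw [h.eq t ht, ← integral_timeMeasure ht.1, ← integral_timeMeasure ht.1]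
      congr 1
      refine integral_congr_ae ?_
      filter_upwards [ae_mono (Measure.restrict_mono (Ioo_subset_Ioo_right ht.2) le_rfl) hg]
        with s hs
      rw [hs]
      rfl
    · filter_upwards [hg] with s hs
      rw [hs]
      simp

/-- Run backwards, the adjoint equation is a forward equation for the transposed form, to which the
theory of `IsSol` applies. -/
theorem IsAdjoint.exists_isSol {ν : ℝ} {p₁ : H} {p : L2Time 1 V} (h : P.IsAdjoint ν p₁ p) :
    ∃ e : ℝ → H, IsSol P.emb (ν • P.a).flip 1 (fun _ => 0) (fun s => p (1 - s)) e ∧ e 0 = p₁ := by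
  obtain ⟨g, c, hW, hg, hc1⟩ := h
  obtain ⟨h1, h2, h3⟩ := (P.isW_iff one_pos p g c).1 hW
  refine ⟨fun s => c (1 - s), ⟨?_, memLp_const 0, ?_, ?_, fun t ht v => ?_⟩, by simpa using hc1⟩
  · exact (Lp.memLp p).comp_measurePreserving (measurePreserving_reflect 1)
  · exact h1.comp (by fun_prop) fun s hs => ⟨by linarith [hs.2], by linarith [hs.1]⟩
  · exact (measurePreserving_reflect 1).quasiMeasurePreserving.ae h2
  · rw [integral_form_reflect zero_le_one (integrable_pairing (Lp.memLp g) (memLp_const v))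
      (fun t ht => h3 t ht v) t ht, ← integral_timeMeasure ht.1, ← integral_timeMeasure ht.1]
    congr 1
    refine integral_congr_ae ?_
    filter_upwards [ae_mono (Measure.restrict_mono (Ioo_subset_Ioo_right ht.2) le_rfl)
      ((measurePreserving_reflect 1).quasiMeasurePreserving.ae hg)] with s hs
    rw [neg_add_eq_zero.1 hs]
    simp

theorem isAdjoint_of_isSol {ν : ℝ} {z : ℝ → V} {e : ℝ → H}
    (h : IsSol P.emb (ν • P.a).flip 1 (fun _ => 0) z e) :
    ∃ p : L2Time 1 V, P.IsAdjoint ν (e 0) p ∧ ∀ᵐ t ∂(timeMeasure 1), p t = z (1 - t) := by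
  have hzm : MemLp (fun s => z (1 - s)) 2 (timeMeasure 1) :=
    h.memLp.comp_measurePreserving (measurePreserving_reflect 1)
  have hp := hzm.coeFn_toLp
  have hgm : MemLp (fun s => ν • P.a.flip (z (1 - s))) 2 (timeMeasure 1) :=
    (P.a.flip.comp_memLp' hzm).const_smul ν
  have hg := hgm.coeFn_toLp
  refine ⟨hzm.toLp, ⟨hgm.toLp, fun s => e (1 - s),
    (P.isW_iff one_pos _ _ _).2 ⟨?_, ?_, fun t ht v => ?_⟩, ?_, by simp⟩, hp⟩
  · exact h.continuousOn.comp (by fun_prop) fun s hs => ⟨by linarith [hs.2], by linarith [hs.1]⟩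
  · filter_upwards [hp, (measurePreserving_reflect 1).quasiMeasurePreserving.ae h.ae_eq]
      with s h1 h2
    rw [h1, h2]
  · rw [integral_form_reflect zero_le_one (integrable_pairing h.memLp_rhs (memLp_const v))
      (fun t ht => h.eq t ht v) t ht, ← integral_timeMeasure ht.1, ← integral_timeMeasure ht.1]
    congr 1
    refine integral_congr_ae ?_
    filter_upwards [ae_mono (Measure.restrict_mono (Ioo_subset_Ioo_right ht.2) le_rfl) hg]
      with s hs
    rw [hs]
    simp
  · filter_upwards [hp, hg] with s h1 h2
    rw [h1, h2, neg_add_cancel]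

end ControlSystem

/-! ### Existence of optimal controls. -/

/-- This takes the place of weak compactness. The norms of the minimal-norm points are nondecreasing
and bounded, and by the parallelogram law these points form a Cauchy sequence. Its limit lies in
every set. -/
theorem nonempty_iInter_of_isClosed_of_convex {X : Type*} [NormedAddCommGroup X]
    [InnerProductSpace ℝ X] [CompleteSpace X] {C : ℕ → Set X} (hanti : Antitone C)
    (hcl : ∀ n, IsClosed (C n)) (hconv : ∀ n, Convex ℝ (C n)) (hne : ∀ n, (C n).Nonempty)
    {M : ℝ} (hM : ∀ x ∈ C 0, ‖x‖ ≤ M) : (⋂ n, C n).Nonempty := by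
  have hmin : ∀ n, ∃ u ∈ C n, ∀ w ∈ C n, ‖u‖ ≤ ‖w‖ := by
    intro n
    obtain ⟨u, hu, hu'⟩ := exists_norm_eq_iInf_of_complete_convex (hne n) (hcl n).isComplete
      (hconv n) 0
    refine ⟨u, hu, fun w hw => ?_⟩
    have h1 : ⨅ w : C n, ‖(0 : X) - w‖ ≤ ‖(0 : X) - w‖ :=
      ciInf_le ⟨0, by rintro _ ⟨w, rfl⟩; positivity⟩ (⟨w, hw⟩ : C n)
    rw [← hu'] at h1
    simpa using h1
  choose u hu hmin using hmin
  have hmono : Monotone fun n => ‖u n‖ := fun m n hmn => hmin m _ (hanti hmn (hu n))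
  have ha : CauchySeq fun n => ‖u n‖ ^ 2 :=
    ((tendsto_atTop_ciSup hmono ⟨M, by
      rintro _ ⟨n, rfl⟩; exact hM _ (hanti (Nat.zero_le n) (hu n))⟩).pow 2).cauchySeq
  have hle : ∀ n m, n ≤ m → ‖u n - u m‖ ^ 2 ≤ 2 * (‖u m‖ ^ 2 - ‖u n‖ ^ 2) := by
    intro n m hnm
    have h1 := hmin n _ (hconv n (hu n) (hanti hnm (hu m)) (by norm_num : (0 : ℝ) ≤ 1 / 2)
      (by norm_num : (0 : ℝ) ≤ 1 / 2) (by norm_num))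
    rw [← smul_add, norm_smul, Real.norm_of_nonneg (by norm_num)] at h1
    have h2 := parallelogram_law_with_norm ℝ (u n) (u m)
    have h3 := pow_le_pow_left₀ (norm_nonneg _) h1 2
    nlinarith
  have hC : CauchySeq u := by
    rw [Metric.cauchySeq_iff'] at ha ⊢
    intro ε hε
    obtain ⟨N, hN⟩ := ha (ε ^ 2 / 2) (by positivity)
    refine ⟨N, fun n hn => ?_⟩
    have h1 := hN n hn
    rw [Real.dist_eq] at h1
    rw [dist_comm, dist_eq_norm]
    have h2 := hle N n hn
    have h3 := (abs_lt.1 h1).2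
    exact lt_of_pow_lt_pow_left₀ 2 hε.le (by linarith)
  obtain ⟨x, hx⟩ := cauchySeq_tendsto_of_complete hC
  refine ⟨x, mem_iInter.2 fun n => (hcl n).mem_of_tendsto hx ?_⟩
  filter_upwards [eventually_ge_atTop n] with m hm using hanti hm (hu m)

section

variable {V H : Type*} [NormedAddCommGroup V] [InnerProductSpace ℝ V]
  [NormedAddCommGroup H] [InnerProductSpace ℝ H] {j : V →L[ℝ] H} {A : V →L[ℝ] StrongDual ℝ V}
  {T : ℝ} {c : ℝ → H}

theorem IsSol.congr_ae {F : ℝ → StrongDual ℝ V} {y y' : ℝ → V} (h : IsSol j A T F y c)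
    (hy : y =ᵐ[timeMeasure T] y') : IsSol j A T F y' c where
  memLp := (memLp_congr_ae hy).1 h.memLp
  memLp_force := h.memLp_force
  continuousOn := h.continuousOn
  ae_eq := by filter_upwards [h.ae_eq, hy] with t h1 h2; rw [h1, h2]
  eq := fun t ht v => by
    rw [h.eq t ht, ← integral_timeMeasure ht.1, ← integral_timeMeasure ht.1]
    congr 1
    refine integral_congr_ae ?_
    filter_upwards [ae_mono (Measure.restrict_mono (Ioo_subset_Ioo_right ht.2) le_rfl) hy] with s hs
    rw [hs]

theorem integral_norm_sq_coeFn {E : Type*} [NormedAddCommGroup E] (hT : 0 ≤ T) (f : L2Time T E) :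
    ∫ s in (0 : ℝ)..T, ‖f s‖ ^ 2 = ‖f‖ ^ 2 := by
  have h := norm_toLp_sq (Lp.memLp f)
  rw [Lp.toLp_coeFn, integral_timeMeasure hT] at h
  exact h.symm

theorem IsSol.energy_estimate_Lp [CompleteSpace V] [CompleteSpace H] {α ω : ℝ}
    {F : L2Time T (StrongDual ℝ V)} {y : L2Time T V} (h : IsSol j A T F y c)
    (hA : GardingWith j A α ω) (hj : Function.Injective j) (hjd : DenseRange j) (hT : 0 < T) :
    ‖c T‖ ^ 2 + α * ‖y‖ ^ 2 ≤ Real.exp (2 * ω * T) * (‖c 0‖ ^ 2 + α⁻¹ * ‖F‖ ^ 2) := by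
  have := h.energy_estimate hA hj hjd hT
  rwa [integral_norm_sq_coeFn hT.le, integral_norm_sq_coeFn hT.le] at this

end

namespace ControlSystem

variable {V H : Type*} [NormedAddCommGroup V] [InnerProductSpace ℝ V]
  [NormedAddCommGroup H] [InnerProductSpace ℝ H]
  {Ω : Type*} [MeasurableSpace Ω] {ρ : Measure Ω} {P : ControlSystem V H ρ}

/-- The standing assumptions, with explicit constants. -/
structure IsRegular (P : ControlSystem V H ρ) (α ω M : ℝ) : Prop where
  gelfand : P.IsGelfandTriple
  garding : GardingWith P.emb P.a α ω
  nonempty : P.Uad.Nonempty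
  bound : ∀ u ∈ P.Uad, ‖u‖ ≤ M

variable {α ω M : ℝ}

theorem IsRegular.bound_nonneg (h : P.IsRegular α ω M) : 0 ≤ M :=
  let ⟨u, hu⟩ := h.nonempty
  (norm_nonneg u).trans (h.bound u hu)

theorem convex_Uad : Convex ℝ P.Uad := by
  intro u hu v hv a b ha hb hab
  filter_upwards [hu, hv, Lp.coeFn_add (a • u) (b • v), Lp.coeFn_smul a u, Lp.coeFn_smul b v]
    with x h1 h2 h3 h4 h5
  rw [h3, Pi.add_apply, h4, h5]
  simp only [Pi.smul_apply, smul_eq_mul]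
  have e1 : a * P.ua x + b * P.ua x = P.ua x := by rw [← add_mul, hab, one_mul]
  have e2 : a * P.ub x + b * P.ub x = P.ub x := by rw [← add_mul, hab, one_mul]
  constructor
  · linarith [mul_le_mul_of_nonneg_left h1.1 ha, mul_le_mul_of_nonneg_left h2.1 hb]
  · linarith [mul_le_mul_of_nonneg_left h1.2 ha, mul_le_mul_of_nonneg_left h2.2 hb]

/-- A set of `L²` functions given by an a.e. closed pointwise constraint is closed. -/
theorem isClosed_setOf_ae_mem {α E : Type*} [MeasurableSpace α] {μ : Measure α}
    [NormedAddCommGroup E] {S : α → Set E} (hS : ∀ x, IsClosed (S x)) :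
    IsClosed {u : Lp E 2 μ | ∀ᵐ x ∂μ, u x ∈ S x} := by
  refine isClosed_of_closure_subset fun u hu => ?_
  obtain ⟨v, hv, hvu⟩ := mem_closure_iff_seq_limit.1 hu
  obtain ⟨ns, -, hae⟩ := (tendstoInMeasure_of_tendsto_Lp hvu).exists_seq_tendsto_ae
  have h1 : ∀ᵐ x ∂μ, ∀ n, v n x ∈ S x := ae_all_iff.2 hv
  filter_upwards [hae, h1] with x h2 h3
  exact (hS x).mem_of_tendsto h2 (Eventually.of_forall fun n => h3 _)

theorem isClosed_Uad : IsClosed P.Uad :=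
  isClosed_setOf_ae_mem (S := fun x => Icc (P.ua x) (P.ub x)) fun _ => isClosed_Icc

theorem isClosed_UadTime (T : ℝ) : IsClosed (P.UadTime T) :=
  isClosed_setOf_ae_mem fun _ => P.isClosed_Uad

theorem convex_UadTime (T : ℝ) : Convex ℝ (P.UadTime T) := by
  intro u hu v hv a b ha hb hab
  filter_upwards [hu, hv, Lp.coeFn_add (a • u) (b • v), Lp.coeFn_smul a u, Lp.coeFn_smul b v]
    with x h1 h2 h3 h4 h5
  rw [h3, Pi.add_apply, h4, h5]
  exact convex_Uad h1 h2 ha hb hab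

theorem IsRegular.nonempty_UadTime (h : P.IsRegular α ω M) (T : ℝ) : (P.UadTime T).Nonempty := by
  obtain ⟨u, hu⟩ := h.nonempty
  refine ⟨(memLp_const u).toLp, ?_⟩
  filter_upwards [(memLp_const (p := 2) (μ := volume.restrict (Ioo 0 T)) u).coeFn_toLp] with t ht
  rw [ht]
  exact hu

theorem IsRegular.norm_le (h : P.IsRegular α ω M) {u : L2Time 1 (Lp ℝ 2 ρ)}
    (hu : u ∈ P.UadTime 1) : ‖u‖ ≤ M := by
  have h1 : ‖u‖ ^ 2 ≤ M ^ 2 := by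
    rw [← integral_norm_sq_coeFn zero_le_one, ← integral_timeMeasure zero_le_one]
    have h2 : ∫ s, ‖u s‖ ^ 2 ∂(timeMeasure 1) ≤ ∫ _, M ^ 2 ∂(timeMeasure 1) := by
      refine integral_mono_ae (Lp.memLp u).norm.integrable_sq (integrable_const _) ?_
      filter_upwards [hu] with s hs
      exact pow_le_pow_left₀ (norm_nonneg _) (h.bound _ hs) 2
    simpa using h2
  exact le_of_sq_le_sq h1 h.bound_nonneg

theorem IsState.scale {T T' ν l : ℝ} (hl : 0 < l) (hT : 0 < T) (hT' : T' = l * T)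
    {u : L2Time T' (Lp ℝ 2 ρ)} (hu : u ∈ P.UadTime T') {y : L2Time T' V} {c : ℝ → H}
    (h : P.IsState T' ν u y c) :
    ∃ u' ∈ P.UadTime T, ∃ y' : L2Time T V, P.IsState T (l * ν) u' y' (fun s => c (l * s)) ∧
      ∀ᵐ s ∂(timeMeasure T), u' s = u (l * s) := by
  subst hT'
  rw [isState_iff (mul_pos hl hT)] at h
  have hs := h.1.comp_mul hl
  have hum := memLp_comp_mul hl (Lp.memLp u)
  have hu' := hum.coeFn_toLp
  refine ⟨hum.toLp, ?_, hs.memLp.toLp, (isState_iff hT).2 ⟨?_, by simpa using h.2⟩, hu'⟩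
  · filter_upwards [hu', (quasiMeasurePreserving_mul hl T).ae hu] with s h1 h2
    rw [h1]; exact h2
  · have hF : MemLp (fun s => (l * ν) • P.B (hum.toLp (fun s => u (l * s)) s)) 2 (timeMeasure T) :=
      (P.B.comp_memLp' (Lp.memLp (hum.toLp fun s => u (l * s)))).const_smul (l * ν)
    refine (hs.congr_ae hs.memLp.coeFn_toLp.symm).congr_force hF ?_
    filter_upwards [hu'] with s h1
    rw [h1]
    simp only [smul_smul, smul_apply]

/-- The values at time `1` of the states of the problem transformed to `(0,1)`. -/
def reachable (P : ControlSystem V H ρ) (ν : ℝ) : Set H :=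
  {x | ∃ u ∈ P.UadTime 1, ∃ (y : L2Time 1 V) (c : ℝ → H), P.IsState 1 ν u y c ∧ x = c 1}

/-- Rescaling by `T` and by `T⁻¹` carries admissible controls and their states back and forth
between `(0,T)` and `(0,1)`. -/
theorem delta_eq {T : ℝ} (hT : 0 < T) :
    P.delta T = sInf ((fun x => ‖x - P.yd‖ - P.δ₀) '' P.reachable T) := by
  unfold delta
  congr 1
  ext r
  constructor
  · rintro ⟨u, hu, y, c, h, rfl⟩
    obtain ⟨u', hu', y', h', -⟩ := h.scale hT one_pos (mul_one T).symm hu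
    rw [mul_one] at h'
    exact ⟨c T, ⟨u', hu', y', _, h', by simp⟩, rfl⟩
  · rintro ⟨_, ⟨u, hu, y, c, h, rfl⟩, rfl⟩
    obtain ⟨u', hu', y', h', -⟩ := h.scale (inv_pos.2 hT) hT (inv_mul_cancel₀ hT.ne').symm hu
    rw [inv_mul_cancel₀ hT.ne'] at h'
    exact ⟨u', hu', y', _, h', by simp [inv_mul_cancel₀ hT.ne']⟩

variable [CompleteSpace V] [CompleteSpace H]

theorem IsRegular.exists_isState (h : P.IsRegular α ω M) {T ν : ℝ} (hT : 0 < T) (hν : 0 < ν)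
    (u : L2Time T (Lp ℝ 2 ρ)) : ∃ y c, P.IsState T ν u y c := by
  have hF : MemLp (fun s => ν • P.B (u s)) 2 (timeMeasure T) :=
    (P.B.comp_memLp' (Lp.memLp u)).const_smul ν
  obtain ⟨y, c, z, hs, hc, -⟩ := exists_isSol_isSmoothLimit (h.garding.smul hν)
    h.gelfand.injective h.gelfand.dense hT hF P.y₀
  exact ⟨hs.memLp.toLp, c, (isState_iff hT).2 ⟨hs.congr_ae hs.memLp.coeFn_toLp.symm, hc⟩⟩

theorem IsRegular.isState_unique (h : P.IsRegular α ω M) {T ν : ℝ} (hT : 0 < T) (hν : 0 < ν)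
    {u : L2Time T (Lp ℝ 2 ρ)} {y y' : L2Time T V} {c c' : ℝ → H} (h₁ : P.IsState T ν u y c)
    (h₂ : P.IsState T ν u y' c') : c T = c' T ∧ y = y' := by
  rw [isState_iff hT] at h₁ h₂
  obtain ⟨h3, h4⟩ := h₁.1.unique (h.garding.smul hν) h.gelfand.injective h.gelfand.dense hT h₂.1
    (Eventually.of_forall fun _ => rfl) (h₁.2.trans h₂.2.symm)
  exact ⟨h3 T (right_mem_Icc.2 hT.le), Lp.ext h4⟩

theorem IsRegular.isState_sub_le (h : P.IsRegular α ω M) {ν : ℝ} (hν : 0 < ν)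
    {u u' : L2Time 1 (Lp ℝ 2 ρ)} {y y' : L2Time 1 V} {c c' : ℝ → H} (h₁ : P.IsState 1 ν u y c)
    (h₂ : P.IsState 1 ν u' y' c') :
    ‖c 1 - c' 1‖ ^ 2 ≤ Real.exp (2 * (ν * ω)) * ((ν * α)⁻¹ * (ν * ‖P.B‖) ^ 2) * ‖u - u'‖ ^ 2 := by
  rw [isState_iff one_pos] at h₁ h₂
  have hA := h.garding.smul hν
  have hs := (h₁.1.lineComb h₂.1 1 (-1)).congr_force (A' := ν • P.a)
    (F' := ((ν • P.B).compLp (u - u'))) (Lp.memLp _) (by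
      filter_upwards [(ν • P.B).coeFn_compLp (u - u'), Lp.coeFn_sub u u'] with s e1 e2
      rw [e1, e2]
      ext v
      simp only [Pi.sub_apply, map_sub, sub_apply, add_apply, smul_apply, smul_eq_mul]
      ring)
  have := (hs.congr_ae hs.memLp.coeFn_toLp.symm).energy_estimate_Lp hA h.gelfand.injective
    h.gelfand.dense one_pos
  have h0 : (1 : ℝ) • c 0 + (-1 : ℝ) • c' 0 = 0 := by
    rw [h₁.2, h₂.2, ← add_smul, add_neg_cancel, zero_smul]
  rw [h0] at this
  have e1 : (1 : ℝ) • c 1 + (-1 : ℝ) • c' 1 = c 1 - c' 1 := by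
    rw [one_smul, neg_smul, one_smul, sub_eq_add_neg]
  rw [e1] at this
  have h1 : ‖(ν • P.B).compLp (u - u')‖ ≤ ν * ‖P.B‖ * ‖u - u'‖ := by
    refine ((ν • P.B).norm_compLp_le _).trans (le_of_eq ?_)
    rw [norm_smul, Real.norm_of_nonneg hν.le]
  have h2 := pow_le_pow_left₀ (norm_nonneg _) h1 2
  have h3 := mul_nonneg hA.pos.le (sq_nonneg ‖hs.memLp.toLp‖)
  have h4 := mul_le_mul_of_nonneg_left h2 (inv_nonneg.2 hA.pos.le)
  have h5 := mul_le_mul_of_nonneg_left h4 (Real.exp_pos (2 * (ν * ω))).le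
  simp only [norm_zero, ne_eq, OfNat.ofNat_ne_zero, not_false_eq_true, zero_pow, zero_add,
    mul_one] at this
  refine le_trans (le_trans (le_add_of_nonneg_right h3) (this.trans h5)) (le_of_eq ?_)
  ring

theorem IsRegular.isState_convexComb (h : P.IsRegular α ω M) {ν : ℝ} (hν : 0 < ν)
    {u u' u'' : L2Time 1 (Lp ℝ 2 ρ)} {y y' y'' : L2Time 1 V} {c c' c'' : ℝ → H}
    (h₁ : P.IsState 1 ν u y c) (h₂ : P.IsState 1 ν u' y' c') {a b : ℝ} (hab : a + b = 1)
    (hu : u'' = a • u + b • u') (h₃ : P.IsState 1 ν u'' y'' c'') :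
    c'' 1 = a • c 1 + b • c' 1 := by
  rw [isState_iff one_pos] at h₁ h₂ h₃
  have hs := h₁.1.lineComb h₂.1 a b
  refine (h₃.1.unique (h.garding.smul hν) h.gelfand.injective h.gelfand.dense one_pos hs ?_ ?_).1 1
    (right_mem_Icc.2 zero_le_one)
  · filter_upwards [Lp.coeFn_add (a • u) (b • u'), Lp.coeFn_smul a u, Lp.coeFn_smul b u']
      with s e1 e2 e3
    rw [hu, e1, Pi.add_apply, e2, e3]
    simp only [Pi.smul_apply, map_add, map_smul, smul_add]
    rw [smul_comm ν a, smul_comm ν b]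
  · rw [h₁.2, h₂.2, h₃.2, ← add_smul, hab, one_smul]

theorem IsRegular.convex_reachable (h : P.IsRegular α ω M) {ν : ℝ} (hν : 0 < ν) :
    Convex ℝ (P.reachable ν) := by
  rintro _ ⟨u, hu, y, c, hs, rfl⟩ _ ⟨u', hu', y', c', hs', rfl⟩ a b ha hb hab
  obtain ⟨y'', c'', hs''⟩ := h.exists_isState one_pos hν (a • u + b • u')
  exact ⟨_, convex_UadTime 1 hu hu' ha hb hab, y'', c'', hs'',
    (h.isState_convexComb hν hs hs' hab rfl hs'').symm⟩

/-- The final state is affine and continuous in the control, so the admissible controls whose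
distance is within `1/(n+1)` of the infimum form nested bounded closed convex nonempty sets. Any
common point is a minimizer. -/
theorem IsRegular.exists_minimizer (h : P.IsRegular α ω M) {ν : ℝ} (hν : 0 < ν) :
    ∃ x ∈ P.reachable ν, ∀ x' ∈ P.reachable ν, ‖x - P.yd‖ ≤ ‖x' - P.yd‖ := by
  choose y c hs using fun u => h.exists_isState one_pos hν (T := 1) u
  set E : L2Time 1 (Lp ℝ 2 ρ) → H := fun u => c u 1 with hE
  have hEc : Continuous E := by
    set K := Real.exp (2 * (ν * ω)) * ((ν * α)⁻¹ * (ν * ‖P.B‖) ^ 2) with hK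
    refine Metric.continuous_iff.2 fun u ε hε => ⟨ε / (|K| + 1), by positivity, fun v hv => ?_⟩
    have h1 := h.isState_sub_le hν (hs v) (hs u)
    rw [← hK] at h1
    rw [dist_eq_norm, lt_div_iff₀ (by positivity)] at hv
    rw [dist_eq_norm]
    refine lt_of_pow_lt_pow_left₀ 2 hε.le (h1.trans_lt (lt_of_le_of_lt ?_
      (pow_lt_pow_left₀ hv (by positivity) two_ne_zero)))
    have : K ≤ (|K| + 1) ^ 2 := by nlinarith [le_abs_self K, abs_nonneg K]
    nlinarith [sq_nonneg ‖v - u‖]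
  have hmem : ∀ u ∈ P.UadTime 1, E u ∈ P.reachable ν := fun u hu => ⟨u, hu, _, _, hs u, rfl⟩
  have hsurj : ∀ x ∈ P.reachable ν, ∃ u ∈ P.UadTime 1, E u = x := by
    rintro _ ⟨u, hu, y', c', hs', rfl⟩
    exact ⟨u, hu, (h.isState_unique one_pos hν (hs u) hs').1⟩
  set f : L2Time 1 (Lp ℝ 2 ρ) → ℝ := fun u => ‖E u - P.yd‖ with hf
  have hfc : Continuous f := (hEc.sub continuous_const).norm
  set d := sInf (f '' P.UadTime 1) with hd
  have hbdd : BddBelow (f '' P.UadTime 1) := ⟨0, by rintro _ ⟨u, -, rfl⟩; exact norm_nonneg _⟩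
  have hne := (h.nonempty_UadTime 1).image f
  obtain ⟨u, hu⟩ := nonempty_iInter_of_isClosed_of_convex
    (C := fun n : ℕ => P.UadTime 1 ∩ {u | f u ≤ d + 1 / ((n : ℝ) + 1)}) (M := M)
    (fun m n hmn => inter_subset_inter_right _ fun u (hu : f u ≤ _) =>
      hu.trans (add_le_add le_rfl (Nat.one_div_le_one_div hmn)))
    (fun n => (isClosed_UadTime 1).inter (isClosed_le hfc continuous_const))
    (fun n => by
      intro u hu v hv a b ha hb hab
      refine ⟨convex_UadTime 1 hu.1 hv.1 ha hb hab, ?_⟩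
      have e1 : E (a • u + b • v) - P.yd = a • (E u - P.yd) + b • (E v - P.yd) := by
        have := h.isState_convexComb hν (hs u) (hs v) hab rfl (hs (a • u + b • v))
        simp only [hE]
        rw [this, smul_sub, smul_sub, sub_add_sub_comm, ← add_smul, hab, one_smul]
      have h1 : f u ≤ d + 1 / ((n : ℝ) + 1) := hu.2
      have h2 : f v ≤ d + 1 / ((n : ℝ) + 1) := hv.2
      change ‖E (a • u + b • v) - P.yd‖ ≤ _
      rw [e1]
      refine (norm_add_le _ _).trans ?_
      rw [norm_smul, norm_smul, Real.norm_of_nonneg ha, Real.norm_of_nonneg hb]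
      have h3 := mul_le_mul_of_nonneg_left h1 ha
      have h4 := mul_le_mul_of_nonneg_left h2 hb
      have h5 : a * (d + 1 / ((n : ℝ) + 1)) + b * (d + 1 / ((n : ℝ) + 1)) = d + 1 / ((n : ℝ) + 1) := by
        rw [← add_mul, hab, one_mul]
      simp only [hf] at h3 h4
      linarith)
    (fun n => by
      obtain ⟨_, ⟨u, hu, rfl⟩, hlt⟩ := exists_lt_of_csInf_lt hne
        (lt_add_of_pos_right d (by positivity : (0 : ℝ) < 1 / ((n : ℝ) + 1)))
      exact ⟨u, hu, hlt.le⟩)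
    (fun u hu => h.norm_le hu.1)
  rw [mem_iInter] at hu
  refine ⟨E u, hmem u (hu 0).1, fun x' hx' => ?_⟩
  obtain ⟨u', hu', rfl⟩ := hsurj x' hx'
  refine le_trans ?_ (csInf_le hbdd ⟨u', hu', rfl⟩)
  have h1 : Tendsto (fun n : ℕ => d + 1 / ((n : ℝ) + 1)) atTop (𝓝 (d + 0)) :=
    tendsto_const_nhds.add tendsto_one_div_add_atTop_nhds_zero_nat
  rw [add_zero] at h1
  exact ge_of_tendsto' h1 fun n => (hu n).2

end ControlSystem

/-! ### First-order expansion in the parameter and semiconcavity. -/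

section

variable {V H : Type*} [NormedAddCommGroup V] [InnerProductSpace ℝ V]
  [NormedAddCommGroup H] [InnerProductSpace ℝ H] {j : V →L[ℝ] H} {A : V →L[ℝ] StrongDual ℝ V}
  {T : ℝ}

theorem IsSol.sub {F₁ F₂ : ℝ → StrongDual ℝ V} {y₁ y₂ : ℝ → V} {c₁ c₂ : ℝ → H}
    (h₁ : IsSol j A T F₁ y₁ c₁) (h₂ : IsSol j A T F₂ y₂ c₂) :
    IsSol j A T (fun s => F₁ s - F₂ s) (fun s => y₁ s - y₂ s) (fun s => c₁ s - c₂ s) := by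
  have h := h₁.lineComb h₂ 1 (-1)
  have e1 : (fun s => (1 : ℝ) • y₁ s + (-1 : ℝ) • y₂ s) = fun s => y₁ s - y₂ s := by
    ext s; rw [one_smul, neg_one_smul, sub_eq_add_neg]
  have e2 : (fun s => (1 : ℝ) • c₁ s + (-1 : ℝ) • c₂ s) = fun s => c₁ s - c₂ s := by
    ext s; rw [one_smul, neg_one_smul, sub_eq_add_neg]
  have e3 : (fun s => (1 : ℝ) • F₁ s + (-1 : ℝ) • F₂ s) = fun s => F₁ s - F₂ s := by
    ext s v; simp only [add_apply, sub_apply, smul_apply, smul_eq_mul]; ring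
  rwa [e1, e2, e3] at h

theorem abs_integral_pairing_le_Lp (hT : 0 ≤ T) (f : L2Time T (StrongDual ℝ V)) (y : L2Time T V) :
    |∫ s in (0 : ℝ)..T, f s (y s)| ≤ ‖f‖ * ‖y‖ := by
  have := abs_integral_pairing_le hT (Lp.memLp f) (Lp.memLp y)
  rwa [integral_norm_sq_coeFn hT, integral_norm_sq_coeFn hT, Real.sqrt_sq (norm_nonneg _),
    Real.sqrt_sq (norm_nonneg _)] at this

/-- `‖x + w‖ ≤ ‖x‖ + (w, x/‖x‖) + ‖w‖²/(2‖x‖)`. -/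
theorem norm_add_le_expansion {x : H} (hx : 0 < ‖x‖) (w : H) :
    ‖x + w‖ ≤ ‖x‖ + inner ℝ w (‖x‖⁻¹ • x) + ‖w‖ ^ 2 / (2 * ‖x‖) := by
  have h1 := norm_add_sq_real x w
  have h2 : 2 * ‖x‖ * ‖x + w‖ ≤ ‖x‖ ^ 2 + ‖x + w‖ ^ 2 := by
    nlinarith [sq_nonneg (‖x‖ - ‖x + w‖)]
  rw [inner_smul_right, real_inner_comm]
  have h3 : ‖x‖ + ‖x‖⁻¹ * inner ℝ x w + ‖w‖ ^ 2 / (2 * ‖x‖) =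
      (2 * ‖x‖ ^ 2 + 2 * inner ℝ x w + ‖w‖ ^ 2) / (2 * ‖x‖) := by
    field_simp
  rw [h3, le_div_iff₀ (by positivity)]
  linarith

theorem norm_le_sqrt_of_add_le {a b c e : ℝ} (ha : 0 < a) (hb : 0 ≤ b) (h : b + a * e ^ 2 ≤ c) :
    e ≤ √(a⁻¹ * c) := by
  refine Real.le_sqrt_of_sq_le ?_
  rw [le_inv_mul_iff₀ ha]
  linarith

end

namespace ControlSystem

variable {V H : Type*} [NormedAddCommGroup V] [InnerProductSpace ℝ V]
  [NormedAddCommGroup H] [InnerProductSpace ℝ H]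
  {Ω : Type*} [MeasurableSpace Ω] {ρ : Measure Ω} {P : ControlSystem V H ρ} {α ω M : ℝ}

/-- The optimal distance `inf ‖y[u](T) - y_d‖`. -/
def minDist (P : ControlSystem V H ρ) (ν : ℝ) : ℝ := P.delta ν + P.δ₀

theorem minDist_le {ν : ℝ} (hν : 0 < ν) {x : H}
    (hx : x ∈ P.reachable ν) : P.minDist ν ≤ ‖x - P.yd‖ := by
  have h1 : P.delta ν ≤ ‖x - P.yd‖ - P.δ₀ := by
    rw [delta_eq hν]
    exact csInf_le ⟨-P.δ₀, by rintro _ ⟨x, -, rfl⟩; simp⟩ ⟨x, hx, rfl⟩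
  unfold minDist
  linarith

variable [CompleteSpace V] [CompleteSpace H]

/-- First-order expansion of the final state in the parameter, with a remainder which is uniform
in the control and locally uniform in the parameter. -/
theorem IsRegular.exists_expansion (h : P.IsRegular α ω M) {n₀ n₁ : ℝ} (hn₀ : 0 < n₀) :
    ∃ K, 0 ≤ K ∧ ∀ ν ∈ Icc n₀ n₁, ∀ μ ∈ Icc n₀ n₁, ∀ u : L2Time 1 (Lp ℝ 2 ρ), ‖u‖ ≤ M →
      ∀ y c y' c', P.IsState 1 ν u y c → P.IsState 1 μ u y' c' →
      ∀ p₁ p, ‖p₁‖ ≤ 1 → P.IsAdjoint ν p₁ p →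
      |inner ℝ (c' 1 - c 1) p₁ -
        (μ - ν) * ∫ t in Ioo (0 : ℝ) 1, (P.B (u t) - P.a (y t)) (p t)| ≤ K * (μ - ν) ^ 2 ∧
      ‖c' 1 - c 1‖ ^ 2 ≤ K * (μ - ν) ^ 2 := by
  have hα := h.garding.pos
  have hω := h.garding.nonneg
  have hM := h.bound_nonneg
  -- Gårding constants valid for `ν • P.a` simultaneously for all `ν` in `[n₀, n₁]`. All later
  -- bounds depend on the parameter only through them.
  set α' := n₀ * α with hα'
  set ω' := n₁ * ω with hω'
  have hα'0 : 0 < α' := mul_pos hn₀ hα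
  set C := Real.exp (2 * ω' * 1) with hC
  have hC0 : 0 < C := Real.exp_pos _
  set Y := √(α'⁻¹ * (C * (‖P.y₀‖ ^ 2 + α'⁻¹ * (n₁ * ‖P.B‖ * M) ^ 2))) with hY
  set R := ‖P.B‖ * M + ‖P.a‖ * Y with hR
  have hR0 : 0 ≤ R := by positivity
  have hG : ∀ ν ∈ Icc n₀ n₁, GardingWith P.emb (ν • P.a) α' ω' := fun ν hν =>
    (h.garding.smul (hn₀.trans_le hν.1)).mono hα'0 (mul_le_mul_of_nonneg_right hν.1 hα.le)
      (mul_le_mul_of_nonneg_right hν.2 hω)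
  set K₁ := ‖P.a‖ * √(α'⁻¹ * (C * (α'⁻¹ * R ^ 2))) * √(α'⁻¹ * C) with hK₁
  refine ⟨C * (α'⁻¹ * R ^ 2) + K₁, by positivity, ?_⟩
  intro ν hν μ hμ u hu y c y' c' hs hs' p₁ p hp₁ hp
  have hν0 : 0 < ν := hn₀.trans_le hν.1
  have hsol := (isState_iff one_pos).1 hs
  have hsol' := (isState_iff one_pos).1 hs'
  have hBu := P.B.coeFn_compLp u
  have hay := P.a.coeFn_compLp y
  -- bound for the state
  have hYle : ‖y‖ ≤ Y := by
    have h1 := (hsol.1.congr_force (A' := ν • P.a) (F' := (ν • P.B.compLp u : L2Time 1 _))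
      (Lp.memLp _) (by
        filter_upwards [hBu, Lp.coeFn_smul ν (P.B.compLp u)] with s e1 e2
        rw [e2, Pi.smul_apply, e1])).energy_estimate_Lp (hG ν hν) h.gelfand.injective
        h.gelfand.dense one_pos
    have h2 : ‖ν • P.B.compLp u‖ ≤ n₁ * ‖P.B‖ * M := by
      rw [norm_smul, Real.norm_of_nonneg hν0.le, mul_assoc]
      exact mul_le_mul hν.2 ((P.B.norm_compLp_le u).trans
        (mul_le_mul_of_nonneg_left hu (norm_nonneg _))) (norm_nonneg _) (hν0.le.trans hν.2)
    have h3 := pow_le_pow_left₀ (norm_nonneg _) h2 2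
    rw [hsol.2] at h1
    refine (norm_le_sqrt_of_add_le hα'0 (sq_nonneg _) h1).trans (Real.sqrt_le_sqrt ?_)
    gcongr
  set f : L2Time 1 (StrongDual ℝ V) := P.B.compLp u - P.a.compLp y with hf
  have hfs : ∀ᵐ s ∂(timeMeasure 1), f s = P.B (u s) - P.a (y s) := by
    filter_upwards [hBu, hay, Lp.coeFn_sub (P.B.compLp u) (P.a.compLp y)] with s e1 e2 e3
    rw [e3, Pi.sub_apply, e1, e2]
  have hfR : ‖f‖ ≤ R := (norm_sub_le _ _).trans (add_le_add
    ((P.B.norm_compLp_le u).trans (mul_le_mul_of_nonneg_left hu (norm_nonneg _)))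
    ((P.a.norm_compLp_le y).trans (mul_le_mul_of_nonneg_left hYle (norm_nonneg _))))
  -- the difference of the states
  set w : L2Time 1 V := y' - y with hw
  have hws : ∀ᵐ s ∂(timeMeasure 1), w s = y' s - y s := Lp.coeFn_sub y' y
  have hFm : MemLp (fun s => μ • P.B (u s) - (μ - ν) • f s) 2 (timeMeasure 1) :=
    ((P.B.comp_memLp' (Lp.memLp u)).const_smul μ).sub ((Lp.memLp f).const_smul (μ - ν))
  -- The old state `y` solves the equation with parameter `μ` up to the force `-(μ - ν) f`. The
  -- difference `w` therefore starts at zero and has force `(μ - ν) f`, which makes it of order `|μ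
  -- - ν|`.
  have hwsol : IsSol P.emb (μ • P.a) 1 ((μ - ν) • f : L2Time 1 _) w (fun s => c' s - c s) := by
    have h1 : IsSol P.emb (μ • P.a) 1 (fun s => μ • P.B (u s) - (μ - ν) • f s) y c :=
      hsol.1.congr_force hFm (by
        filter_upwards [hfs] with s e1
        rw [e1]
        ext v
        simp only [sub_apply, smul_apply, smul_eq_mul]
        ring)
    refine ((hsol'.1.sub h1).congr_ae ?_).congr_force (Lp.memLp _) ?_
    · exact hws.mono fun s e1 => e1.symm
    · filter_upwards [Lp.coeFn_smul (μ - ν) f] with s e1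
      rw [e1, Pi.smul_apply, sub_sub_cancel]
  have hw0 : c' 0 - c 0 = 0 := by rw [hsol.2, hsol'.2, sub_self]
  have hwE := hwsol.energy_estimate_Lp (hG μ hμ) h.gelfand.injective h.gelfand.dense one_pos
  rw [hw0, norm_zero, zero_pow two_ne_zero, zero_add, norm_smul, Real.norm_eq_abs, mul_pow,
    sq_abs] at hwE
  have hfR2 := pow_le_pow_left₀ (norm_nonneg _) hfR 2
  have hwE' : ‖c' 1 - c 1‖ ^ 2 + α' * ‖w‖ ^ 2 ≤ (C * (α'⁻¹ * R ^ 2)) * (μ - ν) ^ 2 := by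
    refine hwE.trans ?_
    calc C * (α'⁻¹ * ((μ - ν) ^ 2 * ‖f‖ ^ 2)) ≤ C * (α'⁻¹ * ((μ - ν) ^ 2 * R ^ 2)) := by gcongr
      _ = _ := by ring
  have hwle : ‖w‖ ≤ √(α'⁻¹ * (C * (α'⁻¹ * R ^ 2))) * |μ - ν| := by
    have := norm_le_sqrt_of_add_le hα'0 (sq_nonneg _) hwE'
    rwa [← mul_assoc, Real.sqrt_mul (by positivity), Real.sqrt_sq_eq_abs] at this
  -- the adjoint state
  obtain ⟨e, he, he0⟩ := hp.exists_isSol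
  have hple : ‖p‖ ≤ √(α'⁻¹ * C) := by
    have h1 := he.energy_estimate (hG ν hν).flip h.gelfand.injective h.gelfand.dense one_pos
    have h2 := intervalIntegral.integral_comp_sub_left (a := 0) (b := 1)
      (fun s => ‖p s‖ ^ 2) 1
    simp only [sub_zero, sub_self] at h2
    rw [h2, integral_norm_sq_coeFn zero_le_one, he0] at h1
    refine (norm_le_sqrt_of_add_le hα'0 (sq_nonneg _) h1).trans (Real.sqrt_le_sqrt ?_)
    have h3 : ‖p₁‖ ^ 2 ≤ 1 := pow_le_one₀ (norm_nonneg _) hp₁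
    simp only [norm_zero, ne_eq, OfNat.ofNat_ne_zero, not_false_eq_true, zero_pow,
      intervalIntegral.integral_zero, mul_zero, add_zero]
    have := mul_le_mul_of_nonneg_left h3 hC0.le
    rw [mul_one] at this
    exact mul_le_mul_of_nonneg_left this (by positivity)
  -- Green's formula
  have haw := P.a.coeFn_compLp w
  -- Now `w` is regarded as a solution for the parameter `ν` of the adjoint state. The additional
  -- force `-(μ - ν) A w` is of second order and becomes the remainder.
  have hwsol' : IsSol P.emb (ν • P.a) 1 (fun s => (μ - ν) • (f s - P.a.compLp w s)) w
      (fun s => c' s - c s) :=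
    hwsol.congr_force (((Lp.memLp f).sub (Lp.memLp (P.a.compLp w))).const_smul (μ - ν)) (by
      filter_upwards [haw, Lp.coeFn_smul (μ - ν) f] with s e1 e2
      rw [e1, e2]
      ext v
      simp only [sub_apply, smul_apply, smul_eq_mul, Pi.smul_apply]
      ring)
  have hgreen := hwsol'.green he (hG ν hν) h.gelfand.injective h.gelfand.dense one_pos
  simp only [sub_sub_cancel] at hgreen
  rw [hw0, inner_zero_left, zero_add, he0] at hgreen
  have h1 : ∫ s in (0 : ℝ)..1, ((μ - ν) • (f s - P.a.compLp w s)) (p s) =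
      (μ - ν) * (∫ t in Ioo (0 : ℝ) 1, (P.B (u t) - P.a (y t)) (p t)) -
      (μ - ν) * ∫ s in (0 : ℝ)..1, P.a.compLp w s (p s) := by
    have e1 : ∫ t in Ioo (0 : ℝ) 1, (P.B (u t) - P.a (y t)) (p t) =
        ∫ s in (0 : ℝ)..1, f s (p s) := by
      rw [← integral_timeMeasure zero_le_one]
      refine integral_congr_ae ?_
      filter_upwards [hfs] with s e2
      rw [e2]
    have hi : ∀ g : L2Time 1 (StrongDual ℝ V),
        IntervalIntegrable (fun s => g s (p s)) volume 0 1 := fun g =>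
      intervalIntegrable_of_integrable (integrable_pairing (Lp.memLp g) (Lp.memLp p))
        (left_mem_Icc.2 zero_le_one) (right_mem_Icc.2 zero_le_one)
    rw [e1, ← mul_sub, ← intervalIntegral.integral_sub (hi _) (hi _),
      ← intervalIntegral.integral_const_mul]
    rfl
  rw [h1] at hgreen
  have h2 := abs_integral_pairing_le_Lp zero_le_one (P.a.compLp w) p
  have h3 : ‖P.a.compLp w‖ * ‖p‖ ≤ K₁ * |μ - ν| := by
    calc ‖P.a.compLp w‖ * ‖p‖ ≤ (‖P.a‖ * (√(α'⁻¹ * (C * (α'⁻¹ * R ^ 2))) * |μ - ν|)) *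
          √(α'⁻¹ * C) := by
          refine mul_le_mul ((P.a.norm_compLp_le w).trans
            (mul_le_mul_of_nonneg_left hwle (norm_nonneg _))) hple (norm_nonneg _) (by positivity)
      _ = K₁ * |μ - ν| := by rw [hK₁]; ring
  constructor
  · rw [hgreen, sub_sub_cancel_left, abs_neg, abs_mul]
    calc |μ - ν| * |∫ s in (0 : ℝ)..1, P.a.compLp w s (p s)| ≤ |μ - ν| * (K₁ * |μ - ν|) :=
          mul_le_mul_of_nonneg_left (h2.trans h3) (abs_nonneg _)
      _ = K₁ * (μ - ν) ^ 2 := by rw [← sq_abs (μ - ν)]; ring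
      _ ≤ _ := by
          refine mul_le_mul_of_nonneg_right (le_add_of_nonneg_left ?_) (sq_nonneg _)
          positivity
  · have h4 := mul_nonneg hα'0.le (sq_nonneg ‖w‖)
    have h5 : 0 ≤ K₁ * (μ - ν) ^ 2 := by positivity
    rw [add_mul]
    linarith

theorem IsRegular.nonempty_reachable (h : P.IsRegular α ω M) {ν : ℝ} (hν : 0 < ν) :
    (P.reachable ν).Nonempty :=
  let ⟨x, hx, _⟩ := h.exists_minimizer hν
  ⟨x, hx⟩

theorem IsRegular.le_minDist (h : P.IsRegular α ω M) {ν : ℝ} (hν : 0 < ν) {b : ℝ}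
    (hb : ∀ x ∈ P.reachable ν, b ≤ ‖x - P.yd‖) : b ≤ P.minDist ν := by
  have h1 : b - P.δ₀ ≤ P.delta ν := by
    rw [delta_eq hν]
    refine le_csInf ((h.nonempty_reachable hν).image _) ?_
    rintro _ ⟨x, hx, rfl⟩
    linarith [hb x hx]
  unfold minDist
  linarith

theorem IsRegular.mem_ubar_iff (h : P.IsRegular α ω M) {ν : ℝ} (hν : 0 < ν)
    {u : L2Time 1 (Lp ℝ 2 ρ)} {y : L2Time 1 V} {c : ℝ → H} (hs : P.IsState 1 ν u y c) :
    u ∈ P.ubar ν ↔ u ∈ P.UadTime 1 ∧ ‖c 1 - P.yd‖ = P.minDist ν := by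
  constructor
  · rintro ⟨hu, y', c', hs', hmin⟩
    refine ⟨hu, le_antisymm (h.le_minDist hν ?_) (minDist_le hν ⟨u, hu, y, c, hs, rfl⟩)⟩
    rintro _ ⟨u'', hu'', y'', c'', hs'', rfl⟩
    rw [(h.isState_unique one_pos hν hs hs').1]
    exact hmin u'' hu'' y'' c'' hs''
  · rintro ⟨hu, he⟩
    refine ⟨hu, y, c, hs, fun u' hu' y' c' hs' => ?_⟩
    rw [he]
    exact minDist_le hν ⟨u', hu', y', c', hs', rfl⟩

/-- Uniform semiconcavity: each element of `derivValues` bounds the optimal distance from above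
to first order, with a locally uniform quadratic remainder. -/
theorem IsRegular.exists_semiconcave (h : P.IsRegular α ω M) {n₀ n₁ m₀ : ℝ} (hn₀ : 0 < n₀)
    (hm₀ : 0 < m₀) :
    ∃ K, 0 ≤ K ∧ ∀ ν ∈ Icc n₀ n₁, m₀ ≤ P.minDist ν → ∀ r ∈ P.derivValues ν, ∀ μ ∈ Icc n₀ n₁,
      P.minDist μ ≤ P.minDist ν + r * (μ - ν) + K * (μ - ν) ^ 2 := by
  obtain ⟨K, hK0, hK⟩ := h.exists_expansion (n₁ := n₁) hn₀
  refine ⟨K + K / (2 * m₀), by positivity, ?_⟩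
  rintro ν hν hm r ⟨u, hu, y, c, p, hs, hp, rfl⟩ μ hμ
  have hν0 : 0 < ν := hn₀.trans_le hν.1
  have hμ0 : 0 < μ := hn₀.trans_le hμ.1
  obtain ⟨huad, he⟩ := (h.mem_ubar_iff hν0 hs).1 hu
  -- The control, optimal for `ν`, need only be admissible for `μ`, which suffices for an upper
  -- bound.
  obtain ⟨y', c', hs'⟩ := h.exists_isState one_pos hμ0 u
  have hx : 0 < ‖c 1 - P.yd‖ := by rw [he]; exact hm₀.trans_le hm
  have hn : ‖‖c 1 - P.yd‖⁻¹ • (c 1 - P.yd)‖ ≤ 1 := by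
    rw [norm_smul, norm_inv, norm_norm, inv_mul_cancel₀ hx.ne']
  obtain ⟨h1, h2⟩ := hK ν hν μ hμ u (h.norm_le huad) y c y' c' hs hs' _ p hn hp
  have h3 := minDist_le hμ0 ⟨u, huad, y', c', hs', rfl⟩
  have h4 := norm_add_le_expansion hx (c' 1 - c 1)
  rw [sub_add_sub_cancel'] at h4
  have h5 : ‖c' 1 - c 1‖ ^ 2 / (2 * ‖c 1 - P.yd‖) ≤ K / (2 * m₀) * (μ - ν) ^ 2 := by
    rw [div_mul_eq_mul_div]
    have : m₀ ≤ ‖c 1 - P.yd‖ := by rw [he]; exact hm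
    exact div_le_div₀ (by positivity) h2 (by positivity) (by linarith)
  have h6 := (abs_le.1 h1).2
  rw [he] at h4
  rw [he] at h5
  rw [he] at h6
  rw [add_mul, mul_comm _ (μ - ν)]
  linarith

end ControlSystem

/-! ### Interior regularity of the homogeneous equation. -/

namespace IsSol

variable {V H : Type*} [NormedAddCommGroup V] [InnerProductSpace ℝ V]
  [NormedAddCommGroup H] [InnerProductSpace ℝ H] {j : V →L[ℝ] H} {A : V →L[ℝ] StrongDual ℝ V}
  {T α ω : ℝ} {z : ℝ → V} {e : ℝ → H} [CompleteSpace V] [CompleteSpace H]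

/-- Solutions of the homogeneous equation are Lipschitz in `H` away from the initial time. -/
theorem exists_lipschitz (h : IsSol j A T (fun _ => 0) z e) (hA : GardingWith j A α ω)
    (hj : Function.Injective j) (hjd : DenseRange j) {τ : ℝ} (hτ : 0 < τ) :
    ∃ C, 0 ≤ C ∧ ∀ s r, τ ≤ s → s ≤ r → r ≤ 2 * s → r ≤ T → ‖e r - e s‖ ≤ C * (r - s) := by
  have hα := hA.pos
  have hω := hA.nonneg
  set Z := ∫ s in (0 : ℝ)..T, ‖A (z s)‖ ^ 2 with hZ
  refine ⟨√(Real.exp (2 * (2 * ω) * T) * (α⁻¹ * Z)) / τ, by positivity, ?_⟩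
  intro s r hs hsr hr2 hrT
  have hs0 : 0 < s := hτ.trans_le hs
  have hsT : s ≤ T := hsr.trans hrT
  -- The function `z(l ·)` solves the equation of `l • A`, and `z` solves it with force `(l - 1) A
  -- z`. Both start at `e 0`, so `e r - e s` is the value at time `s` of a solution with zero
  -- initial value and force of order `l - 1`.
  set l := r / s with hl
  have hl1 : 1 ≤ l := (one_le_div hs0).2 hsr
  have hl2 : l ≤ 2 := (div_le_iff₀ hs0).2 hr2
  have hls : l * s = r := div_mul_cancel₀ r hs0.ne'
  have hl0 : 0 < l := one_pos.trans_le hl1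
  have hr' : IsSol j A (l * s) (fun _ => 0) z e := h.restrict (by rw [hls]; exact hrT)
  have hzl := hr'.comp_mul hl0
  have hzs := h.restrict hsT
  have hFm : MemLp (fun t => (l - 1) • A (z t)) 2 (timeMeasure s) :=
    (A.comp_memLp' hzs.memLp).const_smul (l - 1)
  have hzs' : IsSol j (l • A) s (fun t => (l - 1) • A (z t)) z e :=
    hzs.congr_force hFm (Eventually.of_forall fun t => by
      ext v
      simp only [sub_apply, smul_apply, smul_eq_mul, zero_apply]
      ring)
  have hw := hzl.sub hzs'
  -- The restriction `1 ≤ l ≤ 2` gives constants that do not depend on `l`.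
  have hG : GardingWith j (l • A) α (2 * ω) :=
    (hA.smul hl0).mono hα (le_mul_of_one_le_left hα.le hl1)
      (mul_le_mul_of_nonneg_right hl2 hω)
  have hE := hw.energy_estimate hG hj hjd hs0
  simp only [mul_zero, sub_self, norm_zero, smul_zero, zero_sub, norm_neg, norm_smul, mul_pow,
    intervalIntegral.integral_const_mul, hls, Real.norm_eq_abs, sq_abs, ne_eq, OfNat.ofNat_ne_zero,
    not_false_eq_true, zero_pow, zero_add] at hE
  have h1 : ∫ t in (0 : ℝ)..s, ‖A (z t)‖ ^ 2 ≤ Z := by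
    refine intervalIntegral.integral_mono_interval le_rfl hs0.le hsT
      (Eventually.of_forall fun t => by positivity) ?_
    exact intervalIntegrable_of_integrable (A.comp_memLp' h.memLp).norm.integrable_sq
      (left_mem_Icc.2 (hs0.le.trans hsT)) (right_mem_Icc.2 (hs0.le.trans hsT))
  have h2 : 0 ≤ α * ∫ t in (0 : ℝ)..s, ‖z (l * t) - z t‖ ^ 2 :=
    mul_nonneg hα.le (intervalIntegral.integral_nonneg hs0.le fun _ _ => by positivity)
  have h0 : 0 ≤ ∫ t in (0 : ℝ)..s, ‖A (z t)‖ ^ 2 :=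
    intervalIntegral.integral_nonneg hs0.le fun _ _ => by positivity
  have h3 : ‖e r - e s‖ ^ 2 ≤ Real.exp (2 * (2 * ω) * T) * (α⁻¹ * Z) * (l - 1) ^ 2 := by
    have h4 : Real.exp (2 * (2 * ω) * s) ≤ Real.exp (2 * (2 * ω) * T) :=
      Real.exp_le_exp.2 (mul_le_mul_of_nonneg_left hsT (by positivity))
    calc ‖e r - e s‖ ^ 2 ≤ Real.exp (2 * (2 * ω) * s) *
          (α⁻¹ * ((l - 1) ^ 2 * ∫ t in (0 : ℝ)..s, ‖A (z t)‖ ^ 2)) := by linarith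
      _ ≤ Real.exp (2 * (2 * ω) * T) * (α⁻¹ * ((l - 1) ^ 2 * Z)) := by gcongr
      _ = _ := by ring
  have h5 := Real.le_sqrt_of_sq_le h3
  have hZ0 : 0 ≤ Z := h0.trans h1
  rw [Real.sqrt_mul (by positivity), Real.sqrt_sq (by linarith)] at h5
  have h6 : l - 1 ≤ (r - s) / τ := by
    have : l - 1 = (r - s) / s := by rw [hl, sub_div, div_self hs0.ne']
    rw [this]
    exact div_le_div_of_nonneg_left (by linarith) hτ hs
  calc ‖e r - e s‖ ≤ _ := h5
    _ ≤ √(Real.exp (2 * (2 * ω) * T) * (α⁻¹ * Z)) * ((r - s) / τ) :=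
      mul_le_mul_of_nonneg_left h6 (Real.sqrt_nonneg _)
    _ = _ := by ring

/-- Solutions of the homogeneous equation are continuous with values in `V` away from the initial
time, up to modification on a null set. -/
theorem exists_tendsto_ae (h : IsSol j A T (fun _ => 0) z e) (hA : GardingWith j A α ω)
    (hj : Function.Injective j) (hjd : DenseRange j) {t₀ : ℝ} (ht₀ : t₀ ∈ Ioo 0 T) :
    ∃ q, Tendsto z (𝓝 t₀ ⊓ ae volume) (𝓝 q) := by
  have hα := hA.pos
  have hω := hA.nonneg
  obtain ⟨C, hC0, hC⟩ := h.exists_lipschitz hA hj hjd (τ := 3 / 4 * t₀) (by linarith [ht₀.1])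
  -- Two points of `I` have ratio below `5/3`, as required by the Lipschitz estimate with `r ≤ 2 *
  -- s`.
  set I := Ioo (3 / 4 * t₀) (min T (5 / 4 * t₀)) with hI
  have hIn : I ∈ 𝓝 t₀ := Ioo_mem_nhds (by linarith [ht₀.1])
    (lt_min ht₀.2 (by linarith [ht₀.1]))
  have hlip : ∀ s ∈ I, ∀ r ∈ I, ‖e r - e s‖ ≤ C * |r - s| := by
    have key : ∀ s ∈ I, ∀ r ∈ I, s ≤ r → ‖e r - e s‖ ≤ C * |r - s| := by
      intro s hs r hr hsr
      rw [abs_of_nonneg (sub_nonneg.2 hsr)]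
      have h1 := hr.2.trans_le (min_le_right _ _)
      exact hC s r hs.1.le hsr (by linarith [hs.1, ht₀.1]) (hr.2.trans_le (min_le_left _ _)).le
    intro s hs r hr
    rcases le_total s r with hsr | hsr
    · exact key s hs r hr hsr
    · rw [norm_sub_rev, abs_sub_comm]; exact key r hr s hs hsr
  have hIT : I ⊆ Ioo 0 T := fun s hs => ⟨by linarith [hs.1, ht₀.1],
    hs.2.trans_le (min_le_left _ _)⟩
  have hT : 0 < T := ht₀.1.trans ht₀.2
  have h0T : (0 : ℝ) ∈ Icc 0 T := left_mem_Icc.2 hT.le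
  have hAi : Integrable (fun s => A (z s)) (timeMeasure T) :=
    (A.comp_memLp' h.memLp).integrable one_le_two
  have hAI := intervalIntegrable_of_integrable hAi h0T (right_mem_Icc.2 hT.le)
  -- pointwise bound for `A z`
  have hbound : ∀ᵐ t, t ∈ I → ∀ v, |A (z t) v| ≤ C * ‖j v‖ := by
    filter_upwards [hAI.ae_hasDerivAt_integral] with t ht htI v
    have h1 := ht (by rw [uIcc_of_le hT.le]; exact Ioo_subset_Icc_self (hIT htI)) 0 left_mem_uIcc
    have h2 : HasDerivAt (fun x => (∫ s in (0 : ℝ)..x, A (z s)) v) (A (z t) v) t :=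
      (ContinuousLinearMap.apply ℝ ℝ v).hasFDerivAt.comp_hasDerivAt t h1
    -- At almost every time `-A z` is the derivative of `e` in `V*`, so the Lipschitz bound for `e`
    -- in `H` bounds `A (z t) v` by `‖j v‖` instead of `‖v‖`.
    refine h2.le_of_lip' (by positivity) ?_
    filter_upwards [isOpen_Ioo.mem_nhds htI] with x hx
    have h3 : ∀ x ∈ I, (∫ s in (0 : ℝ)..x, A (z s)) v =
        inner ℝ (e 0) (j v) - inner ℝ (e x) (j v) := by
      intro x hx
      have hx' := Ioo_subset_Icc_self (hIT hx)
      rw [h.eq x hx' v, ContinuousLinearMap.intervalIntegral_apply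
        (intervalIntegrable_of_integrable hAi h0T hx')]
      simp
    rw [h3 x hx, h3 t htI, sub_sub_sub_cancel_left, ← inner_sub_left]
    refine (norm_inner_le_norm _ _).trans ?_
    rw [Real.norm_eq_abs, abs_sub_comm]
    calc ‖e t - e x‖ * ‖j v‖ ≤ C * |t - x| * ‖j v‖ :=
          mul_le_mul_of_nonneg_right (hlip x hx t htI) (norm_nonneg _)
      _ = _ := by ring
  have hae : ∀ᵐ t, t ∈ I → e t = j (z t) := by
    have := (ae_restrict_iff' measurableSet_Ioo).1 h.ae_eq
    filter_upwards [this] with t ht htI using ht (hIT htI)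
  have hNe : (𝓝 t₀ ⊓ ae (volume : Measure ℝ)).NeBot := by
    rw [inf_neBot_iff]
    intro s hs s' hs'
    have h1 : 0 < volume s := Measure.measure_pos_of_mem_nhds volume hs
    have h2 : volume (s ∩ s') = volume s := measure_inter_conull (mem_ae_iff.1 hs')
    exact nonempty_of_measure_ne_zero (by rw [h2]; exact h1.ne')
  have hcauchy : Cauchy (map z (𝓝 t₀ ⊓ ae volume)) := by
    rw [Metric.cauchy_iff]
    refine ⟨hNe.map z, fun ε hε => ?_⟩
    have hcont : Tendsto (fun d : ℝ => α⁻¹ * (2 * C * (C * d) + ω * (C * d) ^ 2)) (𝓝 0) (𝓝 0) := by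
      have : Continuous (fun d : ℝ => α⁻¹ * (2 * C * (C * d) + ω * (C * d) ^ 2)) := by fun_prop
      simpa using this.tendsto 0
    obtain ⟨η, hη, hη'⟩ := Metric.eventually_nhds_iff.1
      (hcont.eventually (gt_mem_nhds (by positivity : 0 < ε ^ 2)))
    set G := {t | (t ∈ I → ∀ v, |A (z t) v| ≤ C * ‖j v‖) ∧ (t ∈ I → e t = j (z t))} with hG
    have hGae : G ∈ ae (volume : Measure ℝ) := hbound.and hae
    set S := (I ∩ Metric.ball t₀ (η / 2)) ∩ G with hS
    have hSm : S ∈ 𝓝 t₀ ⊓ ae volume :=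
      inter_mem_inf (inter_mem hIn (Metric.ball_mem_nhds _ (by positivity))) hGae
    refine ⟨z '' S, image_mem_map hSm, ?_⟩
    rintro _ ⟨s, ⟨⟨hsI, hsb⟩, hsG⟩, rfl⟩ _ ⟨r, ⟨⟨hrI, hrb⟩, hrG⟩, rfl⟩
    have hd : |r - s| < η := by
      rw [Metric.mem_ball, Real.dist_eq] at hsb hrb
      have := abs_sub_le r t₀ s
      rw [abs_sub_comm t₀ s] at this
      linarith
    have h1 := hlip s hsI r hrI
    have h2 : j (z s - z r) = e s - e r := by rw [map_sub, ← hsG.2 hsI, ← hrG.2 hrI]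
    have h3 : ‖j (z s - z r)‖ ≤ C * |r - s| := by rw [h2, norm_sub_rev]; exact h1
    -- In Gårding's inequality for `z s - z r` both terms on the right are controlled by `‖j (z s -
    -- z r)‖ = ‖e s - e r‖`. Smallness in `H` therefore forces smallness in `V`.
    have h4 := hA.le (z s - z r)
    have h5 := (abs_le.1 (hsG.1 hsI (z s - z r))).2
    have h6 := (abs_le.1 (hrG.1 hrI (z s - z r))).1
    have h7 : A (z s - z r) (z s - z r) = A (z s) (z s - z r) - A (z r) (z s - z r) := by
      rw [map_sub A, sub_apply]
    have h8 := hη' (y := |r - s|) (by rw [Real.dist_eq, sub_zero, abs_abs]; exact hd)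
    have h9 : ‖z s - z r‖ ^ 2 < ε ^ 2 := by
      refine lt_of_le_of_lt ?_ h8
      rw [le_inv_mul_iff₀ hα]
      have h10 := mul_le_mul_of_nonneg_left h3 hC0
      have h11 := mul_le_mul_of_nonneg_left (pow_le_pow_left₀ (norm_nonneg _) h3 2) hω
      linarith
    rw [dist_eq_norm]
    exact lt_of_pow_lt_pow_left₀ 2 hε.le h9
  obtain ⟨q, hq⟩ := cauchy_iff_exists_le_nhds.1 hcauchy
  exact ⟨q, hq⟩

end IsSol

/-- If `j` is compact and injective with dense range, then the dual of its domain is separable. -/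
theorem secondCountableTopology_strongDual_of_isCompactOperator {V H : Type*}
    [NormedAddCommGroup V] [InnerProductSpace ℝ V] [NormedAddCommGroup H] [InnerProductSpace ℝ H]
    [CompleteSpace V] [CompleteSpace H] {j : V →L[ℝ] H} (hc : IsCompactOperator j)
    (hj : Function.Injective j) (hd : DenseRange j) :
    SecondCountableTopology (StrongDual ℝ V) := by
  have h1 : TopologicalSpace.IsSeparable (range j) := by
    have h2 : range j = ⋃ n : ℕ, j '' Metric.closedBall 0 n := by
      rw [← image_iUnion, Metric.iUnion_closedBall_nat, image_univ]
    rw [h2]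
    refine TopologicalSpace.IsSeparable.iUnion fun n => ?_
    obtain ⟨K, hK, hKs⟩ := hc.image_closedBall_subset_compact (f := (j : V →ₗ[ℝ] H)) (n : ℝ)
    exact hK.isSeparable.mono hKs
  have h3 : TopologicalSpace.SeparableSpace H := by
    rw [← TopologicalSpace.isSeparable_univ_iff, ← hd.closure_range]
    exact h1.closure
  -- Injectivity of `j` is density of the range of its adjoint, through which separability passes
  -- from `H` to `V`.
  have h4 : DenseRange (ContinuousLinearMap.adjoint j) := by
    have : (LinearMap.range (ContinuousLinearMap.adjoint j).toLinearMap)ᗮ = ⊥ := by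
      rw [Submodule.eq_bot_iff]
      intro v hv
      have h5 : ∀ x, inner ℝ x (j v) = 0 := fun x => by
        rw [← ContinuousLinearMap.adjoint_inner_left]
        exact (Submodule.mem_orthogonal _ v).1 hv _ ⟨x, rfl⟩
      exact hj (by rw [inner_self_eq_zero.1 (h5 (j v)), map_zero])
    have h6 := Submodule.dense_iff_topologicalClosure_eq_top.2
      ((Submodule.topologicalClosure_eq_top_iff).2 this)
    exact h6
  have h7 : TopologicalSpace.SeparableSpace V :=
    h4.separableSpace (ContinuousLinearMap.adjoint j).continuous
  have h8 : SecondCountableTopology V := UniformSpace.secondCountable_of_separable V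
  exact (InnerProductSpace.toDual ℝ V).toHomeomorph.symm.isEmbedding.secondCountableTopology

/-! ### The minimized Hamiltonian and the dual lower bound. -/

namespace ControlSystem

variable {V H : Type*} [NormedAddCommGroup V] [InnerProductSpace ℝ V]
  [NormedAddCommGroup H] [InnerProductSpace ℝ H]
  {Ω : Type*} [MeasurableSpace Ω] {ρ : Measure Ω} {P : ControlSystem V H ρ} {α ω M : ℝ}

/-- The minimized Hamiltonian `q ↦ inf {⟨B v, q⟩ : v ∈ U_ad}`. -/
def minHam (P : ControlSystem V H ρ) (q : V) : ℝ := sInf ((fun v => P.B v q) '' P.Uad)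

theorem IsRegular.abs_B_le (h : P.IsRegular α ω M) {v : Lp ℝ 2 ρ} (hv : v ∈ P.Uad) (q : V) :
    |P.B v q| ≤ ‖P.B‖ * M * ‖q‖ :=
  ((P.B v).le_opNorm q).trans (mul_le_mul_of_nonneg_right ((P.B.le_opNorm v).trans
    (mul_le_mul_of_nonneg_left (h.bound v hv) (norm_nonneg _))) (norm_nonneg _))

theorem IsRegular.minHam_le (h : P.IsRegular α ω M) {v : Lp ℝ 2 ρ} (hv : v ∈ P.Uad) (q : V) :
    P.minHam q ≤ P.B v q :=
  csInf_le ⟨-(‖P.B‖ * M * ‖q‖), by rintro _ ⟨v, hv, rfl⟩; exact (abs_le.1 (h.abs_B_le hv q)).1⟩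
    ⟨v, hv, rfl⟩

theorem IsRegular.le_minHam (h : P.IsRegular α ω M) {q : V} {b : ℝ}
    (hb : ∀ v ∈ P.Uad, b ≤ P.B v q) : b ≤ P.minHam q :=
  le_csInf (h.nonempty.image _) (by rintro _ ⟨v, hv, rfl⟩; exact hb v hv)

/-- An infimum of linear functionals with a common norm bound is Lipschitz with that bound. -/
theorem IsRegular.abs_minHam_sub_le (h : P.IsRegular α ω M) (q q' : V) :
    |P.minHam q - P.minHam q'| ≤ ‖P.B‖ * M * ‖q - q'‖ := by
  have key : ∀ q q' : V, P.minHam q - ‖P.B‖ * M * ‖q - q'‖ ≤ P.minHam q' := fun q q' =>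
    h.le_minHam fun v hv => by
      have h1 := h.minHam_le hv q
      have h2 := (abs_le.1 (h.abs_B_le hv (q - q'))).2
      rw [map_sub] at h2
      linarith
  rw [abs_le]
  have h1 := key q q'
  have h2 := key q' q
  rw [norm_sub_rev] at h2
  constructor <;> linarith

theorem IsRegular.continuous_minHam (h : P.IsRegular α ω M) : Continuous P.minHam := by
  have hC : 0 ≤ ‖P.B‖ * M := mul_nonneg (norm_nonneg P.B) h.bound_nonneg
  exact (LipschitzWith.of_dist_le_mul (K := ⟨‖P.B‖ * M, hC⟩) fun q q' => by
    rw [Real.dist_eq, dist_eq_norm]; exact h.abs_minHam_sub_le q q').continuous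

theorem IsRegular.integrable_minHam (h : P.IsRegular α ω M) {T : ℝ} {z : ℝ → V}
    (hz : MemLp z 2 (timeMeasure T)) : Integrable (fun s => P.minHam (z s)) (timeMeasure T) := by
  have h0 : P.minHam 0 = 0 := by
    have : (fun v => P.B v (0 : V)) '' P.Uad = {0} := by
      simp only [map_zero]
      exact h.nonempty.image_const 0
    rw [minHam, this, csInf_singleton]
  refine ((hz.integrable one_le_two).norm.const_mul (‖P.B‖ * M)).mono'
    (h.continuous_minHam.comp_aestronglyMeasurable hz.1) (Eventually.of_forall fun s => ?_)
  have := h.abs_minHam_sub_le (z s) 0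
  rwa [h0, sub_zero, sub_zero] at this

theorem integral_minHam_eq {z : ℝ → V} {ν : ℝ} :
    ∫ s in (0 : ℝ)..ν, P.minHam (z s) =
      ν * ∫ s in (0 : ℝ)..1, P.minHam (z (ν * (1 - s))) := by
  have h1 := intervalIntegral.integral_comp_sub_left (a := 0) (b := 1)
    (fun s => P.minHam (z (ν * s))) 1
  have h2 := intervalIntegral.smul_integral_comp_mul_left (a := 0) (b := 1)
    (fun s => P.minHam (z s)) ν
  simp only [sub_zero, sub_self, mul_zero, mul_one, smul_eq_mul] at h1 h2
  rw [h1, h2]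

variable [CompleteSpace V] [CompleteSpace H]

/-- The pairing of the final state with a vector, expressed through the adjoint solution. -/
theorem IsRegular.inner_state_eq (h : P.IsRegular α ω M) {T ν : ℝ} {z : ℝ → V} {e : ℝ → H}
    (hz : IsSol P.emb P.a.flip T (fun _ => 0) z e) (hν : 0 < ν) (hνT : ν ≤ T)
    {u : L2Time 1 (Lp ℝ 2 ρ)} {y : L2Time 1 V} {c : ℝ → H} (hs : P.IsState 1 ν u y c) :
    inner ℝ (c 1) (e 0) = inner ℝ P.y₀ (e ν) +
      ν * ∫ s in (0 : ℝ)..1, P.B (u s) (z (ν * (1 - s))) := by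
  have h1 : IsSol P.emb P.a.flip (ν * 1) (fun _ => 0) z e := hz.restrict (by rwa [mul_one])
  have h2 := h1.comp_mul hν
  simp only [smul_zero] at h2
  have hs' := (isState_iff one_pos).1 hs
  have h3 := hs'.1.green h2 (h.garding.smul hν) h.gelfand.injective h.gelfand.dense one_pos
  rw [mul_zero, mul_one, hs'.2] at h3
  rw [h3, ← intervalIntegral.integral_const_mul]
  rfl

/-- The dual lower bound for the optimal distance. -/
def dualFun (P : ControlSystem V H ρ) (z : ℝ → V) (e : ℝ → H) (T : ℝ) : ℝ :=
  inner ℝ P.y₀ (e T) - inner ℝ P.yd (e 0) + ∫ s in (0 : ℝ)..T, P.minHam (z s)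

/-- Weak duality: bound the distance from below by the pairing with `e 0`, rewrite it by Green's
formula, and minimize the integrand pointwise over the control values. -/
theorem IsRegular.dualFun_le (h : P.IsRegular α ω M) {T ν : ℝ} {z : ℝ → V} {e : ℝ → H}
    (hz : IsSol P.emb P.a.flip T (fun _ => 0) z e) (he : ‖e 0‖ ≤ 1) (hν : 0 < ν) (hνT : ν ≤ T) :
    P.dualFun z e ν ≤ P.minDist ν := by
  refine h.le_minDist hν ?_
  rintro _ ⟨u, hu, y, c, hs, rfl⟩
  have h1 : inner ℝ (c 1 - P.yd) (e 0) ≤ ‖c 1 - P.yd‖ :=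
    (real_inner_le_norm _ _).trans (mul_le_of_le_one_right (norm_nonneg _) he)
  refine le_trans ?_ h1
  have hzm : MemLp (fun s => z (ν * (1 - s))) 2 (timeMeasure 1) :=
    (memLp_comp_mul hν (hz.restrict (by rwa [mul_one] : ν * 1 ≤ T)).memLp).comp_measurePreserving
      (measurePreserving_reflect 1)
  rw [inner_sub_left, h.inner_state_eq hz hν hνT hs, dualFun, integral_minHam_eq]
  have h2 : ∫ s in (0 : ℝ)..1, P.minHam (z (ν * (1 - s))) ≤
      ∫ s in (0 : ℝ)..1, P.B (u s) (z (ν * (1 - s))) := by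
    rw [← integral_timeMeasure zero_le_one, ← integral_timeMeasure zero_le_one]
    refine integral_mono_ae (h.integrable_minHam hzm)
      (integrable_pairing (P.B.comp_memLp' (Lp.memLp u)) hzm) ?_
    filter_upwards [hu] with s hs
    exact h.minHam_le hs _
  have h3 := mul_le_mul_of_nonneg_left h2 hν.le
  linarith

/-- The pointwise minimum principle, from its integrated form. -/
theorem IsRegular.ae_eq_minHam (h : P.IsRegular α ω M) {q : ℝ → V}
    (hq : MemLp q 2 (timeMeasure 1)) {u : L2Time 1 (Lp ℝ 2 ρ)} (hu : u ∈ P.UadTime 1)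
    (hmin : ∀ v ∈ P.UadTime 1,
      ∫ s in (0 : ℝ)..1, P.B (u s) (q s) ≤ ∫ s in (0 : ℝ)..1, P.B (v s) (q s)) :
    ∀ᵐ s ∂(timeMeasure 1), P.B (u s) (q s) = P.minHam (q s) := by
  have hi : ∀ {w : ℝ → Lp ℝ 2 ρ}, MemLp w 2 (timeMeasure 1) →
      Integrable (fun s => P.B (w s) (q s)) (timeMeasure 1) := fun hw =>
    integrable_pairing (P.B.comp_memLp' hw) hq
  have h1 : ∀ v ∈ P.Uad, ∀ᵐ s ∂(timeMeasure 1), P.B (u s) (q s) ≤ P.B v (q s) := by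
    intro v hv
    have hvm : MemLp (fun _ : ℝ => v) 2 (timeMeasure 1) := memLp_const v
    have h2 := ae_nonneg_of_forall_setIntegral_nonneg ((hi hvm).sub (hi (Lp.memLp u)))
      fun E hE _ => ?_
    · filter_upwards [h2] with s hs
      exact sub_nonneg.1 hs
    classical
    -- The competitor replaces `u` by the fixed value `v` on an arbitrary measurable set of times,
    -- which localizes the integral inequality.
    set w : ℝ → Lp ℝ 2 ρ := E.piecewise (fun _ => v) u with hw
    have hwm : MemLp w 2 (timeMeasure 1) :=
      MemLp.piecewise hE (hvm.restrict E) ((Lp.memLp u).restrict Eᶜ)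
    have hwU : hwm.toLp ∈ P.UadTime 1 := by
      filter_upwards [hu, hwm.coeFn_toLp] with s h3 h4
      rw [h4, hw]
      by_cases hs : s ∈ E
      · rw [piecewise_eq_of_mem _ _ _ hs]; exact hv
      · rw [piecewise_eq_of_notMem _ _ _ hs]; exact h3
    have h5 := hmin _ hwU
    rw [← integral_timeMeasure zero_le_one, ← integral_timeMeasure zero_le_one] at h5
    have h6 : ∫ s, P.B (hwm.toLp w s) (q s) ∂(timeMeasure 1) =
        ∫ s, P.B (w s) (q s) ∂(timeMeasure 1) := by
      refine integral_congr_ae ?_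
      filter_upwards [hwm.coeFn_toLp] with s h4
      rw [h4]
    rw [h6, ← sub_nonneg, ← integral_sub (hi hwm) (hi (Lp.memLp u))] at h5
    rw [← integral_indicator hE]
    refine h5.trans_eq (integral_congr_ae (Eventually.of_forall fun s => ?_))
    by_cases hs : s ∈ E <;> simp [hw, hs]
  -- The exceptional null set depends on `v`. A countable dense subset of `B(U_ad)`, available
  -- because `V*` is separable, gives one null set for all values.
  have := secondCountableTopology_strongDual_of_isCompactOperator h.gelfand.compact
    h.gelfand.injective h.gelfand.dense
  obtain ⟨t, hts, htc, htd⟩ := (TopologicalSpace.IsSeparable.of_separableSpace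
    (P.B '' P.Uad)).exists_countable_dense_subset
  have h3 : ∀ᵐ s ∂(timeMeasure 1), ∀ f ∈ t, P.B (u s) (q s) ≤ f (q s) := by
    rw [ae_ball_iff htc]
    intro f hf
    obtain ⟨v, hv, rfl⟩ := hts hf
    exact h1 v hv
  filter_upwards [h3, hu] with s hs hus
  refine le_antisymm (h.le_minHam fun v hv => ?_) (h.minHam_le hus _)
  have hcl : IsClosed {f : StrongDual ℝ V | P.B (u s) (q s) ≤ f (q s)} :=
    isClosed_le continuous_const (ContinuousLinearMap.apply ℝ ℝ (q s)).continuous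
  exact closure_minimal hs hcl (htd ⟨v, hv, rfl⟩)

/-- Variational inequality for the point of a convex set which is closest to `d`. -/
theorem inner_nonneg_of_norm_sub_le {E : Type*} [NormedAddCommGroup E] [InnerProductSpace ℝ E]
    {K : Set E} (hK : Convex ℝ K) {x d : E} (hx : x ∈ K) (hmin : ∀ y ∈ K, ‖x - d‖ ≤ ‖y - d‖)
    {y : E} (hy : y ∈ K) : 0 ≤ inner ℝ (y - x) (x - d) := by
  have h1 := (norm_eq_iInf_iff_real_inner_le_zero hK (u := d) hx).1 (le_antisymm
    (by
      have : Nonempty K := ⟨⟨x, hx⟩⟩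
      refine le_ciInf fun w => ?_
      rw [norm_sub_rev, norm_sub_rev d]
      exact hmin w w.2)
    (ciInf_le ⟨0, by rintro _ ⟨w, rfl⟩; exact norm_nonneg _⟩ (⟨x, hx⟩ : K))) y hy
  rw [← neg_sub d x, inner_neg_right, real_inner_comm]
  linarith

/-- Both inequalities of weak duality become equalities. The vector `e 0` is the unit normal at the
optimal final state, and the variational inequality over the convex reachable set yields the
pointwise minimum principle for `u`. -/
theorem IsRegular.dualFun_eq (h : P.IsRegular α ω M) {T ν : ℝ} {z : ℝ → V} {e : ℝ → H}
    (hz : IsSol P.emb P.a.flip T (fun _ => 0) z e) (hν : 0 < ν) (hνT : ν ≤ T)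
    {u : L2Time 1 (Lp ℝ 2 ρ)} {y : L2Time 1 V} {c : ℝ → H} (hs : P.IsState 1 ν u y c)
    (hu : u ∈ P.ubar ν) (hpos : 0 < ‖c 1 - P.yd‖)
    (he : e 0 = ‖c 1 - P.yd‖⁻¹ • (c 1 - P.yd)) :
    P.dualFun z e ν = P.minDist ν := by
  obtain ⟨huad, hdist⟩ := (h.mem_ubar_iff hν hs).1 hu
  have hzm : MemLp (fun s => z (ν * (1 - s))) 2 (timeMeasure 1) :=
    (memLp_comp_mul hν (hz.restrict (by rwa [mul_one] : ν * 1 ≤ T)).memLp).comp_measurePreserving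
      (measurePreserving_reflect 1)
  have h1 := h.ae_eq_minHam hzm huad fun v hv => by
    obtain ⟨y', c', hs'⟩ := h.exists_isState one_pos hν v
    have h2 := inner_nonneg_of_norm_sub_le (h.convex_reachable hν) (d := P.yd)
      ⟨u, huad, y, c, hs, rfl⟩ (fun x hx => by rw [hdist]; exact minDist_le hν hx)
      (⟨v, hv, y', c', hs', rfl⟩ : c' 1 ∈ P.reachable ν)
    have h3 : 0 ≤ inner ℝ (c' 1 - c 1) (e 0) := by
      rw [he, inner_smul_right]; positivity
    rw [inner_sub_left, h.inner_state_eq hz hν hνT hs,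
      h.inner_state_eq hz hν hνT hs', add_sub_add_left_eq_sub, ← mul_sub] at h3
    exact sub_nonneg.1 ((mul_nonneg_iff_of_pos_left hν).1 h3)
  have h4 : inner ℝ (c 1 - P.yd) (e 0) = P.minDist ν := by
    rw [he, inner_smul_right, real_inner_self_eq_norm_sq, ← hdist]
    field_simp
  rw [← h4, inner_sub_left, h.inner_state_eq hz hν hνT hs, dualFun, integral_minHam_eq]
  have h5 : ∫ s in (0 : ℝ)..1, P.B (u s) (z (ν * (1 - s))) =
      ∫ s in (0 : ℝ)..1, P.minHam (z (ν * (1 - s))) := by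
    rw [← integral_timeMeasure zero_le_one, ← integral_timeMeasure zero_le_one]
    exact integral_congr_ae h1
  rw [h5]
  ring

/-! ### Differentiability of the optimal distance. -/

theorem hasDerivAt_of_abs_sub_le_sq {f : ℝ → ℝ} {x d K : ℝ}
    (h : ∀ᶠ y in 𝓝 x, |f y - f x - (y - x) * d| ≤ K * (y - x) ^ 2) : HasDerivAt f d x := by
  rw [hasDerivAt_iff_isLittleO]
  refine Asymptotics.IsBigO.trans_isLittleO (g := fun y => (y - x) ^ 2) ?_ ?_
  · refine Asymptotics.IsBigO.of_bound K ?_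
    filter_upwards [h] with y hy
    rw [smul_eq_mul, Real.norm_eq_abs, Real.norm_of_nonneg (sq_nonneg _)]
    exact hy
  · simpa only [Real.norm_eq_abs, sq_abs] using Asymptotics.isLittleO_pow_sub_sub x one_lt_two

theorem IsRegular.exists_hasDerivAt_dualFun (h : P.IsRegular α ω M) {T ν : ℝ} {z : ℝ → V}
    {e : ℝ → H} (hz : IsSol P.emb P.a.flip T (fun _ => 0) z e) (he : ‖e 0‖ ≤ 1)
    (hν : ν ∈ Ioo 0 T) : ∃ d, HasDerivAt (P.dualFun z e) d ν := by
  have hν0 := hν.1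
  -- the part which involves the initial state
  obtain ⟨K, -, hK⟩ := h.exists_expansion (n₀ := ν / 2) (n₁ := T) (by linarith)
  have hνI : ν ∈ Icc (ν / 2) T := ⟨by linarith, hν.2.le⟩
  -- For the zero control the pairing of the final state with `e 0` is exactly `(y₀, e(ν))`. This
  -- control need not be admissible, since the expansion only asks for the norm bound.
  obtain ⟨y, c, hs⟩ := h.exists_isState one_pos hν0 0
  have hz1 : IsSol P.emb P.a.flip (ν * 1) (fun _ => 0) z e :=
    hz.restrict (by rw [mul_one]; exact hν.2.le)
  have hz2 := hz1.comp_mul hν0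
  simp only [smul_zero] at hz2
  obtain ⟨p, hp, -⟩ := isAdjoint_of_isSol (P := P) (ν := ν) hz2
  rw [mul_zero] at hp
  set r := ∫ t in Ioo (0 : ℝ) 1, (P.B ((0 : L2Time 1 (Lp ℝ 2 ρ)) t) - P.a (y t)) (p t) with hr
  have hin : ∀ μ ∈ Icc (ν / 2) T, ∀ y' c', P.IsState 1 μ 0 y' c' →
      inner ℝ (c' 1) (e 0) = inner ℝ P.y₀ (e μ) := by
    intro μ hμ y' c' hs'
    have hμ0 : 0 < μ := by linarith [hμ.1]
    rw [h.inner_state_eq hz hμ0 hμ.2 hs', ← integral_timeMeasure zero_le_one,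
      integral_congr_ae (g := fun _ => (0 : ℝ))]
    · simp
    · filter_upwards [Lp.coeFn_zero (Lp ℝ 2 ρ) 2 (timeMeasure 1)] with s h1
      rw [h1]; simp
  have h1 : HasDerivAt (fun μ => inner ℝ P.y₀ (e μ)) r ν := by
    refine hasDerivAt_of_abs_sub_le_sq (K := K) ?_
    filter_upwards [Icc_mem_nhds (by linarith : ν / 2 < ν) hν.2] with μ hμ
    obtain ⟨y', c', hs'⟩ := h.exists_isState one_pos (by linarith [hμ.1] : 0 < μ) 0
    have := (hK ν hνI μ hμ 0 (by rw [norm_zero]; exact h.bound_nonneg) y c y' c' hs hs'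
      _ p he hp).1
    rwa [inner_sub_left, hin μ hμ y' c' hs', hin ν hνI y c hs] at this
  -- the part which involves the control
  obtain ⟨q, hq⟩ := hz.exists_tendsto_ae h.garding.flip h.gelfand.injective h.gelfand.dense hν
  have hT : 0 < T := hν.1.trans hν.2
  have hmi := h.integrable_minHam hz.memLp
  -- The fundamental theorem of calculus needs only a limit of the integrand at `ν` off a null set.
  have h2 : HasDerivAt (fun t => ∫ s in (0 : ℝ)..t, P.minHam (z s)) (P.minHam q) ν := by
    refine intervalIntegral.integral_hasDerivAt_of_tendsto_ae_right
      (intervalIntegrable_of_integrable hmi (left_mem_Icc.2 hT.le) (Ioo_subset_Icc_self hν)) ?_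
      ((h.continuous_minHam.tendsto q).comp hq)
    exact ⟨Ioo 0 T, isOpen_Ioo.mem_nhds hν, hmi.1⟩
  exact ⟨_, (h1.sub_const _).add h2⟩

/-- The optimal distance is differentiable where it is positive, and `derivValues` consists of
its derivative only. -/
theorem IsRegular.exists_hasDerivAt_minDist (h : P.IsRegular α ω M) {ν : ℝ} (hν : 0 < ν)
    (hpos : 0 < P.minDist ν) :
    ∃ d, HasDerivAt P.minDist d ν ∧ P.derivValues ν = {d} := by
  -- a minimizer and its adjoint state
  obtain ⟨x, ⟨u, hu, y, c, hs, rfl⟩, hmin⟩ := h.exists_minimizer hν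
  have hubar : u ∈ P.ubar ν := ⟨hu, y, c, hs, fun u' hu' y' c' hs' =>
    hmin _ ⟨u', hu', y', c', hs', rfl⟩⟩
  have hdist := ((h.mem_ubar_iff hν hs).1 hubar).2
  have hx : 0 < ‖c 1 - P.yd‖ := by rw [hdist]; exact hpos
  -- The horizon `2 * ν` makes `ν` an interior point, so the comparison from below holds on both
  -- sides of `ν`.
  obtain ⟨z, e, -, hz, he, -⟩ := exists_isSol_isSmoothLimit h.garding.flip h.gelfand.injective
    h.gelfand.dense (by linarith : 0 < 2 * ν) (F := fun _ => 0) (memLp_const 0)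
    (‖c 1 - P.yd‖⁻¹ • (c 1 - P.yd))
  have he1 : ‖e 0‖ ≤ 1 := by rw [he, norm_smul, norm_inv, norm_norm, inv_mul_cancel₀ hx.ne']
  have hz1 : IsSol P.emb P.a.flip (ν * 1) (fun _ => 0) z e := hz.restrict (by linarith)
  have hz2 := hz1.comp_mul hν
  simp only [smul_zero] at hz2
  obtain ⟨p, hp, -⟩ := isAdjoint_of_isSol (P := P) (ν := ν) hz2
  rw [mul_zero, he] at hp
  -- comparison functions
  obtain ⟨d, hd⟩ := h.exists_hasDerivAt_dualFun hz he1 ⟨hν, by linarith⟩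
  have hDeq := h.dualFun_eq hz hν (by linarith) hs hubar hx he
  have hDle : ∀ᶠ μ in 𝓝 ν, P.dualFun z e μ ≤ P.minDist μ := by
    filter_upwards [Ioo_mem_nhds hν (by linarith : ν < 2 * ν)] with μ hμ
    exact h.dualFun_le hz he1 hμ.1 hμ.2.le
  obtain ⟨K, -, hK⟩ := h.exists_semiconcave (n₀ := ν / 2) (n₁ := 2 * ν) (by linarith) hpos
  have hup : ∀ r ∈ P.derivValues ν, ∀ᶠ μ in 𝓝 ν,
      P.minDist μ ≤ P.minDist ν + r * (μ - ν) + K * (μ - ν) ^ 2 := by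
    intro r hr
    filter_upwards [Icc_mem_nhds (by linarith : ν / 2 < ν) (by linarith : ν < 2 * ν)] with μ hμ
    exact hK ν ⟨by linarith, by linarith⟩ le_rfl r hr μ hμ
  have hgd : ∀ r, HasDerivAt (fun μ => P.minDist ν + r * (μ - ν) + K * (μ - ν) ^ 2) r ν := by
    intro r
    have h1 : HasDerivAt (fun μ : ℝ => μ - ν) 1 ν := (hasDerivAt_id ν).sub_const ν
    have h2 := ((h1.const_mul r).const_add (P.minDist ν)).add ((h1.fun_pow 2).const_mul K)
    refine h2.congr_deriv ?_
    simp
  have heq : ∀ r ∈ P.derivValues ν, r = d := by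
    intro r hr
    -- The upper bound minus the lower bound is nonnegative near `ν` and zero at `ν`, so the two
    -- slopes agree.
    have h1 : IsLocalMin ((fun μ => P.minDist ν + r * (μ - ν) + K * (μ - ν) ^ 2) -
        P.dualFun z e) ν := by
      filter_upwards [hup r hr, hDle] with μ h2 h3
      simp only [Pi.sub_apply, hDeq, sub_self, mul_zero, ne_eq, OfNat.ofNat_ne_zero,
        not_false_eq_true, zero_pow, add_zero]
      linarith
    exact sub_eq_zero.1 (h1.hasDerivAt_eq_zero ((hgd r).sub hd))
  have hne : ∃ r, r ∈ P.derivValues ν := ⟨_, u, hubar, y, c, p, hs, hp, rfl⟩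
  obtain ⟨r, hr⟩ := hne
  obtain rfl := heq r hr
  refine ⟨r, ?_, ?_⟩
  · have h1 := hasDerivAt_iff_isLittleO.1 hd
    have h2 := hasDerivAt_iff_isLittleO.1 (hgd r)
    rw [hasDerivAt_iff_isLittleO]
    -- The first-order error of `minDist` lies between those of the two comparison functions, hence
    -- is bounded by the sum of their absolute values.
    refine Asymptotics.IsBigO.trans_isLittleO (Asymptotics.IsBigO.of_bound 1 ?_)
      (h1.norm_left.add h2.norm_left)
    filter_upwards [hup r hr, hDle] with μ h3 h4
    simp only [hDeq, sub_self, mul_zero, ne_eq, OfNat.ofNat_ne_zero, not_false_eq_true, zero_pow,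
      add_zero, smul_eq_mul, Real.norm_eq_abs, one_mul]
    rw [abs_of_nonneg (a := |_| + |_|) (by positivity), abs_le]
    constructor
    · have := neg_abs_le (P.dualFun z e μ - P.minDist ν - (μ - ν) * r)
      have := abs_nonneg (P.minDist ν + r * (μ - ν) + K * (μ - ν) ^ 2 - P.minDist ν - (μ - ν) * r)
      linarith
    · have := abs_nonneg (P.dualFun z e μ - P.minDist ν - (μ - ν) * r)
      have := le_abs_self (P.minDist ν + r * (μ - ν) + K * (μ - ν) ^ 2 - P.minDist ν - (μ - ν) * r)
      linarith
  · ext r'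
    exact ⟨fun h1 => heq r' h1, fun h1 => by rw [mem_singleton_iff.1 h1]; exact hr⟩

end ControlSystem

/-! ### From semiconcavity to continuous differentiability. -/

/-- A differentiable function which is uniformly semiconcave near a point is `C¹` there. -/
theorem contDiffAt_one_of_semiconcave {f d : ℝ → ℝ} {a b K x : ℝ} (hx : x ∈ Ioo a b)
    (hd : ∀ y ∈ Ioo a b, HasDerivAt f (d y) y)
    (hK : ∀ y ∈ Ioo a b, ∀ w ∈ Ioo a b, f w ≤ f y + d y * (w - y) + K * (w - y) ^ 2) :
    ContDiffAt ℝ 1 f x := by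
  have hcont : ContinuousOn d (Ioo a b) := by
    intro y hy
    refine ContinuousAt.continuousWithinAt ?_
    have hfc : ContinuousAt f y := (hd y hy).continuousAt
    have hI : Ioo a b ∈ 𝓝 y := isOpen_Ioo.mem_nhds hy
    -- the bound from one comparison point `w`
    have hcmp : ∀ w ∈ Ioo a b, w ≠ y → ContinuousAt (fun s => (f w - f s) / (w - s) - K * (w - s)) y := by
      intro w hw hwy
      exact ((continuousAt_const.sub hfc).div (continuousAt_const.sub continuousAt_id)
        (sub_ne_zero.2 hwy)).sub (continuousAt_const.mul (continuousAt_const.sub continuousAt_id))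
    have hslope : Tendsto (fun w => (f w - f y) / (w - y) - K * (w - y)) (𝓝[≠] y) (𝓝 (d y)) := by
      have h1 := (hasDerivAt_iff_tendsto_slope.1 (hd y hy))
      have h2 : Tendsto (fun w => K * (w - y)) (𝓝[≠] y) (𝓝 0) := by
        have : Continuous fun w => K * (w - y) := by fun_prop
        simpa using (this.tendsto y).mono_left nhdsWithin_le_nhds
      have h3 := h1.sub h2
      rw [sub_zero] at h3
      refine h3.congr fun w => ?_
      rw [slope_def_field]
    -- Semiconcavity at `s`, evaluated at a fixed `w > s`, bounds `d s` from below by an expression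
    -- continuous in `s`. At `s = y` that expression is close to `d y` once `w` is chosen close to
    -- `y`. A point `w < s` gives the upper bound, since dividing by `w - s` reverses the
    -- inequality.
    rw [ContinuousAt, tendsto_order]
    constructor
    · intro l hl
      have h1 : ∀ᶠ w in 𝓝[>] y, l < (f w - f y) / (w - y) - K * (w - y) :=
        (hslope.mono_left (nhdsWithin_mono _ fun w hw => ne_of_gt hw)).eventually (lt_mem_nhds hl)
      have h2 : ∀ᶠ w in 𝓝[>] y, w ∈ Ioo a b := mem_nhdsWithin_of_mem_nhds hI
      have h3 : ∀ᶠ w in 𝓝[>] y, y < w := self_mem_nhdsWithin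
      obtain ⟨w, hw, hwI, hwy⟩ := (h1.and (h2.and h3)).exists
      filter_upwards [(hcmp w hwI (ne_of_gt hwy)).eventually (lt_mem_nhds hw), hI,
        Iio_mem_nhds hwy] with s hs hsI hsw
      have h2 := hK s hsI w hwI
      have h3 : 0 < w - s := sub_pos.2 hsw
      refine hs.trans_le ?_
      rw [sub_le_iff_le_add, div_le_iff₀ h3]
      nlinarith
    · intro l hl
      have h1 : ∀ᶠ w in 𝓝[<] y, (f w - f y) / (w - y) - K * (w - y) < l :=
        (hslope.mono_left (nhdsWithin_mono _ fun w hw => ne_of_lt hw)).eventually (gt_mem_nhds hl)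
      have h2 : ∀ᶠ w in 𝓝[<] y, w ∈ Ioo a b := mem_nhdsWithin_of_mem_nhds hI
      have h3 : ∀ᶠ w in 𝓝[<] y, w < y := self_mem_nhdsWithin
      obtain ⟨w, hw, hwI, hwy⟩ := (h1.and (h2.and h3)).exists
      filter_upwards [(hcmp w hwI (ne_of_lt hwy)).eventually (gt_mem_nhds hw), hI,
        Ioi_mem_nhds hwy] with s hs hsI hsw
      have h2 := hK s hsI w hwI
      have h3 : w - s < 0 := sub_neg.2 hsw
      refine lt_of_le_of_lt ?_ hs
      rw [le_sub_iff_add_le, le_div_iff_of_neg h3]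
      nlinarith
  rw [contDiffAt_one_iff]
  refine ⟨fun y => ContinuousLinearMap.toSpanSingleton ℝ (d y), Ioo a b, isOpen_Ioo.mem_nhds hx,
    ?_, fun y hy => (hd y hy).hasFDerivAt⟩
  exact (ContinuousLinearMap.toSpanSingletonCLE (𝕜 := ℝ) (E := ℝ)).continuous.comp_continuousOn hcont

theorem HasDerivAt.hasDirDerivAt {f : ℝ → ℝ} {d x : ℝ} (h : HasDerivAt f d x) (s : ℝ) :
    HasDirDerivAt f x s (s * d) := by
  have h1 : HasDerivAt (fun τ : ℝ => x + τ * s) s 0 := by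
    simpa using ((hasDerivAt_id (0 : ℝ)).mul_const s).const_add x
  have h2 : HasDerivAt (fun τ : ℝ => f (x + τ * s)) (d * s) 0 :=
    HasDerivAt.comp (h₂ := f) 0 (by simpa using h) h1
  have h3 := (hasDerivAt_iff_tendsto_slope.1 h2).mono_left
    (nhdsWithin_mono (0 : ℝ) fun w (hw : w ∈ Ioi 0) => ne_of_gt hw)
  rw [mul_comm] at h3
  refine h3.congr fun τ => ?_
  simp [slope_def_field]

end

theorem mainTheorem6
    {V H : Type*} [NormedAddCommGroup V] [InnerProductSpace ℝ V] [CompleteSpace V]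
    [NormedAddCommGroup H] [InnerProductSpace ℝ H] [CompleteSpace H]
    {Ω : Type*} [MeasurableSpace Ω] {ρ : Measure Ω}
    (P : ControlSystem V H ρ)
    (hGelfand : P.IsGelfandTriple)
    (hGarding : P.Garding)
    (hδ₀ : 0 < P.δ₀)
    (hbounds : ∀ᵐ x ∂ρ, P.ua x < P.ub x)
    (hUad_nonempty : P.Uad.Nonempty)
    (hUad_bounded : Bornology.IsBounded P.Uad)
    (ν : ℝ) (hν : 0 < ν) (hδ : -P.δ₀ < P.delta ν) :
    (∃ d : ℝ, HasDirDerivAt P.delta ν 1 d ∧ IsLeast (P.derivValues ν) d) ∧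
    (∃ d : ℝ, HasDirDerivAt P.delta ν (-1) d ∧
      IsLeast ((fun r => -r) '' P.derivValues ν) d) ∧
    ((P.derivValues ν).Subsingleton → ContDiffAt ℝ 1 P.delta ν) := by
  obtain ⟨α, ω, hα, hω, hle⟩ := hGarding
  obtain ⟨M, hM⟩ := hUad_bounded.exists_norm_le
  have h : P.IsRegular α ω M := ⟨hGelfand, ⟨hα, hω, hle⟩, hUad_nonempty, hM⟩
  have hdelta : P.delta = fun t => P.minDist t - P.δ₀ := by
    ext t; simp [ControlSystem.minDist]
  have hpos : 0 < P.minDist ν := by unfold ControlSystem.minDist; linarith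
  have hderiv : ∀ μ, 0 < μ → 0 < P.minDist μ →
      ∃ d, HasDerivAt P.delta d μ ∧ P.derivValues μ = {d} := by
    intro μ hμ hμp
    obtain ⟨d, hd, hv⟩ := h.exists_hasDerivAt_minDist hμ hμp
    refine ⟨d, ?_, hv⟩
    rw [hdelta]
    exact hd.sub_const _
  obtain ⟨d, hd, hv⟩ := hderiv ν hν hpos
  refine ⟨⟨d, by simpa using hd.hasDirDerivAt 1, by rw [hv]; exact isLeast_singleton⟩,
    ⟨-d, by simpa using hd.hasDirDerivAt (-1), by rw [hv, image_singleton]; exact isLeast_singleton⟩,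
    fun _ => ?_⟩
  have hcont : ContinuousAt P.minDist ν := by
    have : P.minDist = fun t => P.delta t + P.δ₀ := rfl
    rw [this]
    exact (hd.add_const _).continuousAt
  -- Near `ν` the parameter and the optimal distance stay above half their values at `ν`, so one
  -- constant `K` of semiconcavity serves the whole neighbourhood.
  obtain ⟨ε, hε, hball⟩ := Metric.eventually_nhds_iff.1
    ((hcont.eventually (lt_mem_nhds (half_lt_self hpos))).and (lt_mem_nhds (half_lt_self hν)))
  have hI : ∀ μ ∈ Ioo (ν - ε) (ν + ε), P.minDist ν / 2 < P.minDist μ ∧ ν / 2 < μ := fun μ hμ =>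
    hball (by rw [Real.dist_eq, abs_lt]; constructor <;> linarith [hμ.1, hμ.2])
  obtain ⟨K, -, hK⟩ := h.exists_semiconcave (n₀ := ν / 2) (n₁ := ν + ε) (half_pos hν)
    (half_pos hpos)
  choose! D hD hDv using fun μ (hμ : μ ∈ Ioo (ν - ε) (ν + ε)) =>
    hderiv μ ((half_pos hν).trans (hI μ hμ).2) ((half_pos hpos).trans (hI μ hμ).1)
  refine contDiffAt_one_of_semiconcave (a := ν - ε) (b := ν + ε) (d := D) (K := K)
    ⟨by linarith, by linarith⟩ hD fun y hy w hw => ?_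
  have := hK y ⟨(hI y hy).2.le, hy.2.le⟩ (hI y hy).1.le (D y) (by rw [hDv y hy]; rfl) w
    ⟨(hI w hw).2.le, hw.2.le⟩
  simp only [hdelta]
  linarith
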